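/- Let $a\in[0,1)$, $b\in[0,\tfrac12]$, $c\in[0,1]$, let $T=\{(x,y): x,y\ge 0,\ x+y\le 1\}$ (the simplex $S^2$ in the coordinates $(x,y)$, with $z=1-x-y$), and let $V:\mathbb R^2\to\mathbb R^2$ be the symmetric 2-Volterra operator $$V(x,y)=\bigl(x(2c+(a-2c)x+2(b-c)y),\ y(2c+2(b-c)x+(a-2c)y)\bigr),$$ which maps $T$ into $T$. Fixed points are fixed points in $T$, trajectories are $V^n(p)$ with $p\in T$, and a set $M$ is invariant if $V(M)\subseteq M$. A fixed point is hyperbolic if no (complex) eigenvalue of the Jacobian matrix of $V$ there lies on the unit circle; it is attracting (a repeller) if all the eigenvalues have modulus $<1$ ($>1$), and a saddle if it is hyperbolic and neither. Put $$\lambda_0=(0,0),\quad \lambda_1=\Bigl(0,\tfrac{2c-1}{2c-a}\Bigr),\quad \lambda_2=\Bigl(\tfrac{2c-1}{2c-a},0\Bigr),\quad \lambda_3=\Bigl(\tfrac{1-2c}{a+2b-4c},\tfrac{1-2c}{a+2b-4c}\Bigr),$$ and let $M_0,M_1,M_=,M_>,M_<$ be the sets of the points of $T$ with $x=0$, $y=0$,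 $x=y$, $x>y$, $x<y$. (i) If $c\le\frac12$, then $\lambda_0$ is the unique fixed point, and every trajectory converges to $\lambda_0$. (ii) $M_0$, $M_1$, $M_=$, $M_>\cup M_=$ and $M_<\cup M_=$ are invariant. If $a>0$, then $M_>$ and $M_<$ are invariant. If $c>0$, then $M_>\cap\{x+y<1\}$ and $M_<\cap\{x+y<1\}$ are invariant. (iii) If $c>\frac12$ and $a\ne 2b$, then there are exactly four fixed points, $\lambda_0,\lambda_1,\lambda_2,\lambda_3$. The point $\lambda_0$ is a repeller. If $a>2b$, then $\lambda_1,\lambda_2$ are attracting and $\lambda_3$ is a saddle; if $a<2b$, then $\lambda_1,\lambda_2$ are saddles and $\lambda_3$ is attracting. (iv) If $c>\frac12$ and $a=2b$, then the set of fixed points is $\{\lambda_0\}\cup F$, where $\lambda_0$ is a repeller and $F=\{(x,y)\in T: x+y=\frac{2c-1}{2(c-b)}\}$ has the cardinality of the continuum. For every $\nu\in[0,\infty)$ the set $I_\nu=\{(x,y)\in T:y=\nu x\}$ is invariant, the point $\bar\lambda_\nu=\Bigl(\frac{2c-1}{2(c-b)(1+\nu)},\frac{(2c-1)\nu}{2(c-b)(1+\nu)}\Bigr)$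 lies in $I_\nu\cap F$, and the trajectory of every $(x^0,y^0)\in T$ with $x^0\ne0$ and $y^0/x^0=\nu$ converges to $\bar\lambda_\nu$, provided that $b>0$ or $x^0+y^0<1$. The trajectory of every $(0,y^0)\in T$ with $y^0\neq0$ converges to $\lambda_1$, provided that $b>0$ or $y^0<1$. (v) Let $c>\frac12$. Consider $V$ as a map of $T$. The stable set of a fixed point $P$ consists of the points of $T$ whose trajectory converges to $P$; its unstable set consists of the points that have a backward orbit in $T$ (a sequence $u_0,u_1,\dots$ in $T$ with $V(u_{n+1})=u_n$) that starts at the point and converges to $P$. A set $S$ is the stable (unstable) manifold of $P$ if it is the stable (unstable) set of $P$; if moreover, for some $\varepsilon>0$, it contains every point of $T$ whose trajectory (that has some backward orbit in $T$ which) stays within distance less than $\varepsilon$ of $P$; and if, near $P$, it is the part in $T$ of a $C^\infty$ curve with non-vanishing derivative through $P$, whose tangent vector at $P$ is an eigenvector of the Jacobian matrix for an eigenvalue of modulus $<1$ ($>1$). If $a<2b$, then $M_0\setminus\{\lambda_0\}$ (resp. $M_1\setminus\{\lambda_0\}$) is the stable manifold of the saddle $\lambda_1$ (resp. $\lambda_2$),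 where for $a=0$ the end point $(0,1)$ (resp. $(1,0)$) has to be removed as well. If $a>2b$, then $M_=\setminus\{\lambda_0\}$ is the stable manifold of the saddle $\lambda_3$. If $a\ne2b$, there is a simple arc $\Gamma\subset T$ with end points $\lambda_1$ and $\lambda_2$ that passes through $\lambda_3$ and satisfies $V(\Gamma)=\Gamma$, such that: if $a<2b$, then the sub-arc from $\lambda_1$ to $\lambda_3$ without $\lambda_3$ is the unstable manifold of $\lambda_1$, and the sub-arc from $\lambda_2$ to $\lambda_3$ without $\lambda_3$ is the unstable manifold of $\lambda_2$; if $a>2b$, then $\Gamma\setminus\{\lambda_1,\lambda_2\}$ is the unstable manifold of $\lambda_3$. -/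

import Mathlib

open Set Filter Topology
open scoped ContDiff

namespace TwoVolterra

/-! ### Fixed points of smooth self-maps and their types -/

/-- Jacobian matrix of `F : ℝ^m → ℝ^m` at `P`. -/
noncomputable def jacobian {m : ℕ} (F : (Fin m → ℝ) → (Fin m → ℝ)) (P : Fin m → ℝ) :
    Matrix (Fin m) (Fin m) ℝ :=
  LinearMap.toMatrix' ((fderiv ℝ F P : (Fin m → ℝ) →L[ℝ] (Fin m → ℝ)) :
    (Fin m → ℝ) →ₗ[ℝ] (Fin m → ℝ))

/-- The (complex) eigenvalues of the Jacobian matrix of `F` at `P`. -/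
def multipliers {m : ℕ} (F : (Fin m → ℝ) → (Fin m → ℝ)) (P : Fin m → ℝ) : Set ℂ :=
  spectrum ℂ ((jacobian F P).map (algebraMap ℝ ℂ))

/-- A hyperbolic fixed point: no eigenvalue of the Jacobian lies on the unit circle. -/
def IsHyperbolic {m : ℕ} (F : (Fin m → ℝ) → (Fin m → ℝ)) (P : Fin m → ℝ) : Prop :=
  F P = P ∧ DifferentiableAt ℝ F P ∧ ∀ μ ∈ multipliers F P, ‖μ‖ ≠ 1

/-- An attracting fixed point: all eigenvalues of the Jacobian have modulus `< 1`. -/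
def IsAttracting {m : ℕ} (F : (Fin m → ℝ) → (Fin m → ℝ)) (P : Fin m → ℝ) : Prop :=
  IsHyperbolic F P ∧ ∀ μ ∈ multipliers F P, ‖μ‖ < 1

/-- A repelling fixed point: all eigenvalues of the Jacobian have modulus `> 1`. -/
def IsRepelling {m : ℕ} (F : (Fin m → ℝ) → (Fin m → ℝ)) (P : Fin m → ℝ) : Prop :=
  IsHyperbolic F P ∧ ∀ μ ∈ multipliers F P, 1 < ‖μ‖

/-- A saddle: a hyperbolic fixed point that is neither attracting nor repelling. -/
def IsSaddle {m : ℕ} (F : (Fin m → ℝ) → (Fin m → ℝ)) (P : Fin m → ℝ) : Prop :=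
  IsHyperbolic F P ∧ ¬ IsAttracting F P ∧ ¬ IsRepelling F P

/-! ### Stable and unstable manifolds

`D` is the phase space, a forward invariant set of `F`; `F` itself need not be invertible, so that
inverse iterates are replaced by backward orbits in `D`. -/

/-- `u` is a backward orbit `… ↦ u 2 ↦ u 1 ↦ u 0` of `F` inside `D`. -/
def IsBackwardOrbit {m : ℕ} (F : (Fin m → ℝ) → (Fin m → ℝ)) (D : Set (Fin m → ℝ))
    (u : ℕ → (Fin m → ℝ)) : Prop :=
  ∀ n, u n ∈ D ∧ F (u (n + 1)) = u n

/-- The points of `D` whose trajectory converges to `P`. -/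
def stableSet {m : ℕ} (F : (Fin m → ℝ) → (Fin m → ℝ)) (D : Set (Fin m → ℝ)) (P : Fin m → ℝ) :
    Set (Fin m → ℝ) :=
  {q | q ∈ D ∧ Tendsto (fun n : ℕ => F^[n] q) atTop (𝓝 P)}

/-- The points that have a backward orbit in `D` converging to `P`. -/
def unstableSet {m : ℕ} (F : (Fin m → ℝ) → (Fin m → ℝ)) (D : Set (Fin m → ℝ)) (P : Fin m → ℝ) :
    Set (Fin m → ℝ) :=
  {q | ∃ u : ℕ → (Fin m → ℝ), IsBackwardOrbit F D u ∧ u 0 = q ∧ Tendsto u atTop (𝓝 P)}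

/-- Inside `D`, the set `S` is near `P` a smooth regular curve through `P` with tangent vector `v`
at `P`. (If `P` is a boundary point of `D`, the curve may leave `D`.) -/
def IsSmoothCurveAt {m : ℕ} (D S : Set (Fin m → ℝ)) (P v : Fin m → ℝ) : Prop :=
  ∃ ε : ℝ, 0 < ε ∧ ∃ γ : ℝ → (Fin m → ℝ),
    ContDiffOn ℝ ∞ γ (Ioo (-ε) ε) ∧ (∀ t ∈ Ioo (-ε) ε, deriv γ t ≠ 0) ∧
    γ 0 = P ∧ deriv γ 0 = v ∧
    ∃ U ∈ 𝓝 P, S ∩ U = (γ '' Ioo (-ε) ε) ∩ D ∩ U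

/-- `S` is the one-dimensional (global) stable manifold of `P` for the map `F` on `D`: it consists
of the points with trajectory tending to `P`; it contains every point whose trajectory
stays close to `P`; near `P` it is a smooth curve, tangent to a stable eigenvector. -/
def IsStableManifold {m : ℕ} (F : (Fin m → ℝ) → (Fin m → ℝ)) (D : Set (Fin m → ℝ))
    (P : Fin m → ℝ) (S : Set (Fin m → ℝ)) : Prop :=
  S = stableSet F D P ∧
  (∃ ε : ℝ, 0 < ε ∧ ∀ q ∈ D, (∀ n : ℕ, dist (F^[n] q) P < ε) → q ∈ S) ∧
  ∃ (v : Fin m → ℝ) (μ : ℝ), |μ| < 1 ∧ (jacobian F P).mulVec v = μ • v ∧ IsSmoothCurveAt D S P v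

/-- `S` is the one-dimensional (global) unstable manifold of `P` for the map `F` on `D`: it
consists of the points with a backward orbit tending to `P`; it contains every point with a
backward orbit that stays close to `P`; near `P` it is a smooth curve, tangent to an unstable
eigenvector. -/
def IsUnstableManifold {m : ℕ} (F : (Fin m → ℝ) → (Fin m → ℝ)) (D : Set (Fin m → ℝ))
    (P : Fin m → ℝ) (S : Set (Fin m → ℝ)) : Prop :=
  S = unstableSet F D P ∧
  (∃ ε : ℝ, 0 < ε ∧ ∀ u : ℕ → (Fin m → ℝ), IsBackwardOrbit F D u →
    (∀ n : ℕ, dist (u n) P < ε) → u 0 ∈ S) ∧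
  ∃ (v : Fin m → ℝ) (μ : ℝ), 1 < |μ| ∧ (jacobian F P).mulVec v = μ • v ∧ IsSmoothCurveAt D S P v

/-! ### The operator -/

/-- The symmetric 2-Volterra operator, in the coordinates `(x, y)` of
`(x, y, 1 - x - y) ∈ S²`. -/
def V (a b c : ℝ) (p : Fin 2 → ℝ) : Fin 2 → ℝ :=
  ![p 0 * (2 * c + (a - 2 * c) * p 0 + 2 * (b - c) * p 1),
    p 1 * (2 * c + 2 * (b - c) * p 0 + (a - 2 * c) * p 1)]

/-- The simplex `S²` in the coordinates `(x, y)`. -/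
def T : Set (Fin 2 → ℝ) := {p | 0 ≤ p 0 ∧ 0 ≤ p 1 ∧ p 0 + p 1 ≤ 1}

/-- The fixed points of `V` in the simplex. -/
def fixedSet (a b c : ℝ) : Set (Fin 2 → ℝ) := {p | p ∈ T ∧ V a b c p = p}

/-- The points of the simplex with `x = 0`. -/
def MZero : Set (Fin 2 → ℝ) := {p | p ∈ T ∧ p 0 = 0}
/-- The points of the simplex with `y = 0`. -/
def MOne : Set (Fin 2 → ℝ) := {p | p ∈ T ∧ p 1 = 0}
/-- The points of the simplex with `x = y`. -/
def MEq : Set (Fin 2 → ℝ) := {p | p ∈ T ∧ p 0 = p 1}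
/-- The points of the simplex with `x > y`. -/
def MGt : Set (Fin 2 → ℝ) := {p | p ∈ T ∧ p 0 > p 1}
/-- The points of the simplex with `x < y`. -/
def MLt : Set (Fin 2 → ℝ) := {p | p ∈ T ∧ p 0 < p 1}

def lam0 : Fin 2 → ℝ := ![0, 0]
noncomputable def lam1 (a c : ℝ) : Fin 2 → ℝ := ![0, (2 * c - 1) / (2 * c - a)]
noncomputable def lam2 (a c : ℝ) : Fin 2 → ℝ := ![(2 * c - 1) / (2 * c - a), 0]
noncomputable def lam3 (a b c : ℝ) : Fin 2 → ℝ :=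
  ![(1 - 2 * c) / (a + 2 * b - 4 * c), (1 - 2 * c) / (a + 2 * b - 4 * c)]

/-- The segment of fixed points in the case `a = 2b`. -/
def segF (b c : ℝ) : Set (Fin 2 → ℝ) := {p | p ∈ T ∧ p 0 + p 1 = (2 * c - 1) / (2 * (c - b))}

/-- The part of the ray `y = νx` in the simplex. -/
def ray (ν : ℝ) : Set (Fin 2 → ℝ) := {p | p ∈ T ∧ p 1 = ν * p 0}

/-- The limit point on the ray `y = νx` in the case `a = 2b`. -/
noncomputable def lamBar (b c ν : ℝ) : Fin 2 → ℝ :=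
  ![(2 * c - 1) / (2 * (c - b) * (1 + ν)), (2 * c - 1) * ν / (2 * (c - b) * (1 + ν))]

end TwoVolterra

/-!
In the coordinates `s = x + y`, `d = x - y` the operator reads
`d ↦ d (2c - (2c - a) s)`, `s ↦ 2c s - K s² + k d²` with `K = 2c - a/2 - b` and `k = a/2 - b`, and
with `z = 1 - x - y` the coordinate `x` is multiplied by `2cz + ax + 2by` in every step.

For `c ≤ 1/2` the mass `s` drops by at least `(1 - a) s² / 2` in each step, hence tends to `0`. For
`c > 1/2` the edges and the diagonal (for `a = 2b`: all rays) are invariant, and on them `V` is a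
logistic map, whose orbits converge to its positive fixed point (`tendsto_logistic`). These lines
are the stable manifolds of the saddles, because the coordinate transverse to them is expanded near
the saddle (`isStableManifold_of_line`).

The unstable manifold of a saddle is found as an entire curve `γ` with `V (γ t) = γ (μ t)`, where
`μ > 1` is the unstable multiplier (`exists_unstable_curve`): the equation determines the power
series, as no `μⁿ` with `n ≥ 2` is a multiplier, and the factor `μ⁻ⁿ` in the recursion makes the
coefficients decay faster than every geometric sequence. The map contracts the distance to the curve
near the saddle, so that backward orbits that stay there lie on the curve
(`mem_unstable_curve_of_backward_orbit`).

Globally, the equation `V (γ t) = γ (μ t)` and its derivative carry every invariant region and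
every invariant cone of tangent vectors from a neighbourhood of `t = 0` to the whole curve
(`forall_of_scaling`). For `a < 2b` the curve of `λ₂` has, for `t ≥ 0`, `d` decreasing and `s`
increasing; for `a > 2b` the curve of `λ₃` has `x` increasing and `y` decreasing. In both cases the
curve is simple and converges as the parameter tends to `∞` (for `a > 2b`, also to `-∞`), and its
limits are fixed points, which monotonicity identifies. The arc consists of these curves, their
limits and, for `a < 2b`, the mirror image.
-/

namespace TwoVolterra

/-! ### Entire solutions of the conjugacy equation along an unstable direction -/

/-- A power series whose coefficients decay faster than every geometric sequence has a smooth sum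
on the whole line. -/
theorem contDiff_tsum_mul_pow {a : ℕ → ℝ} (ha : ∀ ρ > 0, ∃ δ, ∀ n, |a n| ≤ δ * ρ ^ n) :
    ContDiff ℝ ∞ (fun t : ℝ => ∑' n, a n * t ^ n) := by
  have hr : (FormalMultilinearSeries.ofScalars ℝ a).radius = ⊤ := by
    refine ENNReal.eq_top_of_forall_nnreal_le fun r => ?_
    obtain ⟨δ, hδ⟩ := ha (1 / (r + 1)) (by positivity)
    refine FormalMultilinearSeries.le_radius_of_bound _ δ fun n => ?_
    rw [FormalMultilinearSeries.ofScalars_norm, Real.norm_eq_abs]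
    have hδ0 : 0 ≤ δ := by simpa using (abs_nonneg _).trans (hδ 0)
    calc |a n| * (r : ℝ) ^ n ≤ δ * (1 / (r + 1)) ^ n * (r : ℝ) ^ n := by gcongr; exact hδ n
      _ = δ * ((r : ℝ) / (r + 1)) ^ n := by rw [mul_assoc, ← mul_pow]; congr 2; ring
      _ ≤ δ * 1 := by
        gcongr
        exact pow_le_one₀ (by positivity) ((div_le_one (by positivity)).2 (by linarith))
      _ = δ := mul_one δ
  have h := (FormalMultilinearSeries.ofScalars ℝ a).hasFPowerSeriesOnBall (by rw [hr]; simp)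
  rw [hr] at h
  have h2 := h.analyticOnNhd
  rw [Metric.eball_top] at h2
  have h3 := h2.contDiff (n := ∞)
  convert h3 using 1
  ext t
  have := FormalMultilinearSeries.ofScalars_sum_eq (𝕜 := ℝ) (E := ℝ) a t
  simp only [smul_eq_mul] at this
  rw [← this, FormalMultilinearSeries.ofScalarsSum]

theorem summable_norm_mul_pow {a : ℕ → ℝ} (ha : ∀ ρ > 0, ∃ δ, ∀ n, |a n| ≤ δ * ρ ^ n) (t : ℝ) :
    Summable fun n => ‖a n * t ^ n‖ := by
  obtain ⟨δ, hδ⟩ := ha (1 / (2 * (|t| + 1))) (by positivity)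
  have hδ0 : 0 ≤ δ := by simpa using (abs_nonneg _).trans (hδ 0)
  refine Summable.of_nonneg_of_le (fun _ => norm_nonneg _) (fun n => ?_)
    ((summable_geometric_two).mul_left δ)
  rw [norm_mul, norm_pow, Real.norm_eq_abs, Real.norm_eq_abs]
  calc |a n| * |t| ^ n ≤ δ * (1 / (2 * (|t| + 1))) ^ n * (|t| + 1) ^ n := by
        gcongr
        · exact hδ n
        · linarith
    _ = δ * (1 / 2) ^ n := by
        rw [mul_assoc, ← mul_pow]; congr 2; field_simp

/-- The coefficients of the power series `A`, `B` for which `(t * A t, t * B t)` solves the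
conjugacy equation; the index is shifted by one against the powers of `t`, so that each step
only refers to earlier coefficients. -/
noncomputable def unstableCoeff (μ ν e p₁ p₂ p₃ q₁ q₂ q₃ : ℝ) : ℕ → ℝ × ℝ
  | 0 => (1, e / (μ - ν))
  | n + 1 =>
    let u : Fin (n + 1) → ℝ × ℝ := fun k => unstableCoeff μ ν e p₁ p₂ p₃ q₁ q₂ q₃ k
    let w : Fin (n + 1) → ℝ × ℝ := fun k => unstableCoeff μ ν e p₁ p₂ p₃ q₁ q₂ q₃ (n - k)
    let a := (∑ k, (p₁ * ((u k).1 * (w k).1) + p₂ * ((u k).1 * (w k).2)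
      + p₃ * ((u k).2 * (w k).2))) / (μ ^ (n + 2) - μ)
    let b := (e * a + ∑ k, (q₁ * ((u k).1 * (w k).1) + q₂ * ((u k).1 * (w k).2)
      + q₃ * ((u k).2 * (w k).2))) / (μ ^ (n + 2) - ν)
    (a, b)
  termination_by n => n
  decreasing_by all_goals (have := k.isLt; omega)

/-- The conjugacy equation on the level of coefficients. -/
theorem exists_unstableCoeff {μ ν : ℝ} (hμ : 1 < μ) (hν : ν < 1) (e p₁ p₂ p₃ q₁ q₂ q₃ : ℝ) :
    ∃ a b : ℕ → ℝ, a 0 = 1 ∧ b 0 = e / (μ - ν) ∧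
      (∀ n, (μ ^ (n + 2) - μ) * a (n + 1) = ∑ k ∈ Finset.range (n + 1),
        (p₁ * (a k * a (n - k)) + p₂ * (a k * b (n - k)) + p₃ * (b k * b (n - k)))) ∧
      (∀ n, (μ ^ (n + 2) - ν) * b (n + 1) = e * a (n + 1) + ∑ k ∈ Finset.range (n + 1),
        (q₁ * (a k * a (n - k)) + q₂ * (a k * b (n - k)) + q₃ * (b k * b (n - k)))) := by
  have h1 : ∀ n : ℕ, μ < μ ^ (n + 2) := fun n => by
    have : 1 < μ ^ (n + 1) := one_lt_pow₀ hμ (by omega)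
    have := mul_lt_mul_of_pos_left this (by linarith : 0 < μ)
    rwa [mul_one, ← pow_succ'] at this
  refine ⟨fun n => (unstableCoeff μ ν e p₁ p₂ p₃ q₁ q₂ q₃ n).1,
    fun n => (unstableCoeff μ ν e p₁ p₂ p₃ q₁ q₂ q₃ n).2, ?_, ?_, fun n => ?_, fun n => ?_⟩
  · simp [unstableCoeff]
  · simp [unstableCoeff]
  · beta_reduce
    rw [unstableCoeff]
    simp only
    rw [mul_div_cancel₀ _ (by linarith [h1 n]),
      Fin.sum_univ_eq_sum_range (fun k => p₁ * ((unstableCoeff μ ν e p₁ p₂ p₃ q₁ q₂ q₃ k).1 *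
        (unstableCoeff μ ν e p₁ p₂ p₃ q₁ q₂ q₃ (n - k)).1) + p₂ *
        ((unstableCoeff μ ν e p₁ p₂ p₃ q₁ q₂ q₃ k).1 *
        (unstableCoeff μ ν e p₁ p₂ p₃ q₁ q₂ q₃ (n - k)).2) + p₃ *
        ((unstableCoeff μ ν e p₁ p₂ p₃ q₁ q₂ q₃ k).2 *
        (unstableCoeff μ ν e p₁ p₂ p₃ q₁ q₂ q₃ (n - k)).2))]
  · beta_reduce
    rw [unstableCoeff]
    simp only
    rw [mul_div_cancel₀ _ (by linarith [h1 n]),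
      Fin.sum_univ_eq_sum_range (fun k => q₁ * ((unstableCoeff μ ν e p₁ p₂ p₃ q₁ q₂ q₃ k).1 *
        (unstableCoeff μ ν e p₁ p₂ p₃ q₁ q₂ q₃ (n - k)).1) + q₂ *
        ((unstableCoeff μ ν e p₁ p₂ p₃ q₁ q₂ q₃ k).1 *
        (unstableCoeff μ ν e p₁ p₂ p₃ q₁ q₂ q₃ (n - k)).2) + q₃ *
        ((unstableCoeff μ ν e p₁ p₂ p₃ q₁ q₂ q₃ k).2 *
        (unstableCoeff μ ν e p₁ p₂ p₃ q₁ q₂ q₃ (n - k)).2))]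

/-- A nonnegative sequence that satisfies a convolution inequality damped by `μ⁻ⁿ` decays faster
than every geometric sequence. A first geometric bound comes from the convolution alone; the
damping then improves the ratio by the factor `√μ` over and over. -/
theorem superexponential_decay {m : ℕ → ℝ} {μ C : ℝ} (hμ : 1 < μ) (hm : ∀ n, 0 ≤ m n)
    (h : ∀ n, μ ^ (n + 1) * m (n + 1) ≤ C * ∑ k ∈ Finset.range (n + 1), m k * m (n - k)) :
    ∀ ρ > 0, ∃ δ, ∀ n, m n ≤ δ * ρ ^ n := by
  have hμ0 : 0 < μ := by linarith
  wlog hC : 0 < C generalizing C with H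
  · refine H (C := 1) (fun n => (h n).trans ?_) one_pos
    gcongr
    · exact Finset.sum_nonneg fun k _ => mul_nonneg (hm _) (hm _)
    · linarith
  set r := Real.sqrt μ with hr
  have hr1 : 1 < r := Real.lt_sqrt_of_sq_lt (by linarith)
  have hrr : r * r = μ := Real.mul_self_sqrt hμ0.le
  have hr0 : 0 < r := by linarith
  -- `n r⁻ⁿ` is bounded
  obtain ⟨B, hB⟩ : ∃ B > 0, ∀ n : ℕ, (n : ℝ) ≤ B * r ^ n := by
    have ht := tendsto_self_mul_const_pow_of_lt_one (r := r⁻¹) (by positivity)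
      (inv_lt_one_of_one_lt₀ hr1)
    obtain ⟨B, hB⟩ := ht.bddAbove_range
    refine ⟨max B 1, by positivity, fun n => ?_⟩
    have := hB ⟨n, rfl⟩
    simp only [inv_pow] at this
    rw [← div_eq_mul_inv, div_le_iff₀ (by positivity)] at this
    exact this.trans (by gcongr; exact le_max_left _ _)
  obtain ⟨hB0, hB⟩ := hB
  have conv : ∀ (δ ρ : ℝ) (n : ℕ), 0 ≤ δ → 0 ≤ ρ → (∀ k ≤ n, m k ≤ δ * ρ ^ k) →
      μ ^ (n + 1) * m (n + 1) ≤ C * (B * r ^ (n + 1) * (δ * δ * ρ ^ n)) := by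
    intro δ ρ n hδ hρ hk
    refine (h n).trans ?_
    gcongr
    calc ∑ k ∈ Finset.range (n + 1), m k * m (n - k)
        ≤ ∑ k ∈ Finset.range (n + 1), δ * δ * ρ ^ n := by
          refine Finset.sum_le_sum fun k hkn => ?_
          have hkn' : k ≤ n := by simpa [Nat.lt_succ_iff] using hkn
          calc m k * m (n - k) ≤ (δ * ρ ^ k) * (δ * ρ ^ (n - k)) :=
                mul_le_mul (hk _ hkn') (hk _ (by omega)) (hm _) (by positivity)
            _ = δ * δ * (ρ ^ k * ρ ^ (n - k)) := by ring
            _ = δ * δ * ρ ^ n := by rw [← pow_add, Nat.add_sub_cancel' hkn']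
      _ = ((n + 1 : ℕ) : ℝ) * (δ * δ * ρ ^ n) := by simp
      _ ≤ B * r ^ (n + 1) * (δ * δ * ρ ^ n) := by gcongr; exact hB _
  have hμr : ∀ n, μ ^ n = r ^ n * r ^ n := fun n => by rw [← mul_pow, hrr]
  have conv' : ∀ (δ ρ : ℝ) (n : ℕ), 0 ≤ δ → 0 ≤ ρ → (∀ k ≤ n, m k ≤ δ * ρ ^ k) →
      r ^ (n + 1) * m (n + 1) ≤ C * B * δ * (δ * ρ ^ n) := by
    intro δ ρ n hδ hρ hk
    have := conv δ ρ n hδ hρ hk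
    rw [hμr] at this
    refine le_of_mul_le_mul_left ?_ (pow_pos hr0 (n + 1))
    linarith
  -- the first geometric bound
  have base : ∃ ρ > 0, ∃ δ, ∀ n, m n ≤ δ * ρ ^ n := by
    refine ⟨C * B * (m 0 + 1), by have := hm 0; positivity, m 0 + 1, fun n => ?_⟩
    induction n using Nat.strong_induction_on with
    | _ n ih =>
      rcases n with _ | n
      · simp
      · have := conv' (m 0 + 1) (C * B * (m 0 + 1)) n (by linarith [hm 0])
          (by have := hm 0; positivity) (fun k hk => ih k (by omega))
        have h1 : m (n + 1) ≤ r ^ (n + 1) * m (n + 1) :=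
          le_mul_of_one_le_left (hm _) (one_le_pow₀ hr1.le)
        rw [pow_succ]
        linarith
  have step : ∀ ρ > 0, (∃ δ, ∀ n, m n ≤ δ * ρ ^ n) → ∃ δ, ∀ n, m n ≤ δ * (ρ / r) ^ n := by
    rintro ρ hρ ⟨δ, hδ⟩
    have hδ0 : 0 ≤ δ := by simpa using (hm 0).trans (hδ 0)
    refine ⟨max δ (C * B * δ * δ / ρ), fun n => ?_⟩
    rcases n with _ | n
    · simpa using Or.inl (by simpa using hδ 0)
    · have := conv' δ ρ n hδ0 hρ.le (fun k _ => hδ k)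
      rw [mul_comm, ← le_div_iff₀ (by positivity)] at this
      refine this.trans ?_
      calc C * B * δ * (δ * ρ ^ n) / r ^ (n + 1)
          = (C * B * δ * δ / ρ) * (ρ / r) ^ (n + 1) := by
            rw [div_pow, pow_succ ρ]; field_simp
        _ ≤ _ := by gcongr; exact le_max_right _ _
  obtain ⟨ρ₀, hρ₀, hb⟩ := base
  have all : ∀ j : ℕ, ∃ δ, ∀ n, m n ≤ δ * (ρ₀ / r ^ j) ^ n := by
    intro j
    induction j with
    | zero => simpa using hb
    | succ j ih =>
      have := step _ (by positivity) ih
      rwa [div_div, ← pow_succ] at this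
  intro ρ hρ
  obtain ⟨j, hj⟩ := pow_unbounded_of_one_lt (ρ₀ / ρ) hr1
  obtain ⟨δ, hδ⟩ := all j
  have hδ0 : 0 ≤ δ := by simpa using (hm 0).trans (hδ 0)
  refine ⟨δ, fun n => (hδ n).trans ?_⟩
  gcongr
  rw [div_lt_iff₀ hρ] at hj
  rw [div_le_iff₀ (by positivity)]
  linarith

/-- The unstable manifold of a planar quadratic map with a fixed point at the origin and lower
triangular linear part, the unstable eigenvalue `μ` standing first: it is the image of an entire
curve `(Y, X)` along which the map acts as the multiplication of the parameter by `μ`. The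
power series of the curve is determined coefficient by coefficient, because no power `μⁿ` with
`n ≥ 2` is an eigenvalue. -/
theorem exists_unstable_curve {μ ν : ℝ} (hμ : 1 < μ) (hν : ν < 1)
    (e p₁ p₂ p₃ q₁ q₂ q₃ : ℝ) :
    ∃ Y X : ℝ → ℝ, ContDiff ℝ ∞ Y ∧ ContDiff ℝ ∞ X ∧ Y 0 = 0 ∧ X 0 = 0 ∧
      HasDerivAt Y 1 0 ∧ HasDerivAt X (e / (μ - ν)) 0 ∧
      (∀ t, Y (μ * t) = μ * Y t + (p₁ * (Y t * Y t) + p₂ * (Y t * X t) + p₃ * (X t * X t))) ∧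
      (∀ t, X (μ * t) = ν * X t + e * Y t +
        (q₁ * (Y t * Y t) + q₂ * (Y t * X t) + q₃ * (X t * X t))) := by
  obtain ⟨a, b, ha0, hb0, ha, hb⟩ := exists_unstableCoeff hμ hν e p₁ p₂ p₃ q₁ q₂ q₃
  have hμ0 : 0 < μ := by linarith
  have hμ1 : 0 < μ - 1 := by linarith
  -- both denominators dominate `(μ - 1) μⁿ⁺¹`
  have den₁ : ∀ n : ℕ, (μ - 1) * μ ^ (n + 1) ≤ μ ^ (n + 2) - μ := fun n => by
    have : μ ≤ μ ^ (n + 1) := le_self_pow₀ hμ.le (by omega)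
    have h2 : μ ^ (n + 2) = μ * μ ^ (n + 1) := by rw [← pow_succ']
    rw [h2]; linarith
  have den₂ : ∀ n : ℕ, (μ - 1) * μ ^ (n + 1) ≤ μ ^ (n + 2) - ν := fun n => by
    linarith [den₁ n]
  set q : ℝ := |p₁| + |p₂| + |p₃| + |q₁| + |q₂| + |q₃| with hq
  have hdecay : ∀ ρ > 0, ∃ δ, ∀ n, |a n| + |b n| ≤ δ * ρ ^ n := by
    refine superexponential_decay (C := (q + |e| * (q / (μ - 1)) + q) / (μ - 1)) hμ
      (fun n => by positivity) (fun n => ?_)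
    set S := ∑ k ∈ Finset.range (n + 1), (|a k| + |b k|) * (|a (n - k)| + |b (n - k)|) with hS
    have hS0 : 0 ≤ S := Finset.sum_nonneg fun k _ => by positivity
    have hq0 : 0 ≤ q := by positivity
    have quad : ∀ c₁ c₂ c₃ : ℝ, |c₁| + |c₂| + |c₃| ≤ q →
        |∑ k ∈ Finset.range (n + 1), (c₁ * (a k * a (n - k)) + c₂ * (a k * b (n - k))
          + c₃ * (b k * b (n - k)))| ≤ q * S := by
      intro c₁ c₂ c₃ hc
      rw [hS, Finset.mul_sum]
      refine (Finset.abs_sum_le_sum_abs _ _).trans (Finset.sum_le_sum fun k _ => ?_)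
      refine (abs_add_three _ _ _).trans ?_
      simp only [abs_mul]
      set a₁ := |a k|
      set a₂ := |a (n - k)|
      set b₁ := |b k|
      set b₂ := |b (n - k)|
      have : 0 ≤ a₁ := abs_nonneg _
      have : 0 ≤ a₂ := abs_nonneg _
      have : 0 ≤ b₁ := abs_nonneg _
      have : 0 ≤ b₂ := abs_nonneg _
      calc |c₁| * (a₁ * a₂) + |c₂| * (a₁ * b₂) + |c₃| * (b₁ * b₂)
          ≤ |c₁| * ((a₁ + b₁) * (a₂ + b₂)) + |c₂| * ((a₁ + b₁) * (a₂ + b₂))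
            + |c₃| * ((a₁ + b₁) * (a₂ + b₂)) := by
            gcongr <;> linarith
        _ = (|c₁| + |c₂| + |c₃|) * ((a₁ + b₁) * (a₂ + b₂)) := by ring
        _ ≤ q * ((a₁ + b₁) * (a₂ + b₂)) := by gcongr
    have hP := quad p₁ p₂ p₃ (by rw [hq]; linarith [abs_nonneg q₁, abs_nonneg q₂, abs_nonneg q₃])
    have hQ := quad q₁ q₂ q₃ (by rw [hq]; linarith [abs_nonneg p₁, abs_nonneg p₂, abs_nonneg p₃])
    rw [← ha n] at hP
    have hpow : 1 ≤ μ ^ (n + 1) := one_le_pow₀ hμ.le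
    have hpos : 0 < (μ - 1) * μ ^ (n + 1) := by positivity
    have hA : (μ - 1) * μ ^ (n + 1) * |a (n + 1)| ≤ q * S := by
      rw [abs_mul, abs_of_pos (hpos.trans_le (den₁ n))] at hP
      exact (mul_le_mul_of_nonneg_right (den₁ n) (abs_nonneg _)).trans hP
    have hA' : |a (n + 1)| ≤ q / (μ - 1) * S := by
      rw [div_mul_eq_mul_div, le_div_iff₀ hμ1]
      refine le_trans ?_ hA
      rw [mul_comm]
      refine mul_le_mul_of_nonneg_right ?_ (abs_nonneg _)
      exact le_mul_of_one_le_right hμ1.le hpow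
    have hB : (μ - 1) * μ ^ (n + 1) * |b (n + 1)| ≤ |e| * (q / (μ - 1) * S) + q * S := by
      have h1 : |(μ ^ (n + 2) - ν) * b (n + 1)| ≤ |e| * |a (n + 1)| + q * S := by
        rw [hb n, ← abs_mul]
        exact (abs_add_le _ _).trans (by gcongr)
      rw [abs_mul, abs_of_pos (hpos.trans_le (den₂ n))] at h1
      refine (mul_le_mul_of_nonneg_right (den₂ n) (abs_nonneg _)).trans (h1.trans ?_)
      gcongr
    rw [div_mul_eq_mul_div, le_div_iff₀ hμ1]
    linarith
  have hda : ∀ ρ > 0, ∃ δ, ∀ n, |a n| ≤ δ * ρ ^ n := fun ρ hρ =>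
    (hdecay ρ hρ).imp fun δ h n => by linarith [h n, abs_nonneg (b n)]
  have hdb : ∀ ρ > 0, ∃ δ, ∀ n, |b n| ≤ δ * ρ ^ n := fun ρ hρ =>
    (hdecay ρ hρ).imp fun δ h n => by linarith [h n, abs_nonneg (a n)]
  set A : ℝ → ℝ := fun t => ∑' n, a n * t ^ n with hAdef
  set B : ℝ → ℝ := fun t => ∑' n, b n * t ^ n with hBdef
  have hA0 : A 0 = 1 := by
    simp only [hAdef]
    rw [tsum_eq_single 0 (fun n hn => by simp [hn])]
    simp [ha0]
  have hB0 : B 0 = e / (μ - ν) := by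
    simp only [hBdef]
    rw [tsum_eq_single 0 (fun n hn => by simp [hn])]
    simp [hb0]
  have hAs := contDiff_tsum_mul_pow hda
  have hBs := contDiff_tsum_mul_pow hdb
  have cauchy : ∀ {f g : ℕ → ℝ}, (∀ ρ > 0, ∃ δ, ∀ n, |f n| ≤ δ * ρ ^ n) →
      (∀ ρ > 0, ∃ δ, ∀ n, |g n| ≤ δ * ρ ^ n) → ∀ t : ℝ,
      HasSum (fun n => (∑ k ∈ Finset.range (n + 1), f k * g (n - k)) * t ^ n)
        ((∑' n, f n * t ^ n) * ∑' n, g n * t ^ n) := by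
    intro f g hf hg t
    have h1 := hasSum_sum_range_mul_of_summable_norm (summable_norm_mul_pow hf t)
      (summable_norm_mul_pow hg t)
    refine h1.congr_fun fun n => ?_
    rw [Finset.sum_mul]
    refine Finset.sum_congr rfl fun k hk => ?_
    have hkn' : k ≤ n := by simpa [Nat.lt_succ_iff] using hk
    rw [← Nat.add_sub_cancel' hkn', pow_add, Nat.add_sub_cancel_left]
    ring
  have quadSum : ∀ (c₁ c₂ c₃ t : ℝ), HasSum (fun n => (∑ k ∈ Finset.range (n + 1),
      (c₁ * (a k * a (n - k)) + c₂ * (a k * b (n - k)) + c₃ * (b k * b (n - k)))) * t ^ n)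
      (c₁ * (A t * A t) + c₂ * (A t * B t) + c₃ * (B t * B t)) := by
    intro c₁ c₂ c₃ t
    refine ((((cauchy hda hda t).mul_left c₁).add ((cauchy hda hdb t).mul_left c₂)).add
      ((cauchy hdb hdb t).mul_left c₃)).congr_fun fun n => ?_
    rw [Finset.sum_add_distrib, Finset.sum_add_distrib, ← Finset.mul_sum, ← Finset.mul_sum,
      ← Finset.mul_sum]
    ring
  have sumA : ∀ t, HasSum (fun n => a n * t ^ n) (A t) := fun t =>
    (summable_norm_mul_pow hda t).of_norm.hasSum
  have sumB : ∀ t, HasSum (fun n => b n * t ^ n) (B t) := fun t =>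
    (summable_norm_mul_pow hdb t).of_norm.hasSum
  have eqA : ∀ t, μ * A (μ * t) - μ * A t =
      t * (p₁ * (A t * A t) + p₂ * (A t * B t) + p₃ * (B t * B t)) := by
    intro t
    have h1 := ((sumA (μ * t)).mul_left μ).sub ((sumA t).mul_left μ)
    rw [← hasSum_nat_add_iff' 1] at h1
    have h2 := (quadSum p₁ p₂ p₃ t).mul_left t
    have h3 := h1.unique (h2.congr_fun fun n => ?_)
    · simpa using h3
    · rw [← ha n]; ring
  have eqB : ∀ t, μ * B (μ * t) - ν * B t - e * A t =
      t * (q₁ * (A t * A t) + q₂ * (A t * B t) + q₃ * (B t * B t)) := by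
    intro t
    have h1 := (((sumB (μ * t)).mul_left μ).sub ((sumB t).mul_left ν)).sub ((sumA t).mul_left e)
    rw [← hasSum_nat_add_iff' 1] at h1
    have h2 := (quadSum q₁ q₂ q₃ t).mul_left t
    have h3 := h1.unique (h2.congr_fun fun n => ?_)
    · have hne : μ - ν ≠ 0 := by linarith
      have : μ * (e / (μ - ν)) - ν * (e / (μ - ν)) - e = 0 := by field_simp; ring
      simpa [ha0, hb0, this] using h3
    · have := hb n
      have h4 : μ * (b (n + 1) * (μ * t) ^ (n + 1)) - ν * (b (n + 1) * t ^ (n + 1)) -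
        e * (a (n + 1) * t ^ (n + 1)) =
        t * (((μ ^ (n + 2) - ν) * b (n + 1) - e * a (n + 1)) * t ^ n) := by ring
      rw [h4, this]; ring
  refine ⟨fun t => t * A t, fun t => t * B t, contDiff_id.mul hAs, contDiff_id.mul hBs,
    by simp, by simp, ?_, ?_, fun t => ?_, fun t => ?_⟩
  · have := (hasDerivAt_id' (0 : ℝ)).fun_mul (hAs.differentiable (by simp) 0).hasDerivAt
    rwa [zero_mul, add_zero, one_mul, show ∑' n, a n * (0 : ℝ) ^ n = _ from hA0] at this
  · have := (hasDerivAt_id' (0 : ℝ)).fun_mul (hBs.differentiable (by simp) 0).hasDerivAt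
    rwa [zero_mul, add_zero, one_mul, show ∑' n, b n * (0 : ℝ) ^ n = _ from hB0] at this
  · linear_combination t * eqA t
  · linear_combination t * eqB t

/-! ### Local uniqueness of the unstable curve -/

/-- Backward orbits that stay close to the fixed point lie on the unstable curve. The distance
from a point to the point of the curve with the same first coordinate is contracted by the map, so
that it vanishes along a bounded backward orbit. -/
theorem mem_unstable_curve_of_backward_orbit {μ ν e p₁ p₂ p₃ q₁ q₂ q₃ : ℝ} (hμ : 1 < μ)
    (hν0 : 0 ≤ ν) (hν : ν < 1) {Y X : ℝ → ℝ} (hYs : ContDiff ℝ ∞ Y) (hXs : ContDiff ℝ ∞ X)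
    (hY0 : Y 0 = 0) (hX0 : X 0 = 0) (hY' : HasDerivAt Y 1 0)
    (hY : ∀ t, Y (μ * t) = μ * Y t + (p₁ * (Y t * Y t) + p₂ * (Y t * X t) + p₃ * (X t * X t)))
    (hX : ∀ t, X (μ * t) = ν * X t + e * Y t +
        (q₁ * (Y t * Y t) + q₂ * (Y t * X t) + q₃ * (X t * X t)))
    {τ : ℝ} (hτ : 0 < τ) :
    ∃ ε > 0, ∀ y x : ℕ → ℝ,
      (∀ n, y n = μ * y (n + 1) + (p₁ * (y (n + 1) * y (n + 1)) + p₂ * (y (n + 1) * x (n + 1))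
        + p₃ * (x (n + 1) * x (n + 1)))) →
      (∀ n, x n = ν * x (n + 1) + e * y (n + 1) + (q₁ * (y (n + 1) * y (n + 1))
        + q₂ * (y (n + 1) * x (n + 1)) + q₃ * (x (n + 1) * x (n + 1)))) →
      (∀ n, |y n| < ε) → (∀ n, |x n| < ε) → ∃ t, |t| ≤ τ ∧ Y t = y 0 ∧ X t = x 0 := by
  have hμ0 : 0 < μ := by linarith
  set M : ℝ := |deriv X 0| + 1 with hM
  have hM0 : 0 < M := by positivity
  -- a parameter interval on which the curve is a Lipschitz graph over the first coordinate
  obtain ⟨r, hr0, hrτ, hr⟩ : ∃ r > 0, r ≤ τ ∧ ∀ t, |t| ≤ r → 1 / 2 ≤ deriv Y t ∧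
      |deriv X t| ≤ M := by
    have h1 : ∀ᶠ t in 𝓝 (0 : ℝ), 1 / 2 < deriv Y t :=
      (hYs.continuous_deriv (by simp)).continuousAt.eventually_const_lt
        (by rw [hY'.deriv]; norm_num)
    have h2 : ∀ᶠ t in 𝓝 (0 : ℝ), |deriv X t| < M :=
      (hXs.continuous_deriv (by simp)).abs.continuousAt.eventually_lt_const
        (by rw [hM]; linarith)
    obtain ⟨r, hr, h⟩ := Metric.eventually_nhds_iff.1 (h1.and h2)
    refine ⟨min (r / 2) τ, by positivity, min_le_right _ _, fun t ht => ?_⟩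
    have := h (y := t) (by rw [Real.dist_0_eq_abs]; linarith [min_le_left (r / 2) τ])
    exact ⟨this.1.le, this.2.le⟩
  have lipX : ∀ s t, |s| ≤ r → |t| ≤ r → |X s - X t| ≤ M * |s - t| := by
    intro s t hs ht
    have := (convex_Icc (-r) r).norm_image_sub_le_of_norm_deriv_le (f := X) (C := M)
      (fun z _ => hXs.differentiable (by simp) z)
      (fun z hz => (hr z (abs_le.2 hz)).2) (abs_le.1 ht) (abs_le.1 hs)
    simpa using this
  have lipY' : ∀ s t, |s| ≤ r → |t| ≤ r → s ≤ t → 1 / 2 * (t - s) ≤ Y t - Y s := by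
    intro s t hs ht hst
    refine (convex_Icc (-r) r).mul_sub_le_image_sub_of_le_deriv (f := Y) hYs.continuous.continuousOn
      (fun z _ => (hYs.differentiable (by simp) z).differentiableWithinAt)
      (fun z hz => ?_) s (abs_le.1 hs) t (abs_le.1 ht) hst
    have hz' : z ∈ Icc (-r) r := interior_subset hz
    exact (hr z (abs_le.2 hz')).1
  have lipY : ∀ s t, |s| ≤ r → |t| ≤ r → |s - t| ≤ 2 * |Y s - Y t| := by
    intro s t hs ht
    rcases le_total s t with h | h
    · have := lipY' s t hs ht h
      rw [abs_sub_comm, abs_of_nonneg (by linarith), abs_sub_comm]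
      linarith [le_abs_self (Y t - Y s)]
    · have := lipY' t s ht hs h
      rw [abs_of_nonneg (by linarith)]
      linarith [le_abs_self (Y s - Y t)]
  have hr1 : r / μ ≤ r := div_le_self hr0.le hμ.le
  have hr10 : 0 < r / μ := by positivity
  set G : ℝ := |q₂| + |q₃| * (1 + 2 * M) + 2 * M * (|p₂| + |p₃| * (1 + 2 * M)) with hG
  have hG0 : 0 ≤ G := by positivity
  refine ⟨min (r / μ / 2) ((1 - ν) / 2 / (G + 1)), lt_min (by positivity)
    (div_pos (by linarith) (by positivity)), fun y x hy hx hyε hxε => ?_⟩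
  set ε := min (r / μ / 2) ((1 - ν) / 2 / (G + 1)) with hε
  have hε1 : ε ≤ r / μ / 2 := min_le_left _ _
  have hε2 : G * ε ≤ (1 - ν) / 2 := by
    have : ε ≤ (1 - ν) / 2 / (G + 1) := min_le_right _ _
    rw [le_div_iff₀ (by positivity)] at this
    have hε0 : 0 ≤ ε := (abs_nonneg _).trans (hyε 0).le
    linarith
  -- the parameters of the points of the curve above `y n`
  have hex : ∀ n, ∃ t, |t| ≤ r / μ ∧ Y t = y n := by
    intro n
    have h1 := lipY' 0 (r / μ) (by simpa using hr0.le) (by rwa [abs_of_pos hr10]) hr10.le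
    have h2 := lipY' (-(r / μ)) 0 (by rwa [abs_neg, abs_of_pos hr10]) (by simpa using hr0.le)
      (by linarith)
    rw [hY0] at h1 h2
    have h3 := abs_lt.1 (hyε n)
    obtain ⟨t, ht, htt⟩ := intermediate_value_Icc (by linarith : -(r / μ) ≤ r / μ)
      hYs.continuous.continuousOn (show y n ∈ Icc (Y (-(r / μ))) (Y (r / μ)) from
        ⟨by linarith, by linarith⟩)
    exact ⟨t, abs_le.2 ht, htt⟩
  choose t ht hYt using hex
  have htr : ∀ n, |t n| ≤ r := fun n => (ht n).trans hr1
  have ht2 : ∀ n, |X (t n)| ≤ 2 * M * ε := by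
    intro n
    have h1 := lipX (t n) 0 (htr n) (by simpa using hr0.le)
    have h2 := lipY (t n) 0 (htr n) (by simpa using hr0.le)
    rw [hX0, sub_zero, sub_zero] at h1
    rw [hY0, sub_zero, sub_zero, hYt] at h2
    calc |X (t n)| ≤ M * |t n| := h1
      _ ≤ M * (2 * ε) := by gcongr; linarith [hyε n]
      _ = _ := by ring
  have key : ∀ n, |x n - X (t n)| ≤ (1 + ν) / 2 * |x (n + 1) - X (t (n + 1))| := by
    intro n
    set E := x (n + 1) - X (t (n + 1)) with hE
    have hw := ht2 (n + 1)
    have hsum : |x (n + 1) + X (t (n + 1))| ≤ (1 + 2 * M) * ε := by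
      refine (abs_add_le _ _).trans ?_
      linarith [hxε (n + 1)]
    have hy1 : |y (n + 1)| ≤ ε := (hyε (n + 1)).le
    have hXd : x n - X (μ * t (n + 1)) = (ν + q₂ * y (n + 1)
        + q₃ * (x (n + 1) + X (t (n + 1)))) * E := by
      rw [hX, hx n, hYt, hE]; ring
    have hYd : y n - Y (μ * t (n + 1)) = (p₂ * y (n + 1)
        + p₃ * (x (n + 1) + X (t (n + 1)))) * E := by
      rw [hY, hy n, hYt, hE]; ring
    have b1 : |x n - X (μ * t (n + 1))| ≤ (ν + (|q₂| + |q₃| * (1 + 2 * M)) * ε) * |E| := by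
      rw [hXd, abs_mul]
      gcongr
      refine (abs_add_three _ _ _).trans ?_
      rw [abs_mul, abs_mul, abs_of_nonneg hν0]
      have := mul_le_mul_of_nonneg_left hy1 (abs_nonneg q₂)
      have := mul_le_mul_of_nonneg_left hsum (abs_nonneg q₃)
      linarith
    have b2 : |y n - Y (μ * t (n + 1))| ≤ ((|p₂| + |p₃| * (1 + 2 * M)) * ε) * |E| := by
      rw [hYd, abs_mul]
      gcongr
      refine (abs_add_le _ _).trans ?_
      rw [abs_mul, abs_mul]
      have := mul_le_mul_of_nonneg_left hy1 (abs_nonneg p₂)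
      have := mul_le_mul_of_nonneg_left hsum (abs_nonneg p₃)
      linarith
    have hμt : |μ * t (n + 1)| ≤ r := by
      rw [abs_mul, abs_of_pos hμ0]
      have := mul_le_mul_of_nonneg_left (ht (n + 1)) hμ0.le
      rwa [mul_div_cancel₀ _ hμ0.ne'] at this
    have b3 : |X (μ * t (n + 1)) - X (t n)| ≤ 2 * M * |y n - Y (μ * t (n + 1))| := by
      have h1 := lipX _ _ hμt (htr n)
      have h2 := lipY _ _ hμt (htr n)
      rw [hYt, abs_sub_comm (Y _)] at h2
      have := mul_le_mul_of_nonneg_left h2 hM0.le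
      linarith
    have b4 := mul_le_mul_of_nonneg_left b2 (by positivity : 0 ≤ 2 * M)
    have b5 := mul_le_mul_of_nonneg_right hε2 (abs_nonneg E)
    calc |x n - X (t n)| ≤ |x n - X (μ * t (n + 1))| + |X (μ * t (n + 1)) - X (t n)| :=
          abs_sub_le _ _ _
      _ ≤ (1 + ν) / 2 * |E| := by
          rw [hG] at b5
          linarith
  have iter : ∀ n, |x 0 - X (t 0)| ≤ ((1 + ν) / 2) ^ n * |x n - X (t n)| := by
    intro n
    induction n with
    | zero => simp
    | succ n ih =>
      refine ih.trans ?_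
      rw [pow_succ, mul_assoc]
      exact mul_le_mul_of_nonneg_left (key n) (by positivity)
  have bound : ∀ n, |x 0 - X (t 0)| ≤ ((1 + ν) / 2) ^ n * ((1 + 2 * M) * ε) := by
    intro n
    refine (iter n).trans ?_
    gcongr
    refine (abs_sub _ _).trans ?_
    linarith [hxε n, ht2 n]
  have lim : Tendsto (fun n : ℕ => ((1 + ν) / 2) ^ n * ((1 + 2 * M) * ε)) atTop (𝓝 0) := by
    have := (tendsto_pow_atTop_nhds_zero_of_lt_one (r := (1 + ν) / 2) (by positivity)
      (by linarith)).mul_const ((1 + 2 * M) * ε)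
    rwa [zero_mul] at this
  have h0 : |x 0 - X (t 0)| ≤ 0 := ge_of_tendsto' lim bound
  refine ⟨t 0, (htr 0).trans hrτ, hYt 0, ?_⟩
  have := abs_nonpos_iff.1 h0
  linarith

/-! ### Unstable manifolds from parametrizations, and symmetries -/

theorem jacobian_mulVec {m : ℕ} (F : (Fin m → ℝ) → (Fin m → ℝ)) (P v : Fin m → ℝ) :
    (jacobian F P).mulVec v = fderiv ℝ F P v := by
  rw [jacobian, LinearMap.toMatrix'_mulVec]; rfl

/-- A smooth curve on which `F` acts as the multiplication of the parameter by `μ > 1`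
parametrizes the unstable manifold, if backward orbits that stay close to `P` lie on it. The
parameter runs through `I`, which is the whole line, or a half-line if `P` is on the boundary of
`D`. -/
theorem isUnstableManifold_image {m : ℕ} {F : (Fin m → ℝ) → (Fin m → ℝ)} {D : Set (Fin m → ℝ)}
    {γ : ℝ → (Fin m → ℝ)} {P : Fin m → ℝ} {μ : ℝ} {I : Set ℝ} (hμ : 1 < μ)
    (hF : DifferentiableAt ℝ F P) (hγ : ContDiff ℝ ∞ γ) (h0 : γ 0 = P)
    (hγ' : deriv γ 0 ≠ 0) (hconj : ∀ t, F (γ t) = γ (μ * t))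
    (hI : ∀ t ∈ I, ∀ k : ℝ, 0 < k → k * t ∈ I) (hD : ∀ t ∈ I, γ t ∈ D)
    (hloc : ∃ r > 0, ∀ t, |t| < r → γ t ∈ D → t ∈ I)
    (hproper : ∀ r > 0, ∃ U ∈ 𝓝 P, ∀ t ∈ I, γ t ∈ U → |t| < r)
    (huniq : ∃ ε > 0, ∀ u : ℕ → (Fin m → ℝ), IsBackwardOrbit F D u →
      (∀ n : ℕ, dist (u n) P < ε) → u 0 ∈ γ '' I) :
    IsUnstableManifold F D P (γ '' I) := by
  have hμ0 : 0 < μ := by linarith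
  obtain ⟨ε, hε, hu⟩ := huniq
  refine ⟨?_, ⟨ε, hε, hu⟩, deriv γ 0, μ, by rwa [abs_of_pos hμ0], ?_, ?_⟩
  · ext q
    constructor
    · rintro ⟨t, ht, rfl⟩
      refine ⟨fun n => γ (μ⁻¹ ^ n * t), fun n => ⟨hD _ (hI t ht _ (by positivity)), ?_⟩, by simp,
        ?_⟩
      · rw [hconj, pow_succ]; congr 1; field_simp
      · have h1 : Tendsto (fun n : ℕ => μ⁻¹ ^ n * t) atTop (𝓝 0) := by
          have := (tendsto_pow_atTop_nhds_zero_of_lt_one (r := μ⁻¹) (by positivity)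
            (inv_lt_one_of_one_lt₀ hμ)).mul_const t
          rwa [zero_mul] at this
        rw [← h0]
        exact (hγ.continuous.tendsto 0).comp h1
    · rintro ⟨u, hub, rfl, hlim⟩
      obtain ⟨N, hN⟩ := (Metric.tendsto_atTop.1 hlim) ε hε
      have h1 : u N ∈ γ '' I := by
        have := hu (fun n => u (N + n)) (fun n => hub (N + n)) (fun n => hN _ (by omega))
        simpa using this
      have h2 : ∀ j ≤ N, u (N - j) ∈ γ '' I := by
        intro j
        induction j with
        | zero => intro _; simpa using h1
        | succ j ih =>
          intro hj
          obtain ⟨t, ht, htu⟩ := ih (by omega)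
          refine ⟨μ * t, hI t ht μ hμ0, ?_⟩
          rw [← hconj, htu, ← (hub (N - (j + 1))).2]
          congr 2; omega
      simpa using h2 N le_rfl
  · rw [jacobian_mulVec]
    have hd : HasDerivAt γ (deriv γ 0) 0 := (hγ.differentiable (by simp) 0).hasDerivAt
    have hFd : HasFDerivAt F (fderiv ℝ F P) (γ 0) := by rw [h0]; exact hF.hasFDerivAt
    have h1 : HasDerivAt (fun t => F (γ t)) (fderiv ℝ F P (deriv γ 0)) 0 :=
      hFd.comp_hasDerivAt 0 hd
    have h2 : HasDerivAt (fun t => γ (μ * t)) (μ • deriv γ 0) 0 := by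
      have h3 : HasDerivAt γ (deriv γ 0) (μ * 0) := by simpa using hd
      have h4 : HasDerivAt (fun t : ℝ => μ * t) μ 0 := by
        simpa using (hasDerivAt_id' (0 : ℝ)).const_mul μ
      exact h3.scomp 0 h4
    simp only [hconj] at h1
    exact h1.unique h2
  · obtain ⟨r, hr, hrD⟩ := hloc
    have hne : ∀ᶠ t in 𝓝 (0 : ℝ), deriv γ t ≠ 0 :=
      (hγ.continuous_deriv (by simp)).continuousAt.eventually_ne hγ'
    obtain ⟨r', hr', hne⟩ := Metric.eventually_nhds_iff.1 hne
    have hδ : 0 < min r r' := lt_min hr hr'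
    obtain ⟨U, hU, hUt⟩ := hproper (min r r') hδ
    refine ⟨min r r', hδ, γ, hγ.contDiffOn, fun t ht => hne ?_, h0, rfl, U, hU, ?_⟩
    · rw [Real.dist_0_eq_abs]
      exact (abs_lt.2 ht).trans_le (min_le_right _ _)
    · ext p
      constructor
      · rintro ⟨⟨t, ht, rfl⟩, hp⟩
        exact ⟨⟨⟨t, abs_lt.1 (hUt t ht hp), rfl⟩, hD t ht⟩, hp⟩
      · rintro ⟨⟨⟨t, ht, rfl⟩, hp⟩, hpU⟩
        exact ⟨⟨t, hrD t ((abs_lt.2 ht).trans_le (min_le_left _ _)) hp, rfl⟩, hpU⟩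

section Symmetry

variable {m : ℕ} {F : (Fin m → ℝ) → (Fin m → ℝ)} {D S : Set (Fin m → ℝ)} {P v : Fin m → ℝ}
  (σ : (Fin m → ℝ) ≃ₗᵢ[ℝ] (Fin m → ℝ))

theorem IsBackwardOrbit.map (hF : ∀ p, F (σ p) = σ (F p)) (hD : ∀ p ∈ D, σ p ∈ D)
    {u : ℕ → (Fin m → ℝ)} (hu : IsBackwardOrbit F D u) : IsBackwardOrbit F D (fun n => σ (u n)) :=
  fun n => ⟨hD _ (hu n).1, by rw [hF, (hu n).2]⟩

theorem jacobian_mulVec_map (hF : ∀ p, F (σ p) = σ (F p)) (hd : DifferentiableAt ℝ F P) (μ : ℝ)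
    (h : (jacobian F P).mulVec v = μ • v) :
    (jacobian F (σ P)).mulVec (σ v) = μ • σ v := by
  rw [jacobian_mulVec] at h ⊢
  have hσ : ∀ p, HasFDerivAt σ (σ.toContinuousLinearEquiv : (Fin m → ℝ) →L[ℝ] (Fin m → ℝ)) p :=
    fun p => σ.toContinuousLinearEquiv.hasFDerivAt
  have hσ' : HasFDerivAt σ.symm
      (σ.symm.toContinuousLinearEquiv : (Fin m → ℝ) →L[ℝ] (Fin m → ℝ)) (σ P) :=
    σ.symm.toContinuousLinearEquiv.hasFDerivAt
  have hFe : F = fun p => σ (F (σ.symm p)) := by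
    ext1 p; rw [← hF, σ.apply_symm_apply]
  have hd' : HasFDerivAt F (fderiv ℝ F P) (σ.symm (σ P)) := by
    rw [σ.symm_apply_apply]; exact hd.hasFDerivAt
  have h1 := (hσ _).comp (σ P) (hd'.comp (σ P) hσ')
  have h2 : HasFDerivAt F _ (σ P) := h1.congr_of_eventuallyEq (Eventually.of_forall (congrFun hFe))
  rw [h2.fderiv]
  have : σ (fderiv ℝ F P (σ.symm (σ v))) = μ • σ v := by
    rw [σ.symm_apply_apply, h, map_smul]
  exact this

theorem IsSmoothCurveAt.map (hD : ∀ p, σ p ∈ D ↔ p ∈ D) (h : IsSmoothCurveAt D S P v) :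
    IsSmoothCurveAt D (σ '' S) (σ P) (σ v) := by
  obtain ⟨ε, hε, γ, hγ, hne, h0, hv, U, hU, hSU⟩ := h
  have hderiv : ∀ t ∈ Ioo (-ε) ε, deriv (fun s => σ (γ s)) t = σ (deriv γ t) := by
    intro t ht
    have h1 : HasDerivAt γ (deriv γ t) t :=
      ((hγ.contDiffAt (isOpen_Ioo.mem_nhds ht)).differentiableAt (by simp)).hasDerivAt
    exact ((σ.toContinuousLinearEquiv : (Fin m → ℝ) →L[ℝ] (Fin m → ℝ)).hasFDerivAt.comp_hasDerivAt
      t h1).deriv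
  refine ⟨ε, hε, fun s => σ (γ s), σ.contDiff.comp_contDiffOn hγ, fun t ht => ?_, by simp only [h0],
    by rw [hderiv 0 ⟨by linarith, hε⟩, hv], σ '' U, ?_, ?_⟩
  · rw [hderiv t ht]
    simpa using hne t ht
  · exact σ.toHomeomorph.isOpenMap.image_mem_nhds hU
  · have hDσ : σ '' D = D := by
      ext p
      constructor
      · rintro ⟨q, hq, rfl⟩; exact (hD q).2 hq
      · intro hp
        exact ⟨σ.symm p, (hD _).1 (by rwa [σ.apply_symm_apply]), σ.apply_symm_apply p⟩
    rw [← image_inter σ.injective, hSU, image_inter σ.injective, image_inter σ.injective, hDσ,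
      image_image]

theorem IsStableManifold.map (hF : ∀ p, F (σ p) = σ (F p)) (hD : ∀ p, σ p ∈ D ↔ p ∈ D)
    (hd : DifferentiableAt ℝ F P) (h : IsStableManifold F D P S) :
    IsStableManifold F D (σ P) (σ '' S) := by
  have hit : ∀ (n : ℕ) p, F^[n] (σ p) = σ (F^[n] p) := fun n p =>
    (Function.Semiconj.iterate_right (f := σ) (ga := F) (gb := F) (fun p => (hF p).symm) n p).symm
  have hDs : ∀ p ∈ D, σ.symm p ∈ D := fun p hp => (hD _).1 (by rwa [σ.apply_symm_apply])
  obtain ⟨hS, ⟨ε, hε, hloc⟩, v, μ, hμ, hv, hc⟩ := h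
  refine ⟨?_, ⟨ε, hε, fun q hq hn => ?_⟩, σ v, μ, hμ, jacobian_mulVec_map σ hF hd μ hv, hc.map σ hD⟩
  · rw [hS]
    ext q
    constructor
    · rintro ⟨p, ⟨hp, hlim⟩, rfl⟩
      refine ⟨(hD p).2 hp, ?_⟩
      simp only [hit]
      exact (σ.continuous.tendsto P).comp hlim
    · rintro ⟨hq, hlim⟩
      refine ⟨σ.symm q, ⟨hDs q hq, ?_⟩, σ.apply_symm_apply q⟩
      have h1 := (σ.symm.continuous.tendsto _).comp hlim
      rw [σ.symm_apply_apply] at h1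
      refine h1.congr fun n => ?_
      rw [Function.comp_apply, σ.symm_apply_eq, ← hit, σ.apply_symm_apply]
  · refine ⟨σ.symm q, hloc _ (hDs q hq) fun n => ?_, σ.apply_symm_apply q⟩
    rw [← σ.dist_map, ← hit, σ.apply_symm_apply]
    exact hn n

theorem IsUnstableManifold.map (hF : ∀ p, F (σ p) = σ (F p)) (hD : ∀ p, σ p ∈ D ↔ p ∈ D)
    (hd : DifferentiableAt ℝ F P) (h : IsUnstableManifold F D P S) :
    IsUnstableManifold F D (σ P) (σ '' S) := by
  have hFs : ∀ p, F (σ.symm p) = σ.symm (F p) := fun p => by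
    rw [σ.eq_symm_apply, ← hF, σ.apply_symm_apply]
  have hDs : ∀ p ∈ D, σ.symm p ∈ D := fun p hp => (hD _).1 (by rwa [σ.apply_symm_apply])
  obtain ⟨hS, ⟨ε, hε, hloc⟩, v, μ, hμ, hv, hc⟩ := h
  refine ⟨?_, ⟨ε, hε, fun u hu hn => ?_⟩, σ v, μ, hμ, jacobian_mulVec_map σ hF hd μ hv, hc.map σ hD⟩
  · rw [hS]
    ext q
    constructor
    · rintro ⟨p, ⟨u, hu, rfl, hlim⟩, rfl⟩
      exact ⟨_, hu.map σ hF fun p hp => (hD p).2 hp, rfl, (σ.continuous.tendsto P).comp hlim⟩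
    · rintro ⟨u, hu, rfl, hlim⟩
      refine ⟨σ.symm (u 0), ⟨_, hu.map σ.symm hFs hDs, rfl, ?_⟩, σ.apply_symm_apply _⟩
      have h1 := (σ.symm.continuous.tendsto _).comp hlim
      rwa [σ.symm_apply_apply] at h1
  · refine ⟨σ.symm (u 0), hloc _ (hu.map σ.symm hFs hDs) fun n => ?_, σ.apply_symm_apply _⟩
    rw [← σ.dist_map, σ.apply_symm_apply]
    exact hn n

end Symmetry

/-! ### The operator on the simplex -/

@[simp] theorem V_apply_zero (a b c : ℝ) (p : Fin 2 → ℝ) :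
    V a b c p 0 = p 0 * (2 * c + (a - 2 * c) * p 0 + 2 * (b - c) * p 1) := rfl

@[simp] theorem V_apply_one (a b c : ℝ) (p : Fin 2 → ℝ) :
    V a b c p 1 = p 1 * (2 * c + 2 * (b - c) * p 0 + (a - 2 * c) * p 1) := rfl

theorem ext_two {p q : Fin 2 → ℝ} (h0 : p 0 = q 0) (h1 : p 1 = q 1) : p = q := by
  ext i; fin_cases i <;> assumption

/-- In terms of `z = 1 - x - y` the growth factor of `x` is `2cz + ax + 2by`. -/
theorem V_zero_eq (a b c : ℝ) (p : Fin 2 → ℝ) :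
    V a b c p 0 = p 0 * (2 * c * (1 - p 0 - p 1) + a * p 0 + 2 * b * p 1) := by
  rw [V_apply_zero]; ring

theorem V_one_eq (a b c : ℝ) (p : Fin 2 → ℝ) :
    V a b c p 1 = p 1 * (2 * c * (1 - p 0 - p 1) + 2 * b * p 0 + a * p 1) := by
  rw [V_apply_one]; ring

theorem V_diff (a b c : ℝ) (p : Fin 2 → ℝ) :
    V a b c p 0 - V a b c p 1
      = (p 0 - p 1) * (2 * c * (1 - p 0 - p 1) + a * (p 0 + p 1)) := by
  rw [V_apply_zero, V_apply_one]; ring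

theorem V_sum (a b c : ℝ) (p : Fin 2 → ℝ) :
    V a b c p 0 + V a b c p 1
      = 2 * c * (p 0 + p 1) - (2 * c - a / 2 - b) * (p 0 + p 1) ^ 2
        + (a / 2 - b) * (p 0 - p 1) ^ 2 := by
  rw [V_apply_zero, V_apply_one]; ring

/-- The reflection that exchanges the two coordinates. -/
noncomputable def swapXY : (Fin 2 → ℝ) ≃ₗᵢ[ℝ] (Fin 2 → ℝ) :=
  { LinearEquiv.funCongrLeft ℝ ℝ (Equiv.swap (0 : Fin 2) 1) with
    norm_map' := fun p => by
      simp only [Pi.norm_def]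
      congr 1
      simp only [Fin.univ_succ, Finset.sup_cons]
      simp [LinearEquiv.funCongrLeft, LinearMap.funLeft, sup_comm] }

@[simp] theorem swapXY_zero (p : Fin 2 → ℝ) : swapXY p 0 = p 1 := rfl
@[simp] theorem swapXY_one (p : Fin 2 → ℝ) : swapXY p 1 = p 0 := rfl

theorem V_swapXY (a b c : ℝ) (p : Fin 2 → ℝ) : V a b c (swapXY p) = swapXY (V a b c p) := by
  refine ext_two ?_ ?_
  · simp only [V_apply_zero, V_apply_one, swapXY_zero, swapXY_one]; ring
  · simp only [V_apply_zero, V_apply_one, swapXY_zero, swapXY_one]; ring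

theorem swapXY_mem_T (p : Fin 2 → ℝ) : swapXY p ∈ T ↔ p ∈ T := by
  simp only [T, mem_ofPred_eq, swapXY_zero, swapXY_one]
  constructor <;> rintro ⟨h1, h2, h3⟩ <;> exact ⟨h2, h1, by linarith⟩

section Invariance

variable {a b c : ℝ}

/-- The parameter region `a ∈ [0, 1)`, `b ∈ [0, 1/2]`, `c ∈ [0, 1]`. -/
structure Admissible (a b c : ℝ) : Prop where
  a_nonneg : 0 ≤ a
  a_lt_one : a < 1
  b_nonneg : 0 ≤ b
  b_le_half : b ≤ 1 / 2
  c_nonneg : 0 ≤ c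
  c_le_one : c ≤ 1

/-- The total mass after one step is at most `2sz + s² = 1 - z²`. -/
theorem V_sum_le (H : Admissible a b c) {p : Fin 2 → ℝ} (hp : p ∈ T) :
    V a b c p 0 + V a b c p 1 ≤ 1 - (1 - p 0 - p 1) ^ 2 := by
  have ⟨ha0, ha1, hb0, hb, hc0, hc⟩ := H
  obtain ⟨hx, hy, hs⟩ := hp
  rw [V_zero_eq, V_one_eq]
  have h1 : 0 ≤ (1 - c) * ((p 0 + p 1) * (1 - p 0 - p 1)) :=
    mul_nonneg (by linarith) (mul_nonneg (by linarith) (by linarith))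
  have h2 : 0 ≤ (1 - a) * (p 0 * p 0 + p 1 * p 1) :=
    mul_nonneg (by linarith) (by positivity)
  have h3 : 0 ≤ (1 / 2 - b) * (p 0 * p 1) :=
    mul_nonneg (by linarith) (mul_nonneg hx hy)
  nlinarith [h1, h2, h3]

theorem mapsTo_T (H : Admissible a b c) : MapsTo (V a b c) T T := by
  have ⟨ha0, ha1, hb0, hb, hc0, hc⟩ := H
  intro p hp
  have hs' := V_sum_le H hp
  obtain ⟨hx, hy, hs⟩ := hp
  have hz : 0 ≤ 1 - p 0 - p 1 := by linarith
  refine ⟨?_, ?_, by nlinarith [sq_nonneg (1 - p 0 - p 1)]⟩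
  · rw [V_zero_eq]; positivity
  · rw [V_one_eq]; positivity

theorem iterate_mem_T (H : Admissible a b c) {p : Fin 2 → ℝ} (hp : p ∈ T) (n : ℕ) :
    (V a b c)^[n] p ∈ T :=
  (mapsTo_T H).iterate n hp

theorem mapsTo_MZero (H : Admissible a b c) : MapsTo (V a b c) MZero MZero := fun p hp =>
  ⟨mapsTo_T H hp.1, by rw [V_apply_zero, hp.2, zero_mul]⟩

theorem mapsTo_MOne (H : Admissible a b c) : MapsTo (V a b c) MOne MOne := fun p hp =>
  ⟨mapsTo_T H hp.1, by rw [V_apply_one, hp.2, zero_mul]⟩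

theorem mapsTo_MEq (H : Admissible a b c) : MapsTo (V a b c) MEq MEq := fun p hp => by
  have ⟨ha0, ha1, hb0, hb, hc0, hc⟩ := H
  refine ⟨mapsTo_T H hp.1, ?_⟩
  have h := V_diff a b c p
  rw [hp.2, sub_self, zero_mul] at h
  linarith

theorem mapsTo_MGt (H : Admissible a b c) (ha : 0 < a) : MapsTo (V a b c) MGt MGt := fun p hp => by
  have ⟨ha0, ha1, hb0, hb, hc0, hc⟩ := H
  refine ⟨mapsTo_T H hp.1, ?_⟩
  obtain ⟨⟨hx, hy, hs⟩, hd⟩ := hp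
  have h := V_diff a b c p
  have h1 : 0 < p 0 - p 1 := sub_pos.2 hd
  have h2 : 0 < a * (p 0 + p 1) := mul_pos ha (by linarith)
  have h3 : 0 ≤ 2 * c * (1 - p 0 - p 1) := mul_nonneg (by linarith) (by linarith)
  have h4 := mul_pos h1 (by linarith : 0 < 2 * c * (1 - p 0 - p 1) + a * (p 0 + p 1))
  exact sub_pos.1 (by rwa [h])

theorem mapsTo_MGt_inter (H : Admissible a b c) (hcp : 0 < c) :
    MapsTo (V a b c) (MGt ∩ {p | p 0 + p 1 < 1}) (MGt ∩ {p | p 0 + p 1 < 1}) := by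
  have ⟨ha0, ha1, hb0, hb, hc0, hc⟩ := H
  rintro p ⟨hp, hs1⟩
  have hs' := V_sum_le H hp.1
  rw [mem_ofPred_eq] at hs1
  refine ⟨⟨mapsTo_T H hp.1, ?_⟩, ?_⟩
  · obtain ⟨⟨hx, hy, hs⟩, hd⟩ := hp
    have h := V_diff a b c p
    have h1 : 0 < p 0 - p 1 := sub_pos.2 hd
    have h2 : 0 ≤ a * (p 0 + p 1) := mul_nonneg ha0 (by linarith)
    have h3 : 0 < 2 * c * (1 - p 0 - p 1) := mul_pos (by linarith) (by linarith)
    have h4 := mul_pos h1 (by linarith : 0 < 2 * c * (1 - p 0 - p 1) + a * (p 0 + p 1))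
    exact sub_pos.1 (by rwa [h])
  · have : 0 < (1 - p 0 - p 1) ^ 2 := by
      have : 0 < 1 - p 0 - p 1 := by linarith
      positivity
    rw [mem_ofPred_eq]; linarith

theorem mapsTo_MGt_union (H : Admissible a b c) : MapsTo (V a b c) (MGt ∪ MEq) (MGt ∪ MEq) := by
  have ⟨ha0, ha1, hb0, hb, hc0, hc⟩ := H
  have key : ∀ p : Fin 2 → ℝ, p ∈ MGt ∪ MEq ↔ p ∈ T ∧ p 1 ≤ p 0 := fun p => by
    simp only [MGt, MEq, mem_union, mem_ofPred_eq, ← and_or_left, le_iff_lt_or_eq, gt_iff_lt,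
      eq_comm (a := p 0)]
  intro p hp
  rw [key] at hp ⊢
  refine ⟨mapsTo_T H hp.1, ?_⟩
  obtain ⟨⟨hx, hy, hs⟩, hd⟩ := hp
  have h := V_diff a b c p
  have hz : 0 ≤ 1 - p 0 - p 1 := by linarith
  have : 0 ≤ (p 0 - p 1) * (2 * c * (1 - p 0 - p 1) + a * (p 0 + p 1)) :=
    mul_nonneg (by linarith) (by positivity)
  linarith

theorem swapXY_mem_MGt (p : Fin 2 → ℝ) : swapXY p ∈ MGt ↔ p ∈ MLt := by
  simp only [MGt, MLt, mem_ofPred_eq, swapXY_mem_T, swapXY_zero, swapXY_one, gt_iff_lt]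

theorem swapXY_mem_MEq (p : Fin 2 → ℝ) : swapXY p ∈ MEq ↔ p ∈ MEq := by
  simp only [MEq, mem_ofPred_eq, swapXY_mem_T, swapXY_zero, swapXY_one, eq_comm (a := p 0)]

theorem mapsTo_MLt (H : Admissible a b c) (ha : 0 < a) : MapsTo (V a b c) MLt MLt := fun p hp => by
  rw [← swapXY_mem_MGt] at hp ⊢
  rw [← V_swapXY]
  exact mapsTo_MGt H ha hp

theorem mapsTo_MLt_inter (H : Admissible a b c) (hcp : 0 < c) :
    MapsTo (V a b c) (MLt ∩ {p | p 0 + p 1 < 1}) (MLt ∩ {p | p 0 + p 1 < 1}) := by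
  have key : ∀ p : Fin 2 → ℝ, p ∈ MLt ∩ {p | p 0 + p 1 < 1} ↔
      swapXY p ∈ MGt ∩ {p | p 0 + p 1 < 1} := fun p => by
    simp only [mem_inter_iff, swapXY_mem_MGt, mem_ofPred_eq, swapXY_zero, swapXY_one,
      add_comm (p 0)]
  intro p hp
  rw [key] at hp ⊢
  rw [← V_swapXY]
  exact mapsTo_MGt_inter H hcp hp

theorem mapsTo_MLt_union (H : Admissible a b c) : MapsTo (V a b c) (MLt ∪ MEq) (MLt ∪ MEq) := by
  have key : ∀ p : Fin 2 → ℝ, p ∈ MLt ∪ MEq ↔ swapXY p ∈ MGt ∪ MEq := fun p => by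
    simp only [mem_union, swapXY_mem_MGt, swapXY_mem_MEq]
  intro p hp
  rw [key] at hp ⊢
  rw [← V_swapXY]
  exact mapsTo_MGt_union H hp

/-! ### Extinction for small `c` -/

/-- For `c ≤ 1/2` the total mass `s` decreases by at least `(1 - a) s² / 2`. -/
theorem V_sum_le_of_le_half (H : Admissible a b c) (hch : c ≤ 1 / 2) {p : Fin 2 → ℝ} (hp : p ∈ T) :
    V a b c p 0 + V a b c p 1 ≤ p 0 + p 1 - (1 - a) / 2 * (p 0 + p 1) ^ 2 := by
  have ⟨ha0, ha1, hb0, hb, hc0, hc⟩ := H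
  obtain ⟨hx, hy, hs⟩ := hp
  rw [V_zero_eq, V_one_eq]
  have h1 : 0 ≤ (1 / 2 - c) * ((p 0 + p 1) * (1 - p 0 - p 1)) :=
    mul_nonneg (by linarith) (mul_nonneg (by linarith) (by linarith))
  have h2 : 0 ≤ (1 - a) * (p 0 - p 1) ^ 2 := mul_nonneg (by linarith) (by positivity)
  have h3 : 0 ≤ (1 / 2 - b) * (p 0 * p 1) := mul_nonneg (by linarith) (mul_nonneg hx hy)
  nlinarith [h1, h2, h3]

theorem tendsto_lam0_of_le_half (H : Admissible a b c) (hch : c ≤ 1 / 2) {p : Fin 2 → ℝ}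
    (hp : p ∈ T) : Tendsto (fun n : ℕ => (V a b c)^[n] p) atTop (𝓝 lam0) := by
  have ⟨ha0, ha1, hb0, hb, hc0, hc⟩ := H
  set u : ℕ → (Fin 2 → ℝ) := fun n => (V a b c)^[n] p with hu
  have huT : ∀ n, u n ∈ T := iterate_mem_T H hp
  have husucc : ∀ n, u (n + 1) = V a b c (u n) := fun n => Function.iterate_succ_apply' _ _ _
  set s : ℕ → ℝ := fun n => u n 0 + u n 1 with hs
  have hs0 : ∀ n, 0 ≤ s n := fun n => add_nonneg (huT n).1 (huT n).2.1
  have hstep : ∀ n, s (n + 1) ≤ s n - (1 - a) / 2 * s n ^ 2 := fun n => by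
    simp only [hs, husucc]
    exact V_sum_le_of_le_half H hch (huT n)
  have hanti : Antitone s := antitone_nat_of_succ_le fun n => by
    have : 0 ≤ (1 - a) / 2 * s n ^ 2 := mul_nonneg (by linarith) (sq_nonneg _)
    linarith [hstep n]
  have hlim := tendsto_atTop_ciInf hanti ⟨0, by rintro _ ⟨n, rfl⟩; exact hs0 n⟩
  set L := ⨅ n, s n with hL
  have hL0 : 0 ≤ L := ge_of_tendsto' hlim hs0
  have hLe : L ≤ L - (1 - a) / 2 * L ^ 2 :=
    le_of_tendsto_of_tendsto' (hlim.comp (tendsto_add_atTop_nat 1))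
      (hlim.sub ((hlim.pow 2).const_mul _)) hstep
  have hL1 : L = 0 := by
    by_contra hne
    have : 0 < (1 - a) / 2 * L ^ 2 := mul_pos (by linarith) (by positivity)
    linarith
  rw [hL1] at hlim
  rw [tendsto_pi_nhds]
  intro i
  fin_cases i
  · exact squeeze_zero (fun n => (huT n).1)
      (fun n => (le_add_of_nonneg_right (huT n).2.1 : u n 0 ≤ s n)) hlim
  · exact squeeze_zero (fun n => (huT n).2.1)
      (fun n => (le_add_of_nonneg_left (huT n).1 : u n 1 ≤ s n)) hlim

theorem lam0_mem_fixedSet : lam0 ∈ fixedSet a b c := by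
  refine ⟨⟨le_rfl, le_rfl, by simp [lam0]⟩, ext_two ?_ ?_⟩ <;> simp [lam0]

theorem fixedSet_of_le_half (H : Admissible a b c) (hch : c ≤ 1 / 2) : fixedSet a b c = {lam0} := by
  refine Subset.antisymm (fun p hp => ?_) (singleton_subset_iff.2 lam0_mem_fixedSet)
  have h1 := tendsto_lam0_of_le_half H hch hp.1
  have h2 : ∀ n : ℕ, (V a b c)^[n] p = p := fun n => Function.iterate_fixed hp.2 n
  simp only [h2] at h1
  exact tendsto_nhds_unique tendsto_const_nhds h1

end Invariance

/-! ### The logistic map -/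

/-- Orbits of the logistic map `s ↦ s (α - β s)` with `1 < α`, `β ≤ α ≤ 2` and `α - 1 < β` that
start in `(0, 1]` and do not reach `0` in one step converge to the positive fixed point. Either the
orbit stays above that point and decreases, or it falls below and increases from then on. -/
theorem tendsto_logistic {α β s : ℝ} (hα : 1 < α) (hα2 : α ≤ 2) (hβα : β ≤ α) (hβ : α - 1 < β)
    (hs0 : 0 < s) (hs1 : s ≤ 1) (hs : 0 < α - β ∨ s < 1) :
    Tendsto (fun n : ℕ => (fun t => t * (α - β * t))^[n] s) atTop (𝓝 ((α - 1) / β)) := by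
  have hβ0 : 0 < β := by linarith
  set g : ℝ → ℝ := fun t => t * (α - β * t) with hg
  have hgc : Continuous g := by rw [hg]; fun_prop
  set F := (α - 1) / β with hF
  have hFβ : β * F = α - 1 := by rw [hF]; field_simp
  have hF0 : 0 < F := div_pos (by linarith) hβ0
  set u : ℕ → ℝ := fun n => g^[n] s with hu
  have husucc : ∀ n, u (n + 1) = g (u n) := fun n => Function.iterate_succ_apply' _ _ _
  have hstep : ∀ t, g t = t + t * β * (F - t) := fun t => by
    simp only [hg]; linear_combination -t * hFβ
  have hpos : ∀ n, 0 < u n ∧ u n ≤ 1 ∧ (0 < α - β ∨ u n < 1) := by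
    intro n
    induction n with
    | zero => exact ⟨hs0, hs1, hs⟩
    | succ n ih =>
      obtain ⟨h0, h1, h2⟩ := ih
      have hfac : 0 < α - β * u n := by
        rcases h2 with h2 | h2
        · nlinarith
        · nlinarith
      have hlt : u (n + 1) < 1 := by
        rw [husucc]; simp only [hg]
        nlinarith [sq_nonneg (u n - 1), mul_pos h0 h0]
      exact ⟨by rw [husucc]; exact mul_pos h0 hfac, hlt.le, Or.inr hlt⟩
  have hfix : ∀ L, Tendsto u atTop (𝓝 L) → L ≠ 0 → L = F := by
    intro L hL hL0
    have h1 : Tendsto (fun n => g (u n)) atTop (𝓝 (g L)) := (hgc.tendsto L).comp hL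
    have h2 : Tendsto (fun n => u (n + 1)) atTop (𝓝 L) := hL.comp (tendsto_add_atTop_nat 1)
    simp only [husucc] at h2
    have h3 := tendsto_nhds_unique h1 h2
    rw [hstep] at h3
    have h4 : L * β * (F - L) = 0 := by linarith
    rcases mul_eq_zero.1 h4 with h | h
    · exact absurd h (mul_ne_zero hL0 hβ0.ne')
    · linarith
  by_cases hN : ∃ N, u N ≤ F
  · obtain ⟨N, hN⟩ := hN
    have hle : ∀ n, u (N + n) ≤ F := by
      intro n
      induction n with
      | zero => simpa using hN
      | succ n ih =>
        -- `g t - F = (t - F) (1 - β t)`, and `β t ≤ α - 1 ≤ 1` below the fixed point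
        have h1 : g (u (N + n)) - F = (u (N + n) - F) * (1 - β * u (N + n)) := by
          rw [hstep]; ring
        have h2 : β * u (N + n) ≤ 1 := by nlinarith
        rw [← add_assoc, husucc]
        nlinarith
    have hmono : Monotone fun n => u (N + n) := monotone_nat_of_le_succ fun n => by
      have : 0 ≤ u (N + n) * β * (F - u (N + n)) :=
        mul_nonneg (mul_nonneg (hpos _).1.le hβ0.le) (by linarith [hle n])
      rw [← add_assoc, husucc, hstep]; linarith
    have hlim := tendsto_atTop_ciSup hmono ⟨F, by rintro _ ⟨n, rfl⟩; exact hle n⟩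
    set L := ⨆ n, u (N + n)
    have hL0 : 0 < L := (hpos N).1.trans_le (by
      have := hmono.ge_of_tendsto hlim 0
      simpa using this)
    have hlim' : Tendsto u atTop (𝓝 L) := by
      rw [← tendsto_add_atTop_iff_nat N]
      simpa [add_comm] using hlim
    rwa [hfix L hlim' hL0.ne'] at hlim'
  · push Not at hN
    have hanti : Antitone u := antitone_nat_of_succ_le fun n => by
      have : 0 ≤ u n * β * (u n - F) :=
        mul_nonneg (mul_nonneg (hpos _).1.le hβ0.le) (by linarith [hN n])
      rw [husucc, hstep]; linarith
    have hlim := tendsto_atTop_ciInf hanti ⟨F, by rintro _ ⟨n, rfl⟩; exact (hN n).le⟩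
    have hL0 : 0 < ⨅ n, u n := hF0.trans_le (ge_of_tendsto' hlim fun n => (hN n).le)
    rwa [hfix _ hlim hL0.ne'] at hlim

/-! ### Jacobian matrices and the types of the fixed points -/

theorem contDiff_V (a b c : ℝ) : ContDiff ℝ ∞ (V a b c) := by
  rw [contDiff_pi]
  intro i
  fin_cases i
  · change ContDiff ℝ ∞ fun p : Fin 2 → ℝ =>
      p 0 * (2 * c + (a - 2 * c) * p 0 + 2 * (b - c) * p 1)
    fun_prop
  · change ContDiff ℝ ∞ fun p : Fin 2 → ℝ =>
      p 1 * (2 * c + 2 * (b - c) * p 0 + (a - 2 * c) * p 1)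
    fun_prop

theorem differentiableAt_V (a b c : ℝ) (p : Fin 2 → ℝ) : DifferentiableAt ℝ (V a b c) p :=
  (contDiff_V a b c).differentiable (by simp) p

theorem fderiv_V (a b c : ℝ) (p v : Fin 2 → ℝ) :
    fderiv ℝ (V a b c) p v =
      ![(2 * c + 2 * (a - 2 * c) * p 0 + 2 * (b - c) * p 1) * v 0 + 2 * (b - c) * p 0 * v 1,
        2 * (b - c) * p 1 * v 0 + (2 * c + 2 * (b - c) * p 0 + 2 * (a - 2 * c) * p 1) * v 1] := by
  have hline : ∀ i, HasDerivAt (fun t : ℝ => p i + t * v i) (v i) 0 := fun i => by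
    simpa using ((hasDerivAt_id' (0 : ℝ)).mul_const (v i)).const_add (p i)
  have hl : HasDerivAt (fun t : ℝ => p + t • v) v 0 := hasDerivAt_pi.2 hline
  have hV : HasFDerivAt (V a b c) (fderiv ℝ (V a b c) p) (p + (0 : ℝ) • v) := by
    rw [zero_smul, add_zero]; exact (differentiableAt_V a b c p).hasFDerivAt
  have h1 := hV.comp_hasDerivAt 0 hl
  refine h1.unique (hasDerivAt_pi.2 fun i => ?_)
  fin_cases i
  · have := (hline 0).fun_mul
      ((((hline 0).const_mul (a - 2 * c)).const_add (2 * c)).add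
        ((hline 1).const_mul (2 * (b - c))))
    refine this.congr_deriv ?_
    simp; ring
  · have := (hline 1).fun_mul
      ((((hline 0).const_mul (2 * (b - c))).const_add (2 * c)).add
        ((hline 1).const_mul (a - 2 * c)))
    refine this.congr_deriv ?_
    simp; ring

theorem jacobian_V (a b c : ℝ) (p : Fin 2 → ℝ) :
    jacobian (V a b c) p =
      !![2 * c + 2 * (a - 2 * c) * p 0 + 2 * (b - c) * p 1, 2 * (b - c) * p 0;
        2 * (b - c) * p 1, 2 * c + 2 * (b - c) * p 0 + 2 * (a - 2 * c) * p 1] := by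
  ext i j
  rw [jacobian, LinearMap.toMatrix'_apply, ContinuousLinearMap.coe_coe, fderiv_V]
  fin_cases i <;> fin_cases j <;> simp

/-- A real `2 × 2` Jacobian with trace `m₁ + m₂` and determinant `m₁ m₂` has the multipliers `m₁`
and `m₂`. -/
theorem mem_multipliers {F : (Fin 2 → ℝ) → (Fin 2 → ℝ)} {P : Fin 2 → ℝ} {m₁ m₂ : ℝ}
    (ht : (jacobian F P).trace = m₁ + m₂) (hd : (jacobian F P).det = m₁ * m₂) (μ : ℂ) :
    μ ∈ multipliers F P ↔ μ = m₁ ∨ μ = m₂ := by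
  rw [Matrix.trace_fin_two] at ht
  rw [Matrix.det_fin_two] at hd
  rw [multipliers, spectrum.mem_iff, Matrix.isUnit_iff_isUnit_det, isUnit_iff_ne_zero, not_not,
    Matrix.det_fin_two]
  simp only [Matrix.sub_apply, Matrix.algebraMap_matrix_apply, Matrix.map_apply]
  have ht' : ((jacobian F P 0 0 : ℝ) : ℂ) + (jacobian F P 1 1 : ℝ) = m₁ + m₂ := by
    exact_mod_cast ht
  have hd' : ((jacobian F P 0 0 : ℝ) : ℂ) * (jacobian F P 1 1 : ℝ)
      - (jacobian F P 0 1 : ℝ) * (jacobian F P 1 0 : ℝ) = m₁ * m₂ := by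
    exact_mod_cast hd
  rw [← sub_eq_zero (a := μ), ← sub_eq_zero (b := (m₂ : ℂ)), ← mul_eq_zero]
  simp only [if_true, Complex.coe_algebraMap, Algebra.algebraMap_self, RingHom.id_apply,
    zero_ne_one, one_ne_zero, if_false, Fin.isValue]
  have : (μ - (m₁ : ℂ)) * (μ - m₂) = (μ - (jacobian F P 0 0 : ℝ)) * (μ - (jacobian F P 1 1 : ℝ))
      - (0 - (jacobian F P 0 1 : ℝ)) * (0 - (jacobian F P 1 0 : ℝ)) := by
    linear_combination μ * ht' - hd'
  rw [this]

section Types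

variable {F : (Fin 2 → ℝ) → (Fin 2 → ℝ)} {P : Fin 2 → ℝ} {m₁ m₂ : ℝ} (hF : F P = P)
  (hdiff : DifferentiableAt ℝ F P) (ht : (jacobian F P).trace = m₁ + m₂)
  (hd : (jacobian F P).det = m₁ * m₂)

include hF hdiff ht hd

theorem isHyperbolic_of_trace_det (h₁ : |m₁| ≠ 1) (h₂ : |m₂| ≠ 1) : IsHyperbolic F P := by
  refine ⟨hF, hdiff, fun μ hμ => ?_⟩
  rcases (mem_multipliers ht hd μ).1 hμ with rfl | rfl <;> simpa [Complex.norm_real]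

theorem isAttracting_of_trace_det (h₁ : |m₁| < 1) (h₂ : |m₂| < 1) : IsAttracting F P := by
  refine ⟨isHyperbolic_of_trace_det hF hdiff ht hd h₁.ne h₂.ne, fun μ hμ => ?_⟩
  rcases (mem_multipliers ht hd μ).1 hμ with rfl | rfl <;> simpa [Complex.norm_real]

theorem isRepelling_of_trace_det (h₁ : 1 < |m₁|) (h₂ : 1 < |m₂|) : IsRepelling F P := by
  refine ⟨isHyperbolic_of_trace_det hF hdiff ht hd h₁.ne' h₂.ne', fun μ hμ => ?_⟩
  rcases (mem_multipliers ht hd μ).1 hμ with rfl | rfl <;> simpa [Complex.norm_real]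

theorem isSaddle_of_trace_det (h₁ : |m₁| < 1) (h₂ : 1 < |m₂|) : IsSaddle F P := by
  refine ⟨isHyperbolic_of_trace_det hF hdiff ht hd h₁.ne h₂.ne', fun h => ?_, fun h => ?_⟩
  · have := h.2 _ ((mem_multipliers ht hd _).2 (Or.inr rfl))
    rw [Complex.norm_real, Real.norm_eq_abs] at this
    linarith
  · have := h.2 _ ((mem_multipliers ht hd _).2 (Or.inl rfl))
    rw [Complex.norm_real, Real.norm_eq_abs] at this
    linarith

end Types

/-! ### The fixed points for large `c` -/

section Fixed

variable {a b c : ℝ}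

theorem swapXY_lam1 : swapXY (lam1 a c) = lam2 a c := ext_two rfl rfl

theorem swapXY_lam2 : swapXY (lam2 a c) = lam1 a c := ext_two rfl rfl

theorem swapXY_lam3 : swapXY (lam3 a b c) = lam3 a b c := ext_two rfl rfl

theorem lam3_eq : lam3 a b c =
    ![(2 * c - 1) / (4 * c - a - 2 * b), (2 * c - 1) / (4 * c - a - 2 * b)] := by
  have : (1 - 2 * c) / (a + 2 * b - 4 * c) = (2 * c - 1) / (4 * c - a - 2 * b) := by
    rw [← neg_div_neg_eq]; congr 1 <;> ring
  rw [lam3, this]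

theorem axis_coord_bounds (H : Admissible a b c) (hch : 1 / 2 < c) :
    0 < (2 * c - 1) / (2 * c - a) ∧ (2 * c - 1) / (2 * c - a) < 1 := by
  have ⟨ha0, ha1, hb0, hb, hc0, hc⟩ := H
  exact ⟨div_pos (by linarith) (by linarith), (div_lt_one (by linarith)).2 (by linarith)⟩

theorem diag_coord_bounds (H : Admissible a b c) (hch : 1 / 2 < c) :
    0 < (2 * c - 1) / (4 * c - a - 2 * b) ∧ (2 * c - 1) / (4 * c - a - 2 * b) < 1 / 2 := by
  have ⟨ha0, ha1, hb0, hb, hc0, hc⟩ := H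
  exact ⟨div_pos (by linarith) (by linarith), (div_lt_iff₀ (by linarith)).2 (by linarith)⟩

theorem V_lam0 : V a b c lam0 = lam0 := lam0_mem_fixedSet.2

theorem V_lam1 (H : Admissible a b c) (hch : 1 / 2 < c) : V a b c (lam1 a c) = lam1 a c := by
  have ⟨ha0, ha1, hb0, hb, hc0, hc⟩ := H
  have h : 2 * c - a ≠ 0 := by linarith
  refine ext_two (by simp [lam1]) ?_
  simp only [V_apply_one, lam1, Matrix.cons_val_zero, Matrix.cons_val_one]
  field_simp
  ring

theorem V_lam2 (H : Admissible a b c) (hch : 1 / 2 < c) : V a b c (lam2 a c) = lam2 a c := by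
  rw [← swapXY_lam1, V_swapXY, V_lam1 H hch]

theorem V_lam3 (H : Admissible a b c) (hch : 1 / 2 < c) : V a b c (lam3 a b c) = lam3 a b c := by
  have ⟨ha0, ha1, hb0, hb, hc0, hc⟩ := H
  have h : 4 * c - a - 2 * b ≠ 0 := by linarith
  have ht := mul_div_cancel₀ (2 * c - 1) h
  rw [lam3_eq]
  set t := (2 * c - 1) / (4 * c - a - 2 * b)
  refine ext_two ?_ ?_
  all_goals
    simp only [V_apply_zero, V_apply_one, Matrix.cons_val_zero, Matrix.cons_val_one]
    linear_combination (-t) * ht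

theorem lam1_mem_T (H : Admissible a b c) (hch : 1 / 2 < c) : lam1 a c ∈ T := by
  obtain ⟨h0, h1⟩ := axis_coord_bounds H hch
  refine ⟨le_rfl, h0.le, ?_⟩
  simp only [lam1, Matrix.cons_val_zero, Matrix.cons_val_one]
  linarith

theorem lam2_mem_T (H : Admissible a b c) (hch : 1 / 2 < c) : lam2 a c ∈ T := by
  rw [← swapXY_lam1, swapXY_mem_T]; exact lam1_mem_T H hch

theorem lam3_mem_T (H : Admissible a b c) (hch : 1 / 2 < c) : lam3 a b c ∈ T := by
  obtain ⟨h0, h1⟩ := diag_coord_bounds H hch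
  rw [lam3_eq]
  refine ⟨h0.le, h0.le, ?_⟩
  simp only [Matrix.cons_val_zero, Matrix.cons_val_one]
  linarith

theorem fixedSet_eq (H : Admissible a b c) (hch : 1 / 2 < c) (hab : a ≠ 2 * b) :
    fixedSet a b c = {lam0, lam1 a c, lam2 a c, lam3 a b c} := by
  have ⟨ha0, ha1, hb0, hb, hc0, hc⟩ := H
  refine Subset.antisymm ?_ ?_
  · rintro p ⟨hp, hfix⟩
    have e0 := congrFun hfix 0
    have e1 := congrFun hfix 1
    rw [V_apply_zero] at e0
    rw [V_apply_one] at e1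
    have f0 : p 0 * (2 * c - 1 - ((2 * c - a) * p 0 + 2 * (c - b) * p 1)) = 0 := by linarith
    have f1 : p 1 * (2 * c - 1 - (2 * (c - b) * p 0 + (2 * c - a) * p 1)) = 0 := by linarith
    have hne : 2 * c - a ≠ 0 := by linarith
    have hne3 : 4 * c - a - 2 * b ≠ 0 := by linarith
    rcases mul_eq_zero.1 f0 with hx | hx <;> rcases mul_eq_zero.1 f1 with hy | hy
    · exact Or.inl (ext_two hx hy)
    · refine Or.inr (Or.inl (ext_two hx ?_))
      rw [hx] at hy
      change p 1 = (2 * c - 1) / (2 * c - a)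
      rw [eq_div_iff hne]; linarith
    · refine Or.inr (Or.inr (Or.inl (ext_two ?_ hy)))
      rw [hy] at hx
      change p 0 = (2 * c - 1) / (2 * c - a)
      rw [eq_div_iff hne]; linarith
    · have hxy : (2 * b - a) * (p 0 - p 1) = 0 := by linarith
      have hxy' : p 0 = p 1 := by
        rcases mul_eq_zero.1 hxy with h | h
        · exact absurd (by linarith) hab
        · linarith
      refine Or.inr (Or.inr (Or.inr ?_))
      rw [lam3_eq]
      refine ext_two ?_ ?_
      · change p 0 = (2 * c - 1) / (4 * c - a - 2 * b)
        rw [eq_div_iff hne3, hxy']; rw [hxy'] at hx; linarith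
      · change p 1 = (2 * c - 1) / (4 * c - a - 2 * b)
        rw [eq_div_iff hne3]; rw [hxy'] at hx; linarith
  · rintro p (rfl | rfl | rfl | rfl)
    · exact lam0_mem_fixedSet
    · exact ⟨lam1_mem_T H hch, V_lam1 H hch⟩
    · exact ⟨lam2_mem_T H hch, V_lam2 H hch⟩
    · exact ⟨lam3_mem_T H hch, V_lam3 H hch⟩

theorem ncard_fixedSet (H : Admissible a b c) (hch : 1 / 2 < c) (hab : a ≠ 2 * b) :
    (fixedSet a b c).ncard = 4 := by
  rw [fixedSet_eq H hch hab]
  have h1 := (axis_coord_bounds H hch).1.ne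
  have h3 := (diag_coord_bounds H hch).1.ne
  have d01 : lam0 ≠ lam1 a c := fun h => h1 (congrFun h 1)
  have d02 : lam0 ≠ lam2 a c := fun h => h1 (congrFun h 0)
  have d03 : lam0 ≠ lam3 a b c := fun h => h3 (by rw [lam3_eq] at h; exact congrFun h 0)
  have d12 : lam1 a c ≠ lam2 a c := fun h => h1 (congrFun h 0)
  have d13 : lam1 a c ≠ lam3 a b c := fun h => h3 (by rw [lam3_eq] at h; exact congrFun h 0)
  have d23 : lam2 a c ≠ lam3 a b c := fun h => h3 (by rw [lam3_eq] at h; exact congrFun h 1)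
  rw [ncard_insert_of_notMem (by simp [d01, d02, d03]) (by simp),
    ncard_insert_of_notMem (by simp [d12, d13]) (by simp), ncard_pair d23]

theorem isRepelling_lam0 (hch : 1 / 2 < c) :
    IsRepelling (V a b c) lam0 := by
  have h : 1 < |2 * c| := lt_of_lt_of_le (by linarith) (le_abs_self _)
  refine isRepelling_of_trace_det V_lam0 (differentiableAt_V _ _ _ _) (m₁ := 2 * c) (m₂ := 2 * c)
    ?_ ?_ h h
  · rw [jacobian_V, Matrix.trace_fin_two]; simp [lam0]
  · rw [jacobian_V, Matrix.det_fin_two]; simp [lam0]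

/-- The multiplier of `V` at `λ₁` and `λ₂` transverse to the edge. -/
noncomputable def edgeMul (a b c : ℝ) : ℝ := 2 * c - 2 * (c - b) * ((2 * c - 1) / (2 * c - a))

/-- The multiplier of `V` at `λ₃` transverse to the diagonal. -/
noncomputable def diagMul (a b c : ℝ) : ℝ :=
  2 * c - 2 * (2 * c - a) * ((2 * c - 1) / (4 * c - a - 2 * b))

theorem edgeMul_pos (H : Admissible a b c) (hch : 1 / 2 < c) : 0 < edgeMul a b c := by
  have ⟨ha0, ha1, hb0, hb, hc0, hc⟩ := H
  have h : 0 < 2 * c - a := by linarith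
  have h2 : edgeMul a b c = (2 * c * (1 - a) + 2 * b * (2 * c - 1)) / (2 * c - a) := by
    rw [edgeMul]; field_simp; ring
  rw [h2]
  refine div_pos ?_ h
  have := mul_pos (by linarith : 0 < 2 * c) (by linarith : 0 < 1 - a)
  have := mul_nonneg (by linarith : 0 ≤ 2 * b) (by linarith : 0 ≤ 2 * c - 1)
  linarith

theorem edgeMul_sub_one (H : Admissible a b c) (hch : 1 / 2 < c) :
    edgeMul a b c - 1 = (2 * c - 1) * (2 * b - a) / (2 * c - a) := by
  have ⟨ha0, ha1, hb0, hb, hc0, hc⟩ := H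
  have h : 2 * c - a ≠ 0 := by linarith
  rw [edgeMul]; field_simp; ring

theorem diagMul_pos (H : Admissible a b c) (hch : 1 / 2 < c) : 0 < diagMul a b c := by
  have ⟨ha0, ha1, hb0, hb, hc0, hc⟩ := H
  have h1 := (diag_coord_bounds H hch).2
  have := mul_lt_mul_of_pos_left h1 (by linarith : 0 < 2 * (2 * c - a))
  rw [diagMul]; linarith

theorem diagMul_sub_one (H : Admissible a b c) (hch : 1 / 2 < c) :
    diagMul a b c - 1 = (2 * c - 1) * (a - 2 * b) / (4 * c - a - 2 * b) := by
  have ⟨ha0, ha1, hb0, hb, hc0, hc⟩ := H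
  have h : 4 * c - a - 2 * b ≠ 0 := by linarith
  have ht := mul_div_cancel₀ (2 * c - 1) h
  rw [diagMul, mul_div_right_comm]
  linear_combination -ht

theorem one_lt_edgeMul (H : Admissible a b c) (hch : 1 / 2 < c) (hab : a < 2 * b) :
    1 < edgeMul a b c := by
  rw [← sub_pos, edgeMul_sub_one H hch]
  have ⟨ha0, ha1, hb0, hb, hc0, hc⟩ := H
  exact div_pos (mul_pos (by linarith) (by linarith)) (by linarith)

theorem edgeMul_lt_one (H : Admissible a b c) (hch : 1 / 2 < c) (hab : 2 * b < a) :
    edgeMul a b c < 1 := by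
  rw [← sub_neg, edgeMul_sub_one H hch]
  have ⟨ha0, ha1, hb0, hb, hc0, hc⟩ := H
  exact div_neg_of_neg_of_pos (mul_neg_of_pos_of_neg (by linarith) (by linarith)) (by linarith)

theorem one_lt_diagMul (H : Admissible a b c) (hch : 1 / 2 < c) (hab : 2 * b < a) :
    1 < diagMul a b c := by
  rw [← sub_pos, diagMul_sub_one H hch]
  have ⟨ha0, ha1, hb0, hb, hc0, hc⟩ := H
  exact div_pos (mul_pos (by linarith) (by linarith)) (by linarith)

theorem diagMul_lt_one (H : Admissible a b c) (hch : 1 / 2 < c) (hab : a < 2 * b) :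
    diagMul a b c < 1 := by
  rw [← sub_neg, diagMul_sub_one H hch]
  have ⟨ha0, ha1, hb0, hb, hc0, hc⟩ := H
  exact div_neg_of_neg_of_pos (mul_neg_of_pos_of_neg (by linarith) (by linarith)) (by linarith)

theorem jacobian_lam1 (H : Admissible a b c) (hch : 1 / 2 < c) :
    jacobian (V a b c) (lam1 a c) =
      !![edgeMul a b c, 0; 2 * (b - c) * ((2 * c - 1) / (2 * c - a)), 2 - 2 * c] := by
  have ⟨ha0, ha1, hb0, hb, hc0, hc⟩ := H
  have h : 2 * c - a ≠ 0 := by linarith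
  have h2 : (2 * c - a) * ((2 * c - 1) / (2 * c - a)) = 2 * c - 1 := mul_div_cancel₀ _ h
  rw [jacobian_V, edgeMul, lam1]
  set t := (2 * c - 1) / (2 * c - a)
  refine Matrix.ext fun i j => ?_
  fin_cases i <;> fin_cases j
  · change 2 * c + 2 * (a - 2 * c) * 0 + 2 * (b - c) * t = 2 * c - 2 * (c - b) * t
    ring
  · change 2 * (b - c) * 0 = 0
    ring
  · rfl
  · change 2 * c + 2 * (b - c) * 0 + 2 * (a - 2 * c) * t = 2 - 2 * c
    linear_combination (-2) * h2

theorem jacobian_lam2 (H : Admissible a b c) (hch : 1 / 2 < c) :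
    jacobian (V a b c) (lam2 a c) =
      !![2 - 2 * c, 2 * (b - c) * ((2 * c - 1) / (2 * c - a)); 0, edgeMul a b c] := by
  have ⟨ha0, ha1, hb0, hb, hc0, hc⟩ := H
  have h : 2 * c - a ≠ 0 := by linarith
  have h2 : (2 * c - a) * ((2 * c - 1) / (2 * c - a)) = 2 * c - 1 := mul_div_cancel₀ _ h
  rw [jacobian_V, edgeMul, lam2]
  set t := (2 * c - 1) / (2 * c - a)
  refine Matrix.ext fun i j => ?_
  fin_cases i <;> fin_cases j
  · change 2 * c + 2 * (a - 2 * c) * t + 2 * (b - c) * 0 = 2 - 2 * c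
    linear_combination (-2) * h2
  · rfl
  · change 2 * (b - c) * 0 = 0
    ring
  · change 2 * c + 2 * (b - c) * t + 2 * (a - 2 * c) * 0 = 2 * c - 2 * (c - b) * t
    ring

theorem trace_det_lam3 (H : Admissible a b c) (hch : 1 / 2 < c) :
    (jacobian (V a b c) (lam3 a b c)).trace = (2 - 2 * c) + diagMul a b c ∧
    (jacobian (V a b c) (lam3 a b c)).det = (2 - 2 * c) * diagMul a b c := by
  have ⟨ha0, ha1, hb0, hb, hc0, hc⟩ := H
  have h : 4 * c - a - 2 * b ≠ 0 := by linarith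
  rw [jacobian_V, Matrix.trace_fin_two, Matrix.det_fin_two, diagMul, lam3_eq]
  simp only [Matrix.cons_val_zero, Matrix.cons_val_one, Matrix.of_apply]
  have ht := mul_div_cancel₀ (2 * c - 1) h
  set t := (2 * c - 1) / (4 * c - a - 2 * b)
  constructor
  · linear_combination (-2) * ht
  · linear_combination (-2) * (2 * c - 2 * (2 * c - a) * t) * ht

theorem abs_two_sub_lt (H : Admissible a b c) (hch : 1 / 2 < c) : |2 - 2 * c| < 1 := by
  have := H.c_le_one
  exact abs_lt.2 ⟨by linarith, by linarith⟩

theorem isAttracting_edge (H : Admissible a b c) (hch : 1 / 2 < c) (hab : 2 * b < a) :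
    IsAttracting (V a b c) (lam1 a c) ∧ IsAttracting (V a b c) (lam2 a c) := by
  have h1 := abs_two_sub_lt H hch
  have h2 : |edgeMul a b c| < 1 := by
    rw [abs_of_pos (edgeMul_pos H hch)]; exact edgeMul_lt_one H hch hab
  constructor
  · refine isAttracting_of_trace_det (V_lam1 H hch) (differentiableAt_V _ _ _ _) ?_ ?_ h1 h2
    · rw [jacobian_lam1 H hch, Matrix.trace_fin_two]; simp; ring
    · rw [jacobian_lam1 H hch, Matrix.det_fin_two]; simp; ring
  · refine isAttracting_of_trace_det (V_lam2 H hch) (differentiableAt_V _ _ _ _) ?_ ?_ h1 h2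
    · rw [jacobian_lam2 H hch, Matrix.trace_fin_two]; simp
    · rw [jacobian_lam2 H hch, Matrix.det_fin_two]; simp

theorem isSaddle_edge (H : Admissible a b c) (hch : 1 / 2 < c) (hab : a < 2 * b) :
    IsSaddle (V a b c) (lam1 a c) ∧ IsSaddle (V a b c) (lam2 a c) := by
  have h1 := abs_two_sub_lt H hch
  have h2 : 1 < |edgeMul a b c| := by
    rw [abs_of_pos (edgeMul_pos H hch)]; exact one_lt_edgeMul H hch hab
  constructor
  · refine isSaddle_of_trace_det (V_lam1 H hch) (differentiableAt_V _ _ _ _) ?_ ?_ h1 h2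
    · rw [jacobian_lam1 H hch, Matrix.trace_fin_two]; simp; ring
    · rw [jacobian_lam1 H hch, Matrix.det_fin_two]; simp; ring
  · refine isSaddle_of_trace_det (V_lam2 H hch) (differentiableAt_V _ _ _ _) ?_ ?_ h1 h2
    · rw [jacobian_lam2 H hch, Matrix.trace_fin_two]; simp
    · rw [jacobian_lam2 H hch, Matrix.det_fin_two]; simp

theorem isSaddle_lam3 (H : Admissible a b c) (hch : 1 / 2 < c) (hab : 2 * b < a) :
    IsSaddle (V a b c) (lam3 a b c) :=
  isSaddle_of_trace_det (V_lam3 H hch) (differentiableAt_V _ _ _ _) (trace_det_lam3 H hch).1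
    (trace_det_lam3 H hch).2 (abs_two_sub_lt H hch)
    (by rw [abs_of_pos (diagMul_pos H hch)]; exact one_lt_diagMul H hch hab)

theorem isAttracting_lam3 (H : Admissible a b c) (hch : 1 / 2 < c) (hab : a < 2 * b) :
    IsAttracting (V a b c) (lam3 a b c) :=
  isAttracting_of_trace_det (V_lam3 H hch) (differentiableAt_V _ _ _ _) (trace_det_lam3 H hch).1
    (trace_det_lam3 H hch).2 (abs_two_sub_lt H hch)
    (by rw [abs_of_pos (diagMul_pos H hch)]; exact diagMul_lt_one H hch hab)

end Fixed

/-! ### Invariant lines -/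

section Lines

variable {a b c : ℝ}

/-- On a line through the origin on which `V` is a logistic map, trajectories converge to the
fixed point of that map. -/
theorem tendsto_of_logistic_line {w : Fin 2 → ℝ} {α β s : ℝ}
    (hw : ∀ t : ℝ, V a b c (t • w) = (t * (α - β * t)) • w) (hα : 1 < α) (hα2 : α ≤ 2)
    (hβα : β ≤ α) (hβ : α - 1 < β) (hs0 : 0 < s) (hs1 : s ≤ 1) (hs : 0 < α - β ∨ s < 1) :
    Tendsto (fun n : ℕ => (V a b c)^[n] (s • w)) atTop (𝓝 (((α - 1) / β) • w)) := by
  have hconj : Function.Semiconj (fun t : ℝ => t • w) (fun t => t * (α - β * t)) (V a b c) :=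
    fun t => (hw t).symm
  have h1 := (tendsto_logistic hα hα2 hβα hβ hs0 hs1 hs).smul_const w
  exact h1.congr fun n => hconj.iterate_right n s

theorem tendsto_lam1_of_mem_MZero (H : Admissible a b c) (hch : 1 / 2 < c) {p : Fin 2 → ℝ}
    (hp : p ∈ MZero) (h0 : p 1 ≠ 0) (h1 : 0 < a ∨ p 1 < 1) :
    Tendsto (fun n : ℕ => (V a b c)^[n] p) atTop (𝓝 (lam1 a c)) := by
  have ⟨ha0, ha1, hb0, hb, hc0, hc⟩ := H
  obtain ⟨⟨hx, hy, hs⟩, hx0⟩ := hp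
  have h := tendsto_of_logistic_line (a := a) (b := b) (c := c) (w := ![0, 1]) (α := 2 * c)
    (β := 2 * c - a) (s := p 1)
    (fun t => ext_two (by simp) (by
      simp only [V_apply_one, Pi.smul_apply, Matrix.cons_val_zero, Matrix.cons_val_one,
        smul_eq_mul]
      ring)) (by linarith) (by linarith) (by linarith)
    (by linarith) (lt_of_le_of_ne hy (Ne.symm h0)) (by linarith)
    (h1.imp_left fun h => by linarith)
  have e1 : p = p 1 • ![0, 1] := ext_two (by simp [hx0]) (by simp)
  have e2 : lam1 a c = ((2 * c - 1) / (2 * c - a)) • ![0, 1] :=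
    ext_two (by simp [lam1]) (by simp [lam1])
  rwa [← e1, ← e2] at h

theorem tendsto_lam3_of_mem_MEq (H : Admissible a b c) (hch : 1 / 2 < c) (hab : 2 * b < a)
    {p : Fin 2 → ℝ} (hp : p ∈ MEq) (h0 : p ≠ lam0) :
    Tendsto (fun n : ℕ => (V a b c)^[n] p) atTop (𝓝 (lam3 a b c)) := by
  have ⟨ha0, ha1, hb0, hb, hc0, hc⟩ := H
  obtain ⟨⟨hx, hy, hs⟩, hxy⟩ := hp
  have hpos : 0 < p 0 := lt_of_le_of_ne hx fun h =>
    h0 (ext_two h.symm (by rw [← hxy, ← h]; rfl))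
  have h := tendsto_of_logistic_line (a := a) (b := b) (c := c) (w := ![1 / 2, 1 / 2])
    (α := 2 * c) (β := 2 * c - a / 2 - b) (s := 2 * p 0)
    (fun t => ext_two (by simp; ring) (by simp; ring)) (by linarith) (by linarith) (by linarith)
    (by linarith) (by linarith) (by linarith) (Or.inl (by linarith))
  have h3 : 4 * c - a - 2 * b ≠ 0 := by linarith
  have h3' : 2 * c - a / 2 - b ≠ 0 := by linarith
  have h4 : (2 * c - 1) / (4 * c - a - 2 * b) = (2 * c - 1) / (2 * c - a / 2 - b) * (1 / 2) := by
    rw [show 4 * c - a - 2 * b = 2 * (2 * c - a / 2 - b) by ring]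
    field_simp
  have e1 : p = (2 * p 0) • ![1 / 2, 1 / 2] := by
    refine ext_two ?_ ?_
    · change p 0 = 2 * p 0 * (1 / 2); ring
    · change p 1 = 2 * p 0 * (1 / 2); rw [hxy]; ring
  have e2 : lam3 a b c = ((2 * c - 1) / (2 * c - a / 2 - b)) • ![1 / 2, 1 / 2] := by
    rw [lam3_eq, h4]
    exact ext_two rfl rfl
  rwa [← e1, ← e2] at h

/-! ### The degenerate case `a = 2b` -/

theorem fixedSet_of_eq (H : Admissible a b c) (hch : 1 / 2 < c) (hab : a = 2 * b) :
    fixedSet a b c = {lam0} ∪ segF b c := by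
  have ⟨ha0, ha1, hb0, hb, hc0, hc⟩ := H
  have hne : 2 * (c - b) ≠ 0 := by linarith
  ext p
  constructor
  · rintro ⟨hp, hfix⟩
    have e0 := congrFun hfix 0
    have e1 := congrFun hfix 1
    rw [V_apply_zero] at e0
    rw [V_apply_one] at e1
    have f0 : p 0 * (2 * c - 1 - 2 * (c - b) * (p 0 + p 1)) = 0 := by rw [hab] at e0; linarith
    have f1 : p 1 * (2 * c - 1 - 2 * (c - b) * (p 0 + p 1)) = 0 := by rw [hab] at e1; linarith
    by_cases h : 2 * c - 1 - 2 * (c - b) * (p 0 + p 1) = 0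
    · refine Or.inr ⟨hp, ?_⟩
      rw [eq_div_iff hne]; linarith
    · exact Or.inl (ext_two ((mul_eq_zero.1 f0).resolve_right h)
        ((mul_eq_zero.1 f1).resolve_right h))
  · rintro (rfl | ⟨hp, hs⟩)
    · exact lam0_mem_fixedSet
    · rw [eq_div_iff hne] at hs
      refine ⟨hp, ext_two ?_ ?_⟩
      · rw [V_apply_zero, hab]; linear_combination (-p 0) * hs
      · rw [V_apply_one, hab]; linear_combination (-p 1) * hs

theorem segment_sum_bounds (H : Admissible a b c) (hch : 1 / 2 < c) (hab : a = 2 * b) :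
    0 < (2 * c - 1) / (2 * (c - b)) ∧ (2 * c - 1) / (2 * (c - b)) ≤ 1 := by
  have ⟨ha0, ha1, hb0, hb, hc0, hc⟩ := H
  exact ⟨div_pos (by linarith) (by linarith), (div_le_one (by linarith)).2 (by linarith)⟩

theorem mk_segF (H : Admissible a b c) (hch : 1 / 2 < c) (hab : a = 2 * b) :
    Cardinal.mk (segF b c) = Cardinal.continuum := by
  obtain ⟨hs0, hs1⟩ := segment_sum_bounds H hch hab
  set s := (2 * c - 1) / (2 * (c - b)) with hs
  apply le_antisymm
  · rw [← Cardinal.mk_real]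
    refine Cardinal.mk_le_of_injective (f := fun p : segF b c => p.1 0) fun p q hpq => ?_
    have hp := p.2.2
    have hq := q.2.2
    simp only at hpq
    exact Subtype.ext (ext_two hpq (by linarith))
  · rw [← Cardinal.mk_Icc_real hs0]
    refine Cardinal.mk_le_of_injective
      (f := fun t : Icc (0 : ℝ) s => (⟨![t.1, s - t.1],
        ⟨t.2.1, by simpa using t.2.2, by simpa using hs1⟩, by simp [← hs]⟩ : segF b c))
      fun t t' h => ?_
    have := congrFun (congrArg Subtype.val h) 0
    exact Subtype.ext this

theorem mapsTo_ray (H : Admissible a b c) (hab : a = 2 * b) (ν : ℝ) :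
    MapsTo (V a b c) (ray ν) (ray ν) := by
  rintro p ⟨hp, hν⟩
  refine ⟨mapsTo_T H hp, ?_⟩
  rw [V_apply_zero, V_apply_one, hν, hab]; ring

theorem lamBar_mem (H : Admissible a b c) (hch : 1 / 2 < c) (hab : a = 2 * b) {ν : ℝ}
    (hν : 0 ≤ ν) : lamBar b c ν ∈ ray ν ∩ segF b c := by
  obtain ⟨hs0, hs1⟩ := segment_sum_bounds H hch hab
  have ⟨ha0, ha1, hb0, hb, hc0, hc⟩ := H
  have h1 : 0 < 1 + ν := by linarith
  have h2 : 0 < c - b := by linarith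
  have h3 : 0 < 2 * c - 1 := by linarith
  have e0 : lamBar b c ν 0 = (2 * c - 1) / (2 * (c - b) * (1 + ν)) := rfl
  have e1 : lamBar b c ν 1 = (2 * c - 1) * ν / (2 * (c - b) * (1 + ν)) := rfl
  have hsum : lamBar b c ν 0 + lamBar b c ν 1 = (2 * c - 1) / (2 * (c - b)) := by
    rw [e0, e1]; field_simp
  have hT : lamBar b c ν ∈ T :=
    ⟨by rw [e0]; positivity, by rw [e1]; positivity, by rw [hsum]; exact hs1⟩
  exact ⟨⟨hT, by rw [e0, e1]; ring⟩, hT, hsum⟩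

theorem tendsto_lamBar (H : Admissible a b c) (hch : 1 / 2 < c) (hab : a = 2 * b) {p : Fin 2 → ℝ}
    (hp : p ∈ T) (hx0 : p 0 ≠ 0) (h : 0 < b ∨ p 0 + p 1 < 1) :
    Tendsto (fun n : ℕ => (V a b c)^[n] p) atTop (𝓝 (lamBar b c (p 1 / p 0))) := by
  have ⟨ha0, ha1, hb0, hb, hc0, hc⟩ := H
  obtain ⟨hx, hy, hs⟩ := hp
  have hx' : 0 < p 0 := lt_of_le_of_ne hx (Ne.symm hx0)
  have hs0 : 0 < p 0 + p 1 := by linarith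
  have h2 : c - b ≠ 0 := by linarith
  have hlim := tendsto_of_logistic_line (a := a) (b := b) (c := c)
    (w := ![p 0 / (p 0 + p 1), p 1 / (p 0 + p 1)]) (α := 2 * c) (β := 2 * (c - b))
    (s := p 0 + p 1) (fun t => by
      subst hab
      refine ext_two ?_ ?_
      all_goals
        simp only [V_apply_zero, V_apply_one, Pi.smul_apply, Matrix.cons_val_zero,
          Matrix.cons_val_one, smul_eq_mul]
        field_simp
        ring)
    (by linarith) (by linarith) (by linarith) (by linarith) hs0 hs
    (h.imp_left fun h => by linarith)
  have e1 : p = (p 0 + p 1) • ![p 0 / (p 0 + p 1), p 1 / (p 0 + p 1)] :=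
    ext_two (mul_div_cancel₀ _ hs0.ne').symm (mul_div_cancel₀ _ hs0.ne').symm
  have e2 : lamBar b c (p 1 / p 0) =
      ((2 * c - 1) / (2 * (c - b))) • ![p 0 / (p 0 + p 1), p 1 / (p 0 + p 1)] := by
    refine ext_two ?_ ?_
    · change (2 * c - 1) / (2 * (c - b) * (1 + p 1 / p 0)) =
        (2 * c - 1) / (2 * (c - b)) * (p 0 / (p 0 + p 1))
      field_simp
    · change (2 * c - 1) * (p 1 / p 0) / (2 * (c - b) * (1 + p 1 / p 0)) =
        (2 * c - 1) / (2 * (c - b)) * (p 1 / (p 0 + p 1))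
      field_simp
  rwa [← e1, ← e2] at hlim

end Lines

/-! ### Stable manifolds that are line segments -/

/-- If `F` multiplies a function `ℓ`, whose zero set is the line `P + ℝ v`, by a factor that
exceeds `1` at the fixed point `P`, then trajectories that stay close to `P` lie on that line. -/
theorem isStableManifold_of_line {m : ℕ} {F : (Fin m → ℝ) → (Fin m → ℝ)} {D S : Set (Fin m → ℝ)}
    {P v : Fin m → ℝ} {μ B : ℝ} {ℓ φ : (Fin m → ℝ) → ℝ} (hD : MapsTo F D D)
    (hℓ : ∀ p, ℓ (F p) = ℓ p * φ p) (hℓB : ∀ p ∈ D, |ℓ p| ≤ B)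
    (hφ : ContinuousAt φ P) (hφ1 : 1 < φ P) (hline : ∀ p, ℓ p = 0 ↔ ∃ t : ℝ, p = P + t • v)
    (hS : ∀ p ∈ S, p ∈ D ∧ ℓ p = 0 ∧ Tendsto (fun n : ℕ => F^[n] p) atTop (𝓝 P))
    (hstable : ∀ p ∈ D, Tendsto (fun n : ℕ => F^[n] p) atTop (𝓝 P) →
      (∀ n, φ (F^[n] p) ≠ 0) ∧ (ℓ p = 0 → p ∈ S))
    (hlocal : ∀ᶠ p in 𝓝 P, p ∈ D → ℓ p = 0 → p ∈ S)
    (hv : v ≠ 0) (hμ : |μ| < 1) (hJ : (jacobian F P).mulVec v = μ • v) :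
    IsStableManifold F D P S := by
  set κ := (1 + φ P) / 2 with hκ
  have hκ1 : 1 < κ := by rw [hκ]; linarith
  have hev : ∀ᶠ p in 𝓝 P, κ < φ p := hφ.eventually_const_lt (by rw [hκ]; linarith)
  obtain ⟨ε, hε, hball⟩ := Metric.eventually_nhds_iff.1 (hev.and hlocal)
  -- expansion away from the line
  have hexp : ∀ q ∈ D, (∀ n : ℕ, dist (F^[n] q) P < ε) → ℓ q = 0 := by
    intro q hq hn
    have hgrow : ∀ n : ℕ, κ ^ n * |ℓ q| ≤ |ℓ (F^[n] q)| := by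
      intro n
      induction n with
      | zero => simp
      | succ n ih =>
        have hf := (hball (hn n)).1
        rw [Function.iterate_succ_apply', hℓ, abs_mul, pow_succ]
        have h1 : κ ≤ |φ (F^[n] q)| := hf.le.trans (le_abs_self _)
        calc κ ^ n * κ * |ℓ q| = (κ ^ n * |ℓ q|) * κ := by ring
          _ ≤ |ℓ (F^[n] q)| * |φ (F^[n] q)| := by gcongr
    by_contra hne
    have hpos : 0 < |ℓ q| := abs_pos.2 hne
    obtain ⟨n, hn'⟩ := pow_unbounded_of_one_lt (B / |ℓ q|) hκ1
    rw [div_lt_iff₀ hpos] at hn'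
    linarith [hgrow n, hℓB _ (hD.iterate n hq)]
  refine ⟨?_, ⟨ε, hε, fun q hq hn => ?_⟩, v, μ, hμ, hJ, ?_⟩
  · ext q
    refine ⟨fun h => ⟨(hS q h).1, (hS q h).2.2⟩, fun ⟨hq, hlim⟩ => ?_⟩
    obtain ⟨N, hN⟩ := (Metric.tendsto_atTop.1 hlim) ε hε
    obtain ⟨hne, hmem⟩ := hstable q hq hlim
    have hzero : ℓ (F^[N] q) = 0 := hexp _ (hD.iterate N hq) fun n => by
      rw [← Function.iterate_add_apply]; exact hN _ (by omega)
    refine hmem ?_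
    clear hN
    induction N with
    | zero => exact hzero
    | succ N ih =>
      rw [Function.iterate_succ_apply', hℓ] at hzero
      exact ih ((mul_eq_zero.1 hzero).resolve_right (hne N))
  · have h0 := hn 0
    exact (hball h0).2 hq (hexp q hq hn)
  · have hd : ∀ t : ℝ, HasDerivAt (fun t : ℝ => P + t • v) v t := fun t => by
      simpa using ((hasDerivAt_id' t).smul_const v).const_add P
    refine ⟨1, one_pos, fun t => P + t • v, by fun_prop, fun t _ => by rwa [(hd t).deriv],
      by simp, (hd 0).deriv, {p | p ∈ D → ℓ p = 0 → p ∈ S} ∩ Metric.ball P ‖v‖,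
      inter_mem hlocal (Metric.ball_mem_nhds _ (norm_pos_iff.2 hv)), ?_⟩
    ext p
    constructor
    · rintro ⟨hp, hpU, hpb⟩
      obtain ⟨hpD, hp0, -⟩ := hS p hp
      obtain ⟨t, rfl⟩ := (hline p).1 hp0
      refine ⟨⟨⟨t, ?_, rfl⟩, hpD⟩, hpU, hpb⟩
      rw [Metric.mem_ball, dist_eq_norm, add_sub_cancel_left, norm_smul, Real.norm_eq_abs] at hpb
      exact abs_lt.1 (lt_of_mul_lt_mul_right (by rwa [one_mul]) (norm_nonneg v))
    · rintro ⟨⟨⟨t, -, rfl⟩, hpD⟩, hpU, hpb⟩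
      exact ⟨hpU hpD ((hline _).2 ⟨t, rfl⟩), hpU, hpb⟩

section StableManifolds

variable {a b c : ℝ}

theorem isStableManifold_lam1 (H : Admissible a b c) (hch : 1 / 2 < c) (hab : a < 2 * b) :
    IsStableManifold (V a b c) T (lam1 a c)
      {p | p ∈ MZero ∧ p 1 ≠ 0 ∧ (0 < a ∨ p 1 < 1)} := by
  have ⟨ha0, ha1, hb0, hb, hc0, hc⟩ := H
  obtain ⟨hd0, hd1⟩ := axis_coord_bounds H hch
  refine isStableManifold_of_line (v := ![0, 1]) (μ := 2 - 2 * c) (B := 1) (ℓ := fun p => p 0)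
    (φ := fun p => 2 * c + (a - 2 * c) * p 0 + 2 * (b - c) * p 1) (mapsTo_T H)
    (fun p => V_apply_zero a b c p) ?_ (by fun_prop) ?_ ?_ ?_ ?_ ?_ ?_ (abs_two_sub_lt H hch) ?_
  · rintro p ⟨hx, hy, hs⟩
    rw [abs_of_nonneg hx]; linarith
  · have := one_lt_edgeMul H hch hab
    rw [edgeMul] at this
    simp only [lam1, Matrix.cons_val_zero, Matrix.cons_val_one]
    linarith
  · intro p
    constructor
    · intro hp
      exact ⟨p 1 - lam1 a c 1, ext_two (by simpa [lam1] using hp) (by simp)⟩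
    · rintro ⟨t, rfl⟩
      simp [lam1]
  · rintro p ⟨hp, h0, h1⟩
    exact ⟨hp.1, hp.2, tendsto_lam1_of_mem_MZero H hch hp h0 h1⟩
  · intro p hp hlim
    have hT : ∀ n, (V a b c)^[n] p ∈ T := iterate_mem_T H hp
    -- the second coordinate cannot vanish along the trajectory, since zero would persist
    have hy : ∀ n, (V a b c)^[n] p 1 ≠ 0 := by
      intro n hn
      have hpers : ∀ k, (V a b c)^[n + k] p 1 = 0 := by
        intro k
        induction k with
        | zero => exact hn
        | succ k ih =>
          rw [← add_assoc, Function.iterate_succ_apply', V_apply_one, ih, zero_mul]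
      have h1 : Tendsto (fun k : ℕ => (V a b c)^[n + k] p 1) atTop (𝓝 (lam1 a c 1)) := by
        have h2 := (tendsto_pi_nhds.1 hlim 1).comp (tendsto_add_atTop_nat n)
        refine h2.congr fun k => ?_
        rw [Function.comp_apply, add_comm]
      simp only [hpers] at h1
      exact hd0.ne (tendsto_nhds_unique tendsto_const_nhds h1)
    refine ⟨fun n => ?_, fun hx => ⟨⟨hp, hx⟩, hy 0, ?_⟩⟩
    · obtain ⟨hx0, hy0, hs⟩ := hT n
      have hy1 : 0 < (V a b c)^[n] p 1 := lt_of_le_of_ne hy0 (Ne.symm (hy n))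
      have h1 : 0 ≤ 2 * c * (1 - (V a b c)^[n] p 0 - (V a b c)^[n] p 1) :=
        mul_nonneg (by linarith) (by linarith)
      have h2 : 0 ≤ a * (V a b c)^[n] p 0 := mul_nonneg ha0 hx0
      have h3 : 0 < 2 * b * (V a b c)^[n] p 1 := mul_pos (by linarith) hy1
      linarith
    · by_contra! hcon
      have ha : a = 0 := le_antisymm hcon.1 ha0
      have h1 : p 1 = 1 := le_antisymm (by linarith [hp.1, hp.2.2]) hcon.2
      refine hy 1 ?_
      rw [Function.iterate_one, V_apply_one, hx, h1, ha]; ring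
  · have h0 : ∀ᶠ p : Fin 2 → ℝ in 𝓝 (lam1 a c), 0 < p 1 :=
      (continuous_apply 1).continuousAt.eventually_const_lt hd0
    have h1 : ∀ᶠ p : Fin 2 → ℝ in 𝓝 (lam1 a c), p 1 < 1 :=
      (continuous_apply 1).continuousAt.eventually_lt_const hd1
    filter_upwards [h0, h1] with p hp0 hp1 hpT hpx
    exact ⟨⟨hpT, hpx⟩, hp0.ne', Or.inr hp1⟩
  · exact fun h => one_ne_zero (congrFun h 1)
  · rw [jacobian_lam1 H hch]
    ext i; fin_cases i <;> simp

theorem isStableManifold_lam2 (H : Admissible a b c) (hch : 1 / 2 < c) (hab : a < 2 * b) :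
    IsStableManifold (V a b c) T (lam2 a c)
      {p | p ∈ MOne ∧ p 0 ≠ 0 ∧ (0 < a ∨ p 0 < 1)} := by
  have h := (isStableManifold_lam1 H hch hab).map swapXY (V_swapXY a b c) swapXY_mem_T
    (differentiableAt_V a b c _)
  rw [swapXY_lam1] at h
  convert h using 1
  ext p
  constructor
  · rintro ⟨⟨hp, h0⟩, h1, h2⟩
    exact ⟨swapXY p, ⟨⟨(swapXY_mem_T p).2 hp, h0⟩, h1, h2⟩, ext_two rfl rfl⟩
  · rintro ⟨q, ⟨⟨hq, h0⟩, h1, h2⟩, rfl⟩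
    exact ⟨⟨(swapXY_mem_T q).2 hq, h0⟩, h1, h2⟩

theorem isStableManifold_lam3 (H : Admissible a b c) (hch : 1 / 2 < c) (hab : 2 * b < a) :
    IsStableManifold (V a b c) T (lam3 a b c) (MEq \ {lam0}) := by
  have ⟨ha0, ha1, hb0, hb, hc0, hc⟩ := H
  obtain ⟨hd0, hd1⟩ := diag_coord_bounds H hch
  have hne : 4 * c - a - 2 * b ≠ 0 := by linarith
  have hpos : 0 < lam3 a b c 0 := by rw [lam3_eq]; exact hd0
  refine isStableManifold_of_line (v := ![1, 1]) (μ := 2 - 2 * c) (B := 1)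
    (ℓ := fun p => p 0 - p 1)
    (φ := fun p => 2 * c * (1 - p 0 - p 1) + a * (p 0 + p 1)) (mapsTo_T H)
    (fun p => V_diff a b c p) ?_ (by fun_prop) ?_ ?_ ?_ ?_ ?_ ?_ (abs_two_sub_lt H hch) ?_
  · rintro p ⟨hx, hy, hs⟩
    exact abs_le.2 ⟨by linarith, by linarith⟩
  · have := one_lt_diagMul H hch hab
    rw [diagMul] at this
    rw [lam3_eq]
    simp only [Matrix.cons_val_zero, Matrix.cons_val_one]
    linarith
  · intro p
    rw [lam3_eq]
    constructor
    · intro hp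
      refine ⟨p 0 - (2 * c - 1) / (4 * c - a - 2 * b), ext_two (by simp) ?_⟩
      change p 1 = (2 * c - 1) / (4 * c - a - 2 * b)
        + (p 0 - (2 * c - 1) / (4 * c - a - 2 * b)) * 1
      linarith
    · rintro ⟨t, rfl⟩
      simp
  · rintro p ⟨hp, h0⟩
    exact ⟨hp.1, sub_eq_zero.2 hp.2, tendsto_lam3_of_mem_MEq H hch hab hp h0⟩
  · intro p hp hlim
    refine ⟨fun n => ?_, fun hx => ⟨⟨hp, sub_eq_zero.1 hx⟩, fun h0 => ?_⟩⟩
    · obtain ⟨hx0, hy0, hs⟩ := iterate_mem_T H hp n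
      set s := (V a b c)^[n] p 0 + (V a b c)^[n] p 1 with hsdef
      have : 2 * c * (1 - (V a b c)^[n] p 0 - (V a b c)^[n] p 1) = 2 * c * (1 - s) := by
        rw [hsdef]; ring
      simp only [this]
      nlinarith
    · rw [mem_singleton_iff.1 h0] at hlim
      have h2 : ∀ n : ℕ, (V a b c)^[n] lam0 = lam0 := fun n => Function.iterate_fixed V_lam0 n
      simp only [h2] at hlim
      have := congrFun (tendsto_nhds_unique tendsto_const_nhds hlim) 0
      rw [← this] at hpos
      exact lt_irrefl _ hpos
  · have h0 : ∀ᶠ p : Fin 2 → ℝ in 𝓝 (lam3 a b c), 0 < p 0 :=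
      (continuous_apply 0).continuousAt.eventually_const_lt hpos
    filter_upwards [h0] with p hp0 hpT hpx
    refine ⟨⟨hpT, sub_eq_zero.1 hpx⟩, fun h => hp0.ne' ?_⟩
    rw [mem_singleton_iff.1 h]; rfl
  · exact fun h => one_ne_zero (congrFun h 1)
  · rw [jacobian_V, lam3_eq]
    have : (4 * c - a - 2 * b) * ((2 * c - 1) / (4 * c - a - 2 * b)) = 2 * c - 1 :=
      mul_div_cancel₀ _ hne
    ext i
    fin_cases i
    · simp [Matrix.mulVec, dotProduct]; linear_combination (-2) * this
    · simp [Matrix.mulVec, dotProduct]; linear_combination (-2) * this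

end StableManifolds

/-! ### Arcs glued from two compactified half-lines -/

section Arcs

variable {E : Type*}

open Classical in
/-- The half-line `[0, ∞)`, parametrized by `t = τ / (1 - τ)` with `τ ∈ [0, 1)`, together with an
end point `L` at `τ = 1`. -/
noncomputable def compactify (f : ℝ → E) (L : E) (τ : ℝ) : E :=
  if τ < 1 then f (τ / (1 - τ)) else L

open Classical in
/-- Two arcs that start at the same point, joined to one arc with parameter in `[-1, 1]`. -/
noncomputable def joinArcs (h₁ h₂ : ℝ → E) (τ : ℝ) : E :=
  if 0 ≤ τ then h₂ τ else h₁ (-τ)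

theorem compactify_zero (f : ℝ → E) (L : E) : compactify f L 0 = f 0 := by
  simp [compactify]

theorem compactify_one (f : ℝ → E) (L : E) : compactify f L 1 = L := by
  simp [compactify]

theorem compactify_image_Ico (f : ℝ → E) (L : E) : compactify f L '' Ico 0 1 = f '' Ici 0 := by
  ext p
  constructor
  · rintro ⟨τ, ⟨h0, h1⟩, rfl⟩
    exact ⟨τ / (1 - τ), div_nonneg h0 (by linarith), by rw [compactify, if_pos h1]⟩
  · rintro ⟨t, ht, rfl⟩
    have ht' : (0 : ℝ) ≤ t := ht
    have h1 : t / (1 + t) < 1 := (div_lt_one (by linarith)).2 (by linarith)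
    refine ⟨t / (1 + t), ⟨by positivity, h1⟩, ?_⟩
    rw [compactify, if_pos h1]
    congr 1
    field_simp
    ring

theorem compactify_image_Icc (f : ℝ → E) (L : E) :
    compactify f L '' Icc 0 1 = insert L (f '' Ici 0) := by
  rw [← Ico_insert_right zero_le_one, image_insert_eq, compactify_one, compactify_image_Ico]

theorem continuousOn_compactify [TopologicalSpace E] {f : ℝ → E} {L : E} (hf : Continuous f)
    (hL : Tendsto f atTop (𝓝 L)) : ContinuousOn (compactify f L) (Icc 0 1) := by
  rintro τ ⟨h0, h1⟩
  rcases h1.lt_or_eq with h1 | rfl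
  · refine ContinuousAt.continuousWithinAt ?_
    have h2 : ContinuousAt (fun s : ℝ => f (s / (1 - s))) τ :=
      hf.continuousAt.comp (continuousAt_id.div (continuousAt_const.sub continuousAt_id)
        (sub_pos.2 h1).ne')
    refine h2.congr ?_
    filter_upwards [eventually_lt_nhds h1] with s hs
    rw [compactify, if_pos hs]
  · rw [← Ico_insert_right zero_le_one, ContinuousWithinAt, compactify_one, nhdsWithin_insert,
      tendsto_sup]
    refine ⟨?_, ?_⟩
    · rw [tendsto_pure_left]
      intro s hs
      rw [compactify_one]
      exact mem_of_mem_nhds hs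
    · have h2 : Tendsto (fun s : ℝ => s / (1 - s)) (𝓝[Ico 0 1] 1) atTop := by
        have hinv : Tendsto (fun s : ℝ => (1 - s)⁻¹) (𝓝[Ico 0 1] 1) atTop := by
          refine tendsto_inv_nhdsGT_zero.comp (tendsto_nhdsWithin_iff.2 ⟨?_, ?_⟩)
          · have : Tendsto (fun s : ℝ => 1 - s) (𝓝 1) (𝓝 (1 - 1)) :=
              tendsto_const_nhds.sub tendsto_id
            rw [sub_self] at this
            exact this.mono_left nhdsWithin_le_nhds
          · filter_upwards [self_mem_nhdsWithin] with s hs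
            exact sub_pos.2 hs.2
        have hid : Tendsto (fun s : ℝ => s) (𝓝[Ico 0 1] 1) (𝓝 1) :=
          tendsto_id.mono_left nhdsWithin_le_nhds
        simpa only [div_eq_mul_inv] using hid.pos_mul_atTop one_pos hinv
      refine (hL.comp h2).congr' ?_
      filter_upwards [self_mem_nhdsWithin] with s hs
      rw [compactify, if_pos hs.2, Function.comp_apply]

theorem strictMonoOn_compactify {g : ℝ → ℝ} {l : ℝ} (hg : StrictMonoOn g (Ici 0))
    (hl : Tendsto g atTop (𝓝 l)) : StrictMonoOn (compactify g l) (Icc 0 1) := by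
  have hlt : ∀ t ≥ 0, g t < l := by
    intro t ht
    have h1 : g t < g (t + 1) := hg ht (show (0 : ℝ) ≤ t + 1 by linarith) (by linarith)
    refine h1.trans_le (ge_of_tendsto hl ?_)
    filter_upwards [eventually_ge_atTop (t + 1)] with s hs
    exact hg.monotoneOn (show (0 : ℝ) ≤ t + 1 by linarith) (show (0 : ℝ) ≤ s by linarith) hs
  rintro σ ⟨hσ0, hσ1⟩ τ ⟨hτ0, hτ1⟩ hστ
  have hσ : σ < 1 := by linarith
  have hσ' : 0 ≤ σ / (1 - σ) := div_nonneg hσ0 (by linarith)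
  rw [compactify, if_pos hσ]
  rcases hτ1.lt_or_eq with h | rfl
  · rw [compactify, if_pos h]
    refine hg hσ' (div_nonneg hτ0 (by linarith)) ?_
    rw [div_lt_div_iff₀ (by linarith) (by linarith)]
    linarith
  · rw [compactify_one]
    exact hlt _ hσ'

theorem comp_compactify {E' : Type*} (d : E → E') (f : ℝ → E) (L : E) (τ : ℝ) :
    d (compactify f L τ) = compactify (fun t => d (f t)) (d L) τ := by
  rw [compactify, compactify, apply_ite d]

variable {h₁ h₂ : ℝ → E}

theorem joinArcs_of_nonneg {τ : ℝ} (hτ : 0 ≤ τ) : joinArcs h₁ h₂ τ = h₂ τ := if_pos hτ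

theorem joinArcs_of_neg {τ : ℝ} (hτ : τ < 0) : joinArcs h₁ h₂ τ = h₁ (-τ) := if_neg hτ.not_ge

theorem joinArcs_of_nonpos (h : h₁ 0 = h₂ 0) {τ : ℝ} (hτ : τ ≤ 0) :
    joinArcs h₁ h₂ τ = h₁ (-τ) := by
  rcases hτ.lt_or_eq with hτ | rfl
  · exact joinArcs_of_neg hτ
  · rw [joinArcs_of_nonneg le_rfl, neg_zero, h]

theorem joinArcs_image_Ioc : joinArcs h₁ h₂ '' Ioc 0 1 = h₂ '' Ioc 0 1 :=
  image_congr fun _ hτ => joinArcs_of_nonneg hτ.1.le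

theorem joinArcs_image_Ico : joinArcs h₁ h₂ '' Ico (-1) 0 = h₁ '' Ioc 0 1 := by
  rw [image_congr fun _ hτ => joinArcs_of_neg hτ.2, ← image_image h₁ (fun τ : ℝ => -τ)]
  simp

theorem joinArcs_image_Icc (h : h₁ 0 = h₂ 0) :
    joinArcs h₁ h₂ '' Icc (-1) 1 = h₁ '' Icc 0 1 ∪ h₂ '' Icc 0 1 := by
  rw [← Icc_union_Icc_eq_Icc (by norm_num : (-1 : ℝ) ≤ 0) zero_le_one, image_union,
    image_congr fun _ hτ => joinArcs_of_nonpos h hτ.2,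
    image_congr (s := Icc 0 1) fun _ hτ => joinArcs_of_nonneg hτ.1,
    ← image_image h₁ (fun τ : ℝ => -τ)]
  simp

theorem joinArcs_image_Ioo (h : h₁ 0 = h₂ 0) :
    joinArcs h₁ h₂ '' Ioo (-1) 1 = h₁ '' Ico 0 1 ∪ h₂ '' Ico 0 1 := by
  rw [← Ioc_union_Ico_eq_Ioo (by norm_num : (-1 : ℝ) < 0) zero_lt_one, image_union,
    image_congr fun _ hτ => joinArcs_of_nonpos h hτ.2,
    image_congr (s := Ico 0 1) fun _ hτ => joinArcs_of_nonneg hτ.1,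
    ← image_image h₁ (fun τ : ℝ => -τ)]
  simp

theorem continuousOn_joinArcs [TopologicalSpace E] (h : h₁ 0 = h₂ 0)
    (c₁ : ContinuousOn h₁ (Icc 0 1)) (c₂ : ContinuousOn h₂ (Icc 0 1)) :
    ContinuousOn (joinArcs h₁ h₂) (Icc (-1) 1) := by
  rw [← Icc_union_Icc_eq_Icc (by norm_num : (-1 : ℝ) ≤ 0) zero_le_one]
  refine ContinuousOn.union_of_isClosed ?_ ?_ isClosed_Icc isClosed_Icc
  · refine ContinuousOn.congr (f := fun τ => h₁ (-τ)) (c₁.comp continuous_neg.continuousOn ?_)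
      fun τ hτ => joinArcs_of_nonpos h hτ.2
    rintro τ ⟨h1, h2⟩
    exact ⟨by linarith, by linarith⟩
  · exact c₂.congr fun τ hτ => joinArcs_of_nonneg hτ.1

/-- The joined arc is simple if some function increases along it. -/
theorem injOn_joinArcs {d : E → ℝ} (h : h₁ 0 = h₂ 0)
    (m₁ : StrictAntiOn (fun τ => d (h₁ τ)) (Icc 0 1))
    (m₂ : StrictMonoOn (fun τ => d (h₂ τ)) (Icc 0 1)) :
    InjOn (joinArcs h₁ h₂) (Icc (-1) 1) := by
  have key : StrictMonoOn (fun τ => d (joinArcs h₁ h₂ τ)) (Icc (-1) 0 ∪ Icc 0 1) := by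
    refine StrictMonoOn.union (c := 0) ?_ ?_ (isGreatest_Icc (by norm_num))
      (isLeast_Icc zero_le_one)
    · rintro σ ⟨h1, h2⟩ τ ⟨h3, h4⟩ hστ
      simp only [joinArcs_of_nonpos h h2, joinArcs_of_nonpos h h4]
      exact m₁ ⟨by linarith, by linarith⟩ ⟨by linarith, by linarith⟩ (by linarith)
    · rintro σ ⟨h1, h2⟩ τ ⟨h3, h4⟩ hστ
      simp only [joinArcs_of_nonneg h1, joinArcs_of_nonneg h3]
      exact m₂ ⟨h1, h2⟩ ⟨h3, h4⟩ hστ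
  rw [Icc_union_Icc_eq_Icc (by norm_num) zero_le_one] at key
  exact fun σ hσ τ hτ hστ => key.injOn hσ hτ (congrArg d hστ)

end Arcs

/-! ### Functions along a curve with a scaling equation -/

/-- A property that holds near `0` and is inherited from `t` by `μ t` holds everywhere. -/
theorem forall_of_scaling {Q : ℝ → Prop} {μ : ℝ} (hμ : 1 < μ) (h0 : ∀ᶠ t in 𝓝 (0 : ℝ), Q t)
    (hs : ∀ t, Q t → Q (μ * t)) (t : ℝ) : Q t := by
  have hμ0 : 0 < μ := by linarith
  have h1 : Tendsto (fun n : ℕ => μ⁻¹ ^ n * t) atTop (𝓝 0) := by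
    have := (tendsto_pow_atTop_nhds_zero_of_lt_one (r := μ⁻¹) (by positivity)
      (inv_lt_one_of_one_lt₀ hμ)).mul_const t
    rwa [zero_mul] at this
  obtain ⟨n, hn⟩ := (h1.eventually h0).exists
  induction n with
  | zero => simpa using hn
  | succ n ih =>
    refine ih ?_
    have := hs _ hn
    rwa [← mul_assoc, pow_succ', mul_inv_cancel_left₀ hμ0.ne'] at this

theorem deriv_of_scaling {f G : ℝ → ℝ} {μ t g : ℝ} (hf : Differentiable ℝ f)
    (h : ∀ t, f (μ * t) = G t) (hG : HasDerivAt G g t) : μ * deriv f (μ * t) = g := by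
  have h1 : HasDerivAt (fun s : ℝ => μ * s) μ t := by
    simpa using (hasDerivAt_id' t).const_mul μ
  have h2 : HasDerivAt (fun s => f (μ * s)) (deriv f (μ * t) * μ) t :=
    (hf _).hasDerivAt.comp t h1
  simp only [h] at h2
  rw [mul_comm]
  exact h2.unique hG

/-- Near a zero with derivative `1`, a function has the sign of its argument. -/
theorem eventually_sign {Y : ℝ → ℝ} (h0 : Y 0 = 0) (hY : HasDerivAt Y 1 0) :
    ∀ᶠ t in 𝓝 (0 : ℝ), 0 ≤ Y t ↔ 0 ≤ t := by
  rw [hasDerivAt_iff_tendsto_slope] at hY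
  have h1 := eventually_nhdsWithin_iff.1 (hY.eventually (eventually_gt_nhds one_pos))
  filter_upwards [h1] with t ht
  rcases eq_or_ne t 0 with rfl | hne
  · simp [h0]
  · have h2 := ht hne
    rw [slope_def_field, h0, sub_zero, sub_zero] at h2
    rcases div_pos_iff.1 h2 with ⟨h3, h4⟩ | ⟨h3, h4⟩
    · exact ⟨fun _ => h4.le, fun _ => h3.le⟩
    · exact ⟨fun h => absurd h h3.not_ge, fun h => absurd h h4.not_ge⟩

theorem exists_tendsto_of_monotoneOn {f : ℝ → ℝ} {B : ℝ} (hf : MonotoneOn f (Ici 0))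
    (hB : ∀ t ≥ 0, f t ≤ B) : ∃ L, Tendsto f atTop (𝓝 L) := by
  have hm : Monotone fun t => f (max t 0) := fun s t hst =>
    hf (mem_Ici.2 (le_max_right _ _)) (mem_Ici.2 (le_max_right _ _)) (max_le_max_right 0 hst)
  refine ⟨_, (tendsto_atTop_ciSup hm ⟨B, ?_⟩).congr' ?_⟩
  · rintro _ ⟨t, rfl⟩
    exact hB _ (le_max_right _ _)
  · filter_upwards [eventually_ge_atTop 0] with t ht
    rw [max_eq_left ht]

theorem exists_tendsto_of_antitoneOn {f : ℝ → ℝ} {B : ℝ} (hf : AntitoneOn f (Ici 0))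
    (hB : ∀ t ≥ 0, B ≤ f t) : ∃ L, Tendsto f atTop (𝓝 L) := by
  obtain ⟨L, hL⟩ := exists_tendsto_of_monotoneOn (f := fun t => -f t) (B := -B) hf.neg
    fun t ht => neg_le_neg (hB t ht)
  exact ⟨-L, by simpa using hL.neg⟩

theorem isClosed_T : IsClosed T := by
  have : T = {p : Fin 2 → ℝ | 0 ≤ p 0} ∩ ({p | 0 ≤ p 1} ∩ {p | p 0 + p 1 ≤ 1}) := rfl
  rw [this]
  exact (isClosed_le (by fun_prop) (by fun_prop)).inter
    ((isClosed_le (by fun_prop) (by fun_prop)).inter (isClosed_le (by fun_prop) (by fun_prop)))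

/-- The limit of the unstable curve at infinity is a fixed point. -/
theorem mem_fixedSet_of_tendsto {a b c μ : ℝ} {γ : ℝ → Fin 2 → ℝ} {L : Fin 2 → ℝ} (hμ : 1 < μ)
    (hconj : ∀ t, V a b c (γ t) = γ (μ * t)) (hT : ∀ t ≥ 0, γ t ∈ T)
    (hL : Tendsto γ atTop (𝓝 L)) : L ∈ fixedSet a b c := by
  refine ⟨isClosed_T.mem_of_tendsto hL ((eventually_ge_atTop 0).mono hT), ?_⟩
  have h1 : Tendsto (fun t => V a b c (γ t)) atTop (𝓝 (V a b c L)) :=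
    ((contDiff_V a b c).continuous.tendsto L).comp hL
  simp only [hconj] at h1
  exact tendsto_nhds_unique h1
    (hL.comp (tendsto_id.const_mul_atTop (by linarith : 0 < μ)))

theorem image_image_of_conj {E : Type*} {F : E → E} {γ : ℝ → E} {μ : ℝ} {I : Set ℝ} (hμ : 1 < μ)
    (hconj : ∀ t, F (γ t) = γ (μ * t)) (hI : ∀ t ∈ I, ∀ k : ℝ, 0 < k → k * t ∈ I) :
    F '' (γ '' I) = γ '' I := by
  have hμ0 : 0 < μ := by linarith
  ext p
  constructor
  · rintro ⟨_, ⟨t, ht, rfl⟩, rfl⟩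
    exact ⟨μ * t, hI t ht μ hμ0, (hconj t).symm⟩
  · rintro ⟨t, ht, rfl⟩
    refine ⟨_, ⟨μ⁻¹ * t, hI t ht _ (inv_pos.2 hμ0), rfl⟩, ?_⟩
    rw [hconj, mul_inv_cancel_left₀ hμ0.ne']

section Curves

variable {a b c : ℝ}

theorem abs_sub_lt_of_dist {p q : Fin 2 → ℝ} {ε : ℝ} (h : dist p q < ε) (i : Fin 2) :
    |p i - q i| < ε := by
  rw [← Real.dist_eq]
  exact (dist_le_pi_dist p q i).trans_lt h

/-! ### The unstable curve of `λ₂` for `a < 2b` -/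

/-- In the coordinates `s = x + y`, `d = x - y` the region `d > 0`, `s ≤ s₃`, where `s₃` belongs to
`λ₃`, and the cone `d' < 0 < s'` are invariant, so that the unstable curve of `λ₂` runs
monotonically into `λ₃`. -/
theorem exists_unstable_curve_lam2 (H : Admissible a b c) (hch : 1 / 2 < c) (hab : a < 2 * b) :
    ∃ γ : ℝ → (Fin 2 → ℝ), ContDiff ℝ ∞ γ ∧ γ 0 = lam2 a c ∧ deriv γ 0 ≠ 0 ∧
      (∀ t, V a b c (γ t) = γ (edgeMul a b c * t)) ∧ (∀ t ≥ 0, γ t ∈ T) ∧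
      (∃ r > 0, ∀ t, |t| < r → γ t ∈ T → 0 ≤ t) ∧
      StrictAntiOn (fun t => γ t 0 - γ t 1) (Ici 0) ∧ Tendsto γ atTop (𝓝 (lam3 a b c)) ∧
      ∃ ε > 0, ∀ u : ℕ → (Fin 2 → ℝ), IsBackwardOrbit (V a b c) T u →
        (∀ n : ℕ, dist (u n) (lam2 a c) < ε) → u 0 ∈ γ '' Ici 0 := by
  have ⟨ha0, ha1, hb0, hb, hc0, hc⟩ := H
  obtain ⟨hD0, hD1⟩ := axis_coord_bounds H hch
  have hμ := one_lt_edgeMul H hch hab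
  have hDeq : (2 * c - a) * ((2 * c - 1) / (2 * c - a)) = 2 * c - 1 :=
    mul_div_cancel₀ _ (by linarith)
  have hμeq : edgeMul a b c = 2 * c - 2 * (c - b) * ((2 * c - 1) / (2 * c - a)) := rfl
  set D := (2 * c - 1) / (2 * c - a) with hD
  set μ := edgeMul a b c with hμdef
  set K := 2 * c - a / 2 - b with hK
  have hK0 : 2 * c - 1 < K := by rw [hK]; linarith
  set s₃ := (2 * c - 1) / K with hs₃
  have hs₃K : K * s₃ = 2 * c - 1 := mul_div_cancel₀ _ (by linarith)
  have hs₃1 : s₃ < 1 := (div_lt_one (by linarith)).2 hK0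
  have hs₃0 : 0 < s₃ := div_pos (by linarith) (by linarith)
  have hDs₃ : D < s₃ := div_lt_div_of_pos_left (by linarith) (by linarith) (by rw [hK]; linarith)
  obtain ⟨Y, X, hYs, hXs, hY0, hX0, hY', hX', hY, hX⟩ := exists_unstable_curve hμ
    (by linarith : 2 - 2 * c < 1) (2 * (b - c) * D) (a - 2 * c) (2 * (b - c)) 0 0 (2 * (b - c))
    (a - 2 * c)
  set γ : ℝ → (Fin 2 → ℝ) := fun t => ![D + X t, Y t] with hγ
  have hlam2 : lam2 a c = ![D, 0] := rfl
  have hγ0 : γ 0 = lam2 a c := by rw [hlam2, hγ]; simp [hX0, hY0]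
  have hγs : ContDiff ℝ ∞ γ := by
    rw [contDiff_pi]
    intro i
    fin_cases i
    · exact contDiff_const.add hXs
    · exact hYs
  have hconj : ∀ t, V a b c (γ t) = γ (μ * t) := by
    intro t
    refine ext_two ?_ ?_
    · change (D + X t) * (2 * c + (a - 2 * c) * (D + X t) + 2 * (b - c) * Y t) = D + X (μ * t)
      rw [hX]
      linear_combination (-(D + 2 * X t)) * hDeq
    · change Y t * (2 * c + 2 * (b - c) * (D + X t) + (a - 2 * c) * Y t) = Y (μ * t)
      rw [hY, hμeq]
      ring
  -- sum and difference of the coordinates along the curve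
  set S : ℝ → ℝ := fun t => D + X t + Y t with hS
  set E : ℝ → ℝ := fun t => D + X t - Y t with hE
  have hSs : ContDiff ℝ ∞ S := (contDiff_const.add hXs).add hYs
  have hEs : ContDiff ℝ ∞ E := (contDiff_const.add hXs).sub hYs
  have hSd : Differentiable ℝ S := hSs.differentiable (by simp)
  have hEd : Differentiable ℝ E := hEs.differentiable (by simp)
  have hEμ : ∀ t, E (μ * t) = E t * (2 * c - (2 * c - a) * S t) := by
    intro t
    have h := V_diff a b c (γ t)
    rw [hconj] at h
    change E (μ * t) = E t * (2 * c * (1 - (D + X t) - Y t) + a * (D + X t + Y t)) at h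
    rw [h]; simp only [hS]; ring
  have hSμ : ∀ t, S (μ * t) = 2 * c * S t - K * S t ^ 2 + (a / 2 - b) * E t ^ 2 := by
    intro t
    have h := V_sum a b c (γ t)
    rw [hconj] at h
    exact h
  have hYμ : ∀ t, Y (μ * t) =
      Y t * (2 * c * (1 - S t) + 2 * b * (Y t + E t) + a * Y t) := by
    intro t
    have h := V_one_eq a b c (γ t)
    rw [hconj] at h
    change Y (μ * t) = Y t * (2 * c * (1 - (D + X t) - Y t) + 2 * b * (D + X t) + a * Y t) at h
    rw [h]; simp only [hS, hE]; ring
  have hSY : ∀ t, S t = 2 * Y t + E t := fun t => by simp only [hS, hE]; ring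
  have hE'μ : ∀ t, μ * deriv E (μ * t) =
      deriv E t * (2 * c - (2 * c - a) * S t) - (2 * c - a) * E t * deriv S t := by
    intro t
    have h1 := (hEd t).hasDerivAt.fun_mul
      (((hSd t).hasDerivAt.const_mul (2 * c - a)).const_sub (2 * c))
    rw [deriv_of_scaling hEd hEμ h1]; ring
  have hS'μ : ∀ t, μ * deriv S (μ * t) =
      2 * (c - K * S t) * deriv S t + 2 * (a / 2 - b) * E t * deriv E t := by
    intro t
    have h1 := ((((hSd t).hasDerivAt.const_mul (2 * c)).sub
      (((hSd t).hasDerivAt.fun_pow 2).const_mul K)).add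
      (((hEd t).hasDerivAt.fun_pow 2).const_mul (a / 2 - b)))
    rw [deriv_of_scaling hSd hSμ h1]; norm_num; ring
  -- the unstable direction lies in the cone
  have hμν : 0 < μ - (2 - 2 * c) := by linarith
  have he : 2 * (b - c) * D < 0 := mul_neg_of_neg_of_pos (by linarith) hD0
  have hE'0 : deriv E 0 < 0 := by
    have h1 : HasDerivAt E (2 * (b - c) * D / (μ - (2 - 2 * c)) - 1) 0 :=
      (hX'.const_add D).sub hY'
    rw [h1.deriv]
    have := div_neg_of_neg_of_pos he hμν
    linarith
  have hS'0 : 0 < deriv S 0 := by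
    have h1 : HasDerivAt S (2 * (b - c) * D / (μ - (2 - 2 * c)) + 1) 0 :=
      (hX'.const_add D).add hY'
    rw [h1.deriv, div_add_one hμν.ne']
    refine div_pos ?_ hμν
    linarith
  have hS0 : S 0 = D := by simp [hS, hX0, hY0]
  have hE0 : E 0 = D := by simp [hE, hX0, hY0]
  have hsign := eventually_sign hY0 hY'
  have inv : ∀ t, 0 ≤ t → 0 ≤ Y t ∧ 0 < E t ∧ S t ≤ s₃ ∧ deriv E t < 0 ∧ 0 < deriv S t := by
    refine forall_of_scaling hμ ?_ ?_
    · have e1 : ∀ᶠ t in 𝓝 (0 : ℝ), 0 < E t :=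
        hEs.continuous.continuousAt.eventually_const_lt (by rw [hE0]; exact hD0)
      have e2 : ∀ᶠ t in 𝓝 (0 : ℝ), S t < s₃ :=
        hSs.continuous.continuousAt.eventually_lt_const (by rw [hS0]; exact hDs₃)
      have e3 : ∀ᶠ t in 𝓝 (0 : ℝ), deriv E t < 0 :=
        (hEs.continuous_deriv (by simp)).continuousAt.eventually_lt_const hE'0
      have e4 : ∀ᶠ t in 𝓝 (0 : ℝ), 0 < deriv S t :=
        (hSs.continuous_deriv (by simp)).continuousAt.eventually_const_lt hS'0
      filter_upwards [hsign, e1, e2, e3, e4] with t h0 h1 h2 h3 h4 ht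
      exact ⟨h0.2 ht, h1, h2.le, h3, h4⟩
    · intro t ht hμt
      obtain ⟨q1, q2, q3, q4, q5⟩ := ht (by
        by_contra hneg
        have := mul_neg_of_pos_of_neg (by linarith : 0 < μ) (not_le.1 hneg)
        linarith)
      have hSpos : 0 < S t := by rw [hSY]; linarith
      have hfac : 0 < 2 * c - (2 * c - a) * S t := by
        have := mul_le_mul_of_nonneg_left (q3.trans hs₃1.le) (by linarith : 0 ≤ 2 * c - a)
        nlinarith
      have hKS : K * S t ≤ 2 * c - 1 := by
        rw [← hs₃K]; exact mul_le_mul_of_nonneg_left q3 (by linarith)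
      refine ⟨?_, ?_, ?_, ?_, ?_⟩
      · rw [hYμ]
        have h1 : 0 ≤ 2 * c * (1 - S t) := mul_nonneg (by linarith) (by linarith)
        have h2 : 0 ≤ Y t + E t := by linarith
        positivity
      · rw [hEμ]; exact mul_pos q2 hfac
      · rw [hSμ]
        have h1 : (b - a / 2) * E t ^ 2 ≥ 0 := mul_nonneg (by linarith) (sq_nonneg _)
        -- `2cs - K s² - s₃ = (s - s₃) (1 - K s)`
        have h2 : 0 ≤ (s₃ - S t) * (1 - K * S t) := mul_nonneg (by linarith) (by linarith)
        have h3 : (s₃ - S t) * (1 - K * S t) = s₃ - (2 * c * S t - K * S t ^ 2) := by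
          linear_combination (-S t) * hs₃K
        linarith
      · refine neg_of_mul_neg_right (b := deriv E (μ * t)) (a := μ) ?_ (by linarith)
        rw [hE'μ]
        have h1 := mul_neg_of_neg_of_pos q4 hfac
        have h2 := mul_pos (mul_pos (by linarith : 0 < 2 * c - a) q2) q5
        linarith
      · refine pos_of_mul_pos_right (b := deriv S (μ * t)) (a := μ) ?_ (by linarith)
        rw [hS'μ]
        have h1 : 0 ≤ 2 * (c - K * S t) * deriv S t :=
          mul_nonneg (mul_nonneg two_pos.le (by linarith)) q5.le
        have h2 : 0 < (2 * (a / 2 - b) * E t) * deriv E t :=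
          mul_pos_of_neg_of_neg (mul_neg_of_neg_of_pos (by linarith) q2) q4
        linarith
  have hT : ∀ t ≥ 0, γ t ∈ T := by
    intro t ht
    obtain ⟨q1, q2, q3, -, -⟩ := inv t ht
    refine ⟨?_, q1, ?_⟩
    · change 0 ≤ D + X t
      have : D + X t = Y t + E t := by simp only [hE]; ring
      linarith
    · change D + X t + Y t ≤ 1
      exact q3.trans hs₃1.le
  have hEanti : StrictAntiOn E (Ici 0) :=
    strictAntiOn_of_deriv_neg (convex_Ici 0) hEs.continuous.continuousOn fun t ht =>
      (inv t (interior_subset ht)).2.2.2.1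
  have hSmono : StrictMonoOn S (Ici 0) :=
    strictMonoOn_of_deriv_pos (convex_Ici 0) hSs.continuous.continuousOn fun t ht =>
      (inv t (interior_subset ht)).2.2.2.2
  have hlim : Tendsto γ atTop (𝓝 (lam3 a b c)) := by
    obtain ⟨LE, hLE⟩ := exists_tendsto_of_antitoneOn hEanti.antitoneOn
      fun t ht => (inv t ht).2.1.le
    obtain ⟨LS, hLS⟩ := exists_tendsto_of_monotoneOn hSmono.monotoneOn
      fun t ht => (inv t ht).2.2.1
    have hLSD : D < LS := by
      have h1 : S 0 < S 1 := hSmono (mem_Ici.2 le_rfl) (mem_Ici.2 zero_le_one) one_pos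
      rw [hS0] at h1
      refine h1.trans_le (ge_of_tendsto hLS ?_)
      filter_upwards [eventually_ge_atTop 1] with t ht
      exact hSmono.monotoneOn (mem_Ici.2 zero_le_one) (mem_Ici.2 (by linarith)) ht
    have hγL : Tendsto γ atTop (𝓝 ![(LS + LE) / 2, (LS - LE) / 2]) := by
      rw [tendsto_pi_nhds]
      intro i
      fin_cases i
      · refine ((hLS.add hLE).div_const 2).congr fun t => ?_
        change (D + X t + Y t + (D + X t - Y t)) / 2 = D + X t
        ring
      · refine ((hLS.sub hLE).div_const 2).congr fun t => ?_
        change (D + X t + Y t - (D + X t - Y t)) / 2 = Y t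
        ring
    have hfix := mem_fixedSet_of_tendsto hμ hconj hT hγL
    have hsum : ∀ p : Fin 2 → ℝ, ![(LS + LE) / 2, (LS - LE) / 2] = p → p 0 + p 1 = LS := by
      rintro p rfl
      change (LS + LE) / 2 + (LS - LE) / 2 = LS
      ring
    rw [fixedSet_eq H hch hab.ne] at hfix
    rcases hfix with h | h | h | h
    · have := hsum _ h
      simp only [lam0, Matrix.cons_val_zero, Matrix.cons_val_one] at this
      linarith
    · have := hsum _ h
      simp only [lam1, Matrix.cons_val_zero, Matrix.cons_val_one] at this
      linarith
    · have := hsum _ h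
      simp only [lam2, Matrix.cons_val_zero, Matrix.cons_val_one] at this
      linarith
    · rwa [← mem_singleton_iff.1 h]
  obtain ⟨r, hr, hsign⟩ := Metric.eventually_nhds_iff.1 hsign
  have hloc : ∀ t, |t| < r → γ t ∈ T → 0 ≤ t := fun t ht hγT =>
    (hsign (by rwa [Real.dist_0_eq_abs])).1 hγT.2.1
  refine ⟨γ, hγs, hγ0, fun h => ?_, hconj, hT, ⟨r, hr, hloc⟩, hEanti, hlim, ?_⟩
  · have h1 := hasDerivAt_pi.1 (hγs.differentiable (by simp) 0).hasDerivAt 1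
    rw [h] at h1
    exact zero_ne_one (h1.unique hY')
  · obtain ⟨ε, hε, hu⟩ := mem_unstable_curve_of_backward_orbit hμ (by linarith : 0 ≤ 2 - 2 * c)
      (by linarith) hYs hXs hY0 hX0 hY' hY hX (half_pos hr)
    refine ⟨ε, hε, fun u hub hd => ?_⟩
    obtain ⟨t, ht, hYt, hXt⟩ := hu (fun n => u n 1) (fun n => u n 0 - D)
      (fun n => by
        have h := congrFun (hub n).2 1
        rw [V_apply_one] at h
        rw [← h, hμeq]; ring)
      (fun n => by
        have h := congrFun (hub n).2 0
        rw [V_apply_zero] at h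
        rw [← h]
        linear_combination (-(D + 2 * (u (n + 1) 0 - D))) * hDeq)
      (fun n => by simpa [hlam2] using abs_sub_lt_of_dist (hd n) 1)
      (fun n => by simpa [hlam2] using abs_sub_lt_of_dist (hd n) 0)
    have hγt : γ t = u 0 := by
      refine ext_two ?_ hYt
      change D + X t = u 0 0
      rw [hXt]; ring
    exact ⟨t, hloc t (by linarith) (by rw [hγt]; exact (hub 0).1), hγt⟩

/-! ### The unstable curve of `λ₃` for `a > 2b` -/

/-- The triangle `x, y > 0`, `x + y ≤ d*` below the segment from `λ₁` to `λ₂` and the cone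
`x' > 0 > y'` are invariant: on the triangle, the Jacobian matrix has a nonnegative diagonal and
negative entries off the diagonal. Hence the unstable curve of `λ₃` runs monotonically from `λ₁` to
`λ₂`. -/
theorem exists_unstable_curve_lam3 (H : Admissible a b c) (hch : 1 / 2 < c) (hab : 2 * b < a) :
    ∃ γ : ℝ → (Fin 2 → ℝ), ContDiff ℝ ∞ γ ∧ γ 0 = lam3 a b c ∧ deriv γ 0 ≠ 0 ∧
      (∀ t, V a b c (γ t) = γ (diagMul a b c * t)) ∧ (∀ t, γ t ∈ T) ∧
      StrictMono (fun t => γ t 0 - γ t 1) ∧ Tendsto γ atTop (𝓝 (lam2 a c)) ∧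
      Tendsto γ atBot (𝓝 (lam1 a c)) ∧
      ∃ ε > 0, ∀ u : ℕ → (Fin 2 → ℝ), IsBackwardOrbit (V a b c) T u →
        (∀ n : ℕ, dist (u n) (lam3 a b c) < ε) → u 0 ∈ range γ := by
  have ⟨ha0, ha1, hb0, hb, hc0, hc⟩ := H
  obtain ⟨hD0, hD1⟩ := axis_coord_bounds H hch
  obtain ⟨ht0, ht1⟩ := diag_coord_bounds H hch
  have hμ := one_lt_diagMul H hch hab
  have hDeq : (2 * c - a) * ((2 * c - 1) / (2 * c - a)) = 2 * c - 1 :=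
    mul_div_cancel₀ _ (by linarith)
  have hteq : (4 * c - a - 2 * b) * ((2 * c - 1) / (4 * c - a - 2 * b)) = 2 * c - 1 :=
    mul_div_cancel₀ _ (by linarith)
  have hμeq : diagMul a b c =
    2 * c - 2 * (2 * c - a) * ((2 * c - 1) / (4 * c - a - 2 * b)) := rfl
  have htD : 2 * ((2 * c - 1) / (4 * c - a - 2 * b)) < (2 * c - 1) / (2 * c - a) := by
    rw [lt_div_iff₀ (by linarith)]
    nlinarith
  set D := (2 * c - 1) / (2 * c - a) with hD
  have hlam3 : lam3 a b c = ![(2 * c - 1) / (4 * c - a - 2 * b),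
    (2 * c - 1) / (4 * c - a - 2 * b)] := lam3_eq
  set t₃ := (2 * c - 1) / (4 * c - a - 2 * b) with ht₃
  set μ := diagMul a b c with hμdef
  set K := 2 * c - a / 2 - b with hK
  obtain ⟨Y, X, hYs, hXs, hY0, hX0, hY', hX', hY, hX⟩ := exists_unstable_curve hμ
    (by linarith : 2 - 2 * c < 1) 0 0 (-(2 * c - a)) 0 (a / 2 - b) 0 (-K)
  rw [zero_div] at hX'
  set x : ℝ → ℝ := fun t => t₃ + (X t + Y t) / 2 with hx
  set y : ℝ → ℝ := fun t => t₃ + (X t - Y t) / 2 with hy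
  set γ : ℝ → (Fin 2 → ℝ) := fun t => ![x t, y t] with hγ
  have hxs : ContDiff ℝ ∞ x := contDiff_const.add ((hXs.add hYs).div_const 2)
  have hys : ContDiff ℝ ∞ y := contDiff_const.add ((hXs.sub hYs).div_const 2)
  have hxd : Differentiable ℝ x := hxs.differentiable (by simp)
  have hyd : Differentiable ℝ y := hys.differentiable (by simp)
  have hx0 : x 0 = t₃ := by simp [hx, hX0, hY0]
  have hy0 : y 0 = t₃ := by simp [hy, hX0, hY0]
  have hγ0 : γ 0 = lam3 a b c := by rw [hlam3, hγ]; simp [hx0, hy0]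
  have hγs : ContDiff ℝ ∞ γ := by
    rw [contDiff_pi]
    intro i
    fin_cases i
    · exact hxs
    · exact hys
  have hx' : HasDerivAt x (1 / 2) 0 := by
    refine (((hX'.add hY').div_const 2).const_add t₃).congr_deriv ?_
    norm_num
  have hy' : HasDerivAt y (-1 / 2) 0 := by
    refine (((hX'.sub hY').div_const 2).const_add t₃).congr_deriv ?_
    norm_num
  have hconj : ∀ t, V a b c (γ t) = γ (μ * t) := by
    intro t
    refine ext_two ?_ ?_
    · change x t * (2 * c + (a - 2 * c) * x t + 2 * (b - c) * y t) =
        t₃ + (X (μ * t) + Y (μ * t)) / 2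
      rw [hX, hY, hμeq, hK]
      simp only [hx, hy]
      linear_combination (-(t₃ + X t)) * hteq
    · change y t * (2 * c + 2 * (b - c) * x t + (a - 2 * c) * y t) =
        t₃ + (X (μ * t) - Y (μ * t)) / 2
      rw [hX, hY, hμeq, hK]
      simp only [hx, hy]
      linear_combination (-(t₃ + X t)) * hteq
  have hxμ : ∀ t, x (μ * t) = x t * (2 * c + (a - 2 * c) * x t + 2 * (b - c) * y t) :=
    fun t => (congrFun (hconj t) 0).symm
  have hyμ : ∀ t, y (μ * t) = y t * (2 * c + 2 * (b - c) * x t + (a - 2 * c) * y t) :=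
    fun t => (congrFun (hconj t) 1).symm
  have hsμ : ∀ t, x (μ * t) + y (μ * t) = 2 * c * (x t + y t) - K * (x t + y t) ^ 2
      + (a / 2 - b) * (x t - y t) ^ 2 := by
    intro t
    have h := V_sum a b c (γ t)
    rw [hconj] at h
    exact h
  have hx'μ : ∀ t, μ * deriv x (μ * t) =
      (2 * c - 2 * (2 * c - a) * x t - 2 * (c - b) * y t) * deriv x t
        - 2 * (c - b) * x t * deriv y t := by
    intro t
    have h1 := (hxd t).hasDerivAt.fun_mul
      ((((hxd t).hasDerivAt.const_mul (a - 2 * c)).const_add (2 * c)).add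
        ((hyd t).hasDerivAt.const_mul (2 * (b - c))))
    rw [deriv_of_scaling hxd hxμ h1]; simp only [Pi.add_apply]; ring
  have hy'μ : ∀ t, μ * deriv y (μ * t) =
      (2 * c - 2 * (2 * c - a) * y t - 2 * (c - b) * x t) * deriv y t
        - 2 * (c - b) * y t * deriv x t := by
    intro t
    have h1 := (hyd t).hasDerivAt.fun_mul
      ((((hxd t).hasDerivAt.const_mul (2 * (b - c))).const_add (2 * c)).add
        ((hyd t).hasDerivAt.const_mul (a - 2 * c)))
    rw [deriv_of_scaling hyd hyμ h1]; simp only [Pi.add_apply]; ring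
  -- the diagonal entries are nonnegative on the triangle, because they are at its vertices
  have hdiag : ∀ u v : ℝ, 0 < u → 0 < v → u + v ≤ D →
      0 ≤ 2 * c - 2 * (2 * c - a) * u - 2 * (c - b) * v := by
    intro u v hu hv huv
    have h1 : 2 * (c - b) * D ≤ 2 * c := by
      have := mul_le_mul_of_nonneg_left hD1.le (by linarith : 0 ≤ 2 * (c - b))
      linarith
    have h2 := mul_le_mul_of_nonneg_left h1 hv.le
    have h3 : 0 ≤ 2 * c * (D - u - v) := mul_nonneg (by linarith) (by linarith)
    have h4 : 0 ≤ u * (2 - 2 * c) := mul_nonneg hu.le (by linarith)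
    refine le_of_mul_le_mul_right (a := D) ?_ hD0
    have h5 : (2 * c - 2 * (2 * c - a) * u - 2 * (c - b) * v) * D =
      2 * c * (D - u - v) + u * (2 - 2 * c) + (v * (2 * c) - v * (2 * (c - b) * D)) := by
      linear_combination (-2 * u) * hDeq
    rw [zero_mul, h5]
    linarith
  have inv : ∀ t, 0 < x t ∧ 0 < y t ∧ x t + y t ≤ D ∧ 0 < deriv x t ∧ deriv y t < 0 := by
    refine forall_of_scaling hμ ?_ ?_
    · have e1 : ∀ᶠ t in 𝓝 (0 : ℝ), 0 < x t :=
        hxs.continuous.continuousAt.eventually_const_lt (by rw [hx0]; exact ht0)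
      have e2 : ∀ᶠ t in 𝓝 (0 : ℝ), 0 < y t :=
        hys.continuous.continuousAt.eventually_const_lt (by rw [hy0]; exact ht0)
      have e3 : ∀ᶠ t in 𝓝 (0 : ℝ), x t + y t < D :=
        (hxs.continuous.add hys.continuous).continuousAt.eventually_lt_const
          (by rw [Pi.add_apply, hx0, hy0]; linarith)
      have e4 : ∀ᶠ t in 𝓝 (0 : ℝ), 0 < deriv x t :=
        (hxs.continuous_deriv (by simp)).continuousAt.eventually_const_lt
          (by rw [hx'.deriv]; norm_num)
      have e5 : ∀ᶠ t in 𝓝 (0 : ℝ), deriv y t < 0 :=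
        (hys.continuous_deriv (by simp)).continuousAt.eventually_lt_const
          (by rw [hy'.deriv]; norm_num)
      filter_upwards [e1, e2, e3, e4, e5] with t h1 h2 h3 h4 h5
      exact ⟨h1, h2, h3.le, h4, h5⟩
    · rintro t ⟨q1, q2, q3, q4, q5⟩
      have hz : 0 < 2 * c * (1 - x t - y t) := mul_pos (by linarith) (by linarith)
      have hax : 0 ≤ a * x t := mul_nonneg ha0 q1.le
      have hay : 0 ≤ a * y t := mul_nonneg ha0 q2.le
      have hbx : 0 ≤ b * x t := mul_nonneg hb0 q1.le
      have hby : 0 ≤ b * y t := mul_nonneg hb0 q2.le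
      refine ⟨?_, ?_, ?_, ?_, ?_⟩
      · rw [hxμ]; exact mul_pos q1 (by linarith)
      · rw [hyμ]; exact mul_pos q2 (by linarith)
      · rw [hsμ]
        set s := x t + y t with hs
        have h1 : (2 * c - a) * s ≤ 1 := by
          have := mul_le_mul_of_nonneg_left q3 (by linarith : 0 ≤ 2 * c - a)
          linarith
        -- `2cs - (2c - a) s² - d* = (s - d*) (1 - (2c - a) s)`
        have h2 : 0 ≤ (D - s) * (1 - (2 * c - a) * s) := mul_nonneg (by linarith) (by linarith)
        have h3 : (D - s) * (1 - (2 * c - a) * s) = D - (2 * c * s - (2 * c - a) * s ^ 2) := by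
          linear_combination (-s) * hDeq
        have h4 : 0 ≤ (a / 2 - b) * (s ^ 2 - (x t - y t) ^ 2) := by
          refine mul_nonneg (by linarith) ?_
          have : s ^ 2 - (x t - y t) ^ 2 = 4 * (x t * y t) := by rw [hs]; ring
          rw [this]; positivity
        have h5 : K * s ^ 2 = (2 * c - a) * s ^ 2 + (a / 2 - b) * s ^ 2 := by rw [hK]; ring
        linarith
      · refine pos_of_mul_pos_right (b := deriv x (μ * t)) (a := μ) ?_ (by linarith)
        rw [hx'μ]
        have h1 := mul_nonneg (hdiag _ _ q1 q2 q3) q4.le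
        have h2 := mul_neg_of_pos_of_neg (mul_pos (by linarith : 0 < 2 * (c - b)) q1) q5
        linarith
      · refine neg_of_mul_neg_right (b := deriv y (μ * t)) (a := μ) ?_ (by linarith)
        rw [hy'μ]
        have h1 := mul_nonpos_of_nonneg_of_nonpos (hdiag _ _ q2 q1 (by linarith)) q5.le
        have h2 := mul_pos (mul_pos (by linarith : 0 < 2 * (c - b)) q2) q4
        linarith
  have hT : ∀ t, γ t ∈ T := fun t =>
    ⟨(inv t).1.le, (inv t).2.1.le, (inv t).2.2.1.trans hD1.le⟩
  have hxm : StrictMono x := strictMono_of_deriv_pos fun t => (inv t).2.2.2.1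
  have hya : StrictAnti y := strictAnti_of_deriv_neg fun t => (inv t).2.2.2.2
  have hxD : ∀ t, x t ≤ D := fun t => by linarith [(inv t).2.1, (inv t).2.2.1]
  have hyD : ∀ t, y t ≤ D := fun t => by linarith [(inv t).1, (inv t).2.2.1]
  have hpi : ∀ {l : Filter ℝ} {u v : ℝ}, Tendsto x l (𝓝 u) → Tendsto y l (𝓝 v) →
      Tendsto γ l (𝓝 ![u, v]) := by
    intro l u v hu hv
    rw [tendsto_pi_nhds]
    intro i
    fin_cases i
    · exact hu
    · exact hv
  have h01 : x 0 < x 1 := hxm one_pos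
  have h10 : x (-1) < x 0 := hxm (by norm_num)
  have g01 : y 1 < y 0 := hya one_pos
  have g10 : y 0 < y (-1) := hya (by norm_num)
  have htop : Tendsto γ atTop (𝓝 (lam2 a c)) := by
    have bx : BddAbove (range x) := ⟨D, by rintro _ ⟨t, rfl⟩; exact hxD t⟩
    have by' : BddBelow (range y) := ⟨0, by rintro _ ⟨t, rfl⟩; exact (inv t).2.1.le⟩
    have hLx := tendsto_atTop_ciSup hxm.monotone bx
    have hLy := tendsto_atTop_ciInf hya.antitone by'
    have hlt : (⨅ t, y t) < ⨆ t, x t := by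
      have h1 : x 1 ≤ ⨆ t, x t := le_ciSup bx 1
      have h2 : (⨅ t, y t) ≤ y 1 := ciInf_le by' 1
      linarith
    have hγL := hpi hLx hLy
    have hfix := mem_fixedSet_of_tendsto hμ hconj (fun t _ => hT t) hγL
    rw [fixedSet_eq H hch hab.ne'] at hfix
    rcases hfix with h | h | h | h
    · have h1 := congrFun h 0
      have h2 := congrFun h 1
      simp only [lam0, Matrix.cons_val_zero, Matrix.cons_val_one] at h1 h2
      linarith
    · have h1 := congrFun h 0
      have h2 := congrFun h 1
      simp only [lam1, Matrix.cons_val_zero, Matrix.cons_val_one] at h1 h2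
      linarith
    · rwa [← h]
    · have h1 := congrFun h 0
      have h2 := congrFun h 1
      rw [hlam3] at h1 h2
      simp only [Matrix.cons_val_zero, Matrix.cons_val_one] at h1 h2
      linarith
  have hbot : Tendsto γ atBot (𝓝 (lam1 a c)) := by
    have bx : BddBelow (range x) := ⟨0, by rintro _ ⟨t, rfl⟩; exact (inv t).1.le⟩
    have by' : BddAbove (range y) := ⟨D, by rintro _ ⟨t, rfl⟩; exact hyD t⟩
    have hLx := tendsto_atBot_ciInf hxm.monotone bx
    have hLy := tendsto_atBot_ciSup hya.antitone by'
    have hlt : (⨅ t, x t) < ⨆ t, y t := by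
      have h1 : (⨅ t, x t) ≤ x (-1) := ciInf_le bx (-1)
      have h2 : y (-1) ≤ ⨆ t, y t := le_ciSup by' (-1)
      linarith
    have hγL := hpi hLx hLy
    have hfix := mem_fixedSet_of_tendsto (γ := fun t => γ (-t)) hμ
      (fun t => by rw [hconj, mul_neg]) (fun t _ => hT _) (hγL.comp tendsto_neg_atTop_atBot)
    rw [fixedSet_eq H hch hab.ne'] at hfix
    rcases hfix with h | h | h | h
    · have h1 := congrFun h 0
      have h2 := congrFun h 1
      simp only [lam0, Matrix.cons_val_zero, Matrix.cons_val_one] at h1 h2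
      linarith
    · rwa [← h]
    · have h1 := congrFun h 0
      have h2 := congrFun h 1
      simp only [lam2, Matrix.cons_val_zero, Matrix.cons_val_one] at h1 h2
      linarith
    · have h1 := congrFun h 0
      have h2 := congrFun h 1
      rw [hlam3] at h1 h2
      simp only [Matrix.cons_val_zero, Matrix.cons_val_one] at h1 h2
      linarith
  refine ⟨γ, hγs, hγ0, fun h => ?_, hconj, hT, ?_, htop, hbot, ?_⟩
  · have h1 := hasDerivAt_pi.1 (hγs.differentiable (by simp) 0).hasDerivAt 0
    rw [h] at h1
    have := h1.unique hx'
    norm_num at this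
  · intro s t hst
    have h1 := hxm hst
    have h2 := hya hst
    change x s - y s < x t - y t
    linarith
  · obtain ⟨ε, hε, hu⟩ := mem_unstable_curve_of_backward_orbit hμ (by linarith : 0 ≤ 2 - 2 * c)
      (by linarith) hYs hXs hY0 hX0 hY' hY hX one_pos
    refine ⟨ε / 2, half_pos hε, fun u hub hd => ?_⟩
    have hd0 : ∀ n, |u n 0 - t₃| < ε / 2 := fun n => by
      simpa [hlam3] using abs_sub_lt_of_dist (hd n) 0
    have hd1 : ∀ n, |u n 1 - t₃| < ε / 2 := fun n => by
      simpa [hlam3] using abs_sub_lt_of_dist (hd n) 1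
    obtain ⟨t, -, hYt, hXt⟩ := hu (fun n => u n 0 - u n 1) (fun n => u n 0 + u n 1 - 2 * t₃)
      (fun n => by
        have h0 := congrFun (hub n).2 0
        have h1 := congrFun (hub n).2 1
        rw [V_apply_zero] at h0
        rw [V_apply_one] at h1
        rw [← h0, ← h1, hμeq]; ring)
      (fun n => by
        have h0 := congrFun (hub n).2 0
        have h1 := congrFun (hub n).2 1
        rw [V_apply_zero] at h0
        rw [V_apply_one] at h1
        rw [← h0, ← h1, hK]
        linear_combination (-2 * (u (n + 1) 0 + u (n + 1) 1 - t₃)) * hteq)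
      (fun n => by
        have h0 := abs_lt.1 (hd0 n)
        have h1 := abs_lt.1 (hd1 n)
        exact abs_lt.2 ⟨by linarith, by linarith⟩)
      (fun n => by
        have h0 := abs_lt.1 (hd0 n)
        have h1 := abs_lt.1 (hd1 n)
        exact abs_lt.2 ⟨by linarith, by linarith⟩)
    refine ⟨t, ext_two ?_ ?_⟩
    · change t₃ + (X t + Y t) / 2 = u 0 0
      rw [hXt, hYt]; ring
    · change t₃ + (X t - Y t) / 2 = u 0 1
      rw [hXt, hYt]; ring

end Curves

/-! ### The invariant arc -/

section InvariantArc

variable {a b c : ℝ}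

theorem continuous_diff : Continuous fun p : Fin 2 → ℝ => p 0 - p 1 := by fun_prop

/-- For `a < 2b` the arc is the unstable curve of `λ₂`, its limit `λ₃` and the mirror image. -/
theorem arc_of_lt (H : Admissible a b c) (hch : 1 / 2 < c) (hab : a < 2 * b) :
    ∃ γ : ℝ → (Fin 2 → ℝ), ContinuousOn γ (Icc (-1) 1) ∧ InjOn γ (Icc (-1) 1) ∧
      MapsTo γ (Icc (-1) 1) T ∧ V a b c '' (γ '' Icc (-1) 1) = γ '' Icc (-1) 1 ∧
      γ (-1) = lam1 a c ∧ γ 0 = lam3 a b c ∧ γ 1 = lam2 a c ∧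
      IsUnstableManifold (V a b c) T (lam1 a c) (γ '' Ico (-1) 0) ∧
      IsUnstableManifold (V a b c) T (lam2 a c) (γ '' Ioc 0 1) := by
  obtain ⟨γ, hγs, hγ0, hγ', hconj, hT, hloc, hanti, hlim, huniq⟩ :=
    exists_unstable_curve_lam2 H hch hab
  have hμ := one_lt_edgeMul H hch hab
  have hIci : ∀ t ∈ Ici (0 : ℝ), ∀ k : ℝ, 0 < k → k * t ∈ Ici (0 : ℝ) := fun t ht k hk =>
    mul_nonneg hk.le ht
  have hU₂ : IsUnstableManifold (V a b c) T (lam2 a c) (γ '' Ici 0) := by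
    obtain ⟨r, hr, hrloc⟩ := hloc
    refine isUnstableManifold_image hμ (differentiableAt_V a b c _) hγs hγ0 hγ' hconj hIci hT
      ⟨r, hr, fun t ht hγT => hrloc t ht hγT⟩ (fun r hr => ?_) huniq
    refine ⟨{p | γ r 0 - γ r 1 < p 0 - p 1}, ?_, fun t ht htU => ?_⟩
    · rw [← hγ0]
      exact continuous_diff.continuousAt.eventually_const_lt
        (hanti (mem_Ici.2 le_rfl) (mem_Ici.2 hr.le) hr)
    · rw [abs_of_nonneg ht]
      by_contra! hle
      exact absurd (hanti.antitoneOn (mem_Ici.2 hr.le) ht hle) (not_le.2 htU)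
  set g : ℝ → (Fin 2 → ℝ) := compactify γ (lam3 a b c) with hg
  set h₂ : ℝ → (Fin 2 → ℝ) := fun τ => g (1 - τ) with hh₂
  set h₁ : ℝ → (Fin 2 → ℝ) := fun τ => swapXY (h₂ τ) with hh₁
  have h₂0 : h₂ 0 = lam3 a b c := by simp only [hh₂, hg, sub_zero, compactify_one]
  have h₂1 : h₂ 1 = lam2 a c := by simp only [hh₂, hg, sub_self, compactify_zero, hγ0]
  have h₁0 : h₁ 0 = h₂ 0 := by simp only [hh₁, h₂0, swapXY_lam3]
  have h₂c : ContinuousOn h₂ (Icc 0 1) := by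
    refine (continuousOn_compactify hγs.continuous hlim).comp (by fun_prop) ?_
    rintro τ ⟨h0, h1⟩
    exact ⟨by linarith, by linarith⟩
  have h₁c : ContinuousOn h₁ (Icc 0 1) := swapXY.continuous.comp_continuousOn h₂c
  have hd₂ : StrictMonoOn (fun τ => h₂ τ 0 - h₂ τ 1) (Icc 0 1) := by
    have hm := strictMonoOn_compactify (g := fun t => -(γ t 0 - γ t 1))
      (l := -(lam3 a b c 0 - lam3 a b c 1)) hanti.neg
      ((continuous_diff.tendsto _).comp hlim).neg
    rintro σ ⟨h0, h1⟩ τ ⟨h2, h3⟩ hστ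
    have h4 := hm (a := 1 - τ) (b := 1 - σ) ⟨by linarith, by linarith⟩ ⟨by linarith, by linarith⟩
      (by linarith)
    have h5 := fun τ => comp_compactify (fun p : Fin 2 → ℝ => -(p 0 - p 1)) γ (lam3 a b c) τ
    rw [← h5, ← h5] at h4
    exact neg_lt_neg_iff.1 h4
  have hd₁ : StrictAntiOn (fun τ => h₁ τ 0 - h₁ τ 1) (Icc 0 1) := by
    intro σ hσ τ hτ hστ
    have := hd₂ hσ hτ hστ
    simp only [hh₁, swapXY_zero, swapXY_one]
    simp only at this
    linarith
  have im₂ : h₂ '' Ioc 0 1 = γ '' Ici 0 := by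
    rw [← compactify_image_Ico γ (lam3 a b c), hh₂, ← image_image g (fun τ : ℝ => 1 - τ)]
    simp [hg]
  have im₂' : h₂ '' Icc 0 1 = insert (lam3 a b c) (γ '' Ici 0) := by
    rw [← compactify_image_Icc γ (lam3 a b c), hh₂, ← image_image g (fun τ : ℝ => 1 - τ)]
    simp [hg]
  have im₁ : h₁ '' Ioc 0 1 = swapXY '' (γ '' Ici 0) := by
    rw [← im₂, image_image]
  have im₁' : h₁ '' Icc 0 1 = swapXY '' (h₂ '' Icc 0 1) := by rw [image_image]
  have hTh₂ : h₂ '' Icc 0 1 ⊆ T := by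
    rw [im₂', insert_subset_iff]
    refine ⟨lam3_mem_T H hch, ?_⟩
    rintro _ ⟨t, ht, rfl⟩
    exact hT t ht
  have hVh₂ : V a b c '' (h₂ '' Icc 0 1) = h₂ '' Icc 0 1 := by
    rw [im₂', image_insert_eq, V_lam3 H hch, image_image_of_conj hμ hconj hIci]
  refine ⟨joinArcs h₁ h₂, continuousOn_joinArcs h₁0 h₁c h₂c,
    injOn_joinArcs (d := fun p => p 0 - p 1) h₁0 hd₁ hd₂, ?_, ?_, ?_, ?_, ?_, ?_, ?_⟩
  · rw [mapsTo_iff_image_subset, joinArcs_image_Icc h₁0, union_subset_iff, im₁']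
    refine ⟨?_, hTh₂⟩
    rintro _ ⟨p, hp, rfl⟩
    exact (swapXY_mem_T p).2 (hTh₂ hp)
  · rw [joinArcs_image_Icc h₁0, image_union, hVh₂, im₁', image_image]
    congr 1
    simp only [V_swapXY]
    rw [← image_image (swapXY : (Fin 2 → ℝ) → Fin 2 → ℝ) (V a b c), hVh₂]
  · rw [joinArcs_of_neg (by norm_num), neg_neg, hh₁]
    simp only [h₂1, swapXY_lam2]
  · rw [joinArcs_of_nonneg le_rfl, h₂0]
  · rw [joinArcs_of_nonneg zero_le_one, h₂1]
  · rw [joinArcs_image_Ico, im₁, ← swapXY_lam2]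
    exact hU₂.map swapXY (V_swapXY a b c) swapXY_mem_T (differentiableAt_V a b c _)
  · rw [joinArcs_image_Ioc, im₂]
    exact hU₂

/-- For `a > 2b` the arc is the unstable curve of `λ₃` together with its two limits. -/
theorem arc_of_gt (H : Admissible a b c) (hch : 1 / 2 < c) (hab : 2 * b < a) :
    ∃ γ : ℝ → (Fin 2 → ℝ), ContinuousOn γ (Icc (-1) 1) ∧ InjOn γ (Icc (-1) 1) ∧
      MapsTo γ (Icc (-1) 1) T ∧ V a b c '' (γ '' Icc (-1) 1) = γ '' Icc (-1) 1 ∧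
      γ (-1) = lam1 a c ∧ γ 0 = lam3 a b c ∧ γ 1 = lam2 a c ∧
      IsUnstableManifold (V a b c) T (lam3 a b c) (γ '' Ioo (-1) 1) := by
  obtain ⟨γ, hγs, hγ0, hγ', hconj, hT, hmono, htop, hbot, huniq⟩ :=
    exists_unstable_curve_lam3 H hch hab
  have hμ := one_lt_diagMul H hch hab
  have hU : IsUnstableManifold (V a b c) T (lam3 a b c) (γ '' univ) := by
    refine isUnstableManifold_image hμ (differentiableAt_V a b c _) hγs hγ0 hγ' hconj
      (fun _ _ _ _ => mem_univ _) (fun t _ => hT t) ⟨1, one_pos, fun _ _ _ => mem_univ _⟩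
      (fun r hr => ?_) (by rwa [image_univ])
    refine ⟨{p | γ (-r) 0 - γ (-r) 1 < p 0 - p 1} ∩ {p | p 0 - p 1 < γ r 0 - γ r 1}, ?_,
      fun t _ htU => ?_⟩
    · rw [← hγ0]
      exact inter_mem
        (continuous_diff.continuousAt.eventually_const_lt (hmono (by linarith : -r < 0)))
        (continuous_diff.continuousAt.eventually_lt_const (hmono hr))
    · exact abs_lt.2 ⟨hmono.lt_iff_lt.1 htU.1, hmono.lt_iff_lt.1 htU.2⟩
  set h₂ : ℝ → (Fin 2 → ℝ) := compactify γ (lam2 a c) with hh₂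
  set h₁ : ℝ → (Fin 2 → ℝ) := compactify (fun t => γ (-t)) (lam1 a c) with hh₁
  have hneg : Tendsto (fun t => γ (-t)) atTop (𝓝 (lam1 a c)) := hbot.comp tendsto_neg_atTop_atBot
  have h₂0 : h₂ 0 = lam3 a b c := by rw [hh₂, compactify_zero, hγ0]
  have h₁0 : h₁ 0 = h₂ 0 := by rw [h₂0, hh₁, compactify_zero, neg_zero, hγ0]
  have h₁c : ContinuousOn h₁ (Icc 0 1) :=
    continuousOn_compactify (hγs.continuous.comp continuous_neg) hneg
  have h₂c : ContinuousOn h₂ (Icc 0 1) := continuousOn_compactify hγs.continuous htop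
  have hd₂ : StrictMonoOn (fun τ => h₂ τ 0 - h₂ τ 1) (Icc 0 1) := by
    have hm := strictMonoOn_compactify (hmono.strictMonoOn (Ici 0))
      ((continuous_diff.tendsto _).comp htop)
    refine hm.congr fun τ _ => ?_
    exact (comp_compactify (fun p : Fin 2 → ℝ => p 0 - p 1) γ (lam2 a c) τ).symm
  have hd₁ : StrictAntiOn (fun τ => h₁ τ 0 - h₁ τ 1) (Icc 0 1) := by
    have hm := strictMonoOn_compactify (g := fun t => -(γ (-t) 0 - γ (-t) 1))
      (l := -(lam1 a c 0 - lam1 a c 1))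
      (fun s _ t _ hst => neg_lt_neg (hmono (neg_lt_neg hst)))
      ((continuous_diff.tendsto _).comp hneg).neg
    intro σ hσ τ hτ hστ
    have h4 := hm hσ hτ hστ
    have h5 := fun τ => comp_compactify (fun p : Fin 2 → ℝ => -(p 0 - p 1)) (fun t => γ (-t))
      (lam1 a c) τ
    rw [← h5, ← h5] at h4
    exact neg_lt_neg_iff.1 h4
  have hIic : (fun t => γ (-t)) '' Ici 0 ∪ γ '' Ici 0 = γ '' univ := by
    rw [← image_image γ (fun t : ℝ => -t), ← image_union]
    simp
  have im : joinArcs h₁ h₂ '' Ioo (-1) 1 = γ '' univ := by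
    rw [joinArcs_image_Ioo h₁0, compactify_image_Ico, compactify_image_Ico, hIic]
  have im' : joinArcs h₁ h₂ '' Icc (-1) 1 = insert (lam1 a c) (insert (lam2 a c) (γ '' univ)) := by
    rw [joinArcs_image_Icc h₁0, compactify_image_Icc, compactify_image_Icc, insert_union,
      union_insert, hIic]
  refine ⟨joinArcs h₁ h₂, continuousOn_joinArcs h₁0 h₁c h₂c,
    injOn_joinArcs (d := fun p => p 0 - p 1) h₁0 hd₁ hd₂, ?_, ?_, ?_, ?_, ?_, ?_⟩
  · rw [mapsTo_iff_image_subset, im', insert_subset_iff, insert_subset_iff]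
    refine ⟨lam1_mem_T H hch, lam2_mem_T H hch, ?_⟩
    rintro _ ⟨t, -, rfl⟩
    exact hT t
  · rw [im', image_insert_eq, image_insert_eq, V_lam1 H hch, V_lam2 H hch,
      image_image_of_conj hμ hconj fun _ _ _ _ => mem_univ _]
  · rw [joinArcs_of_neg (by norm_num), neg_neg, hh₁, compactify_one]
  · rw [joinArcs_of_nonneg le_rfl, h₂0]
  · rw [joinArcs_of_nonneg zero_le_one, hh₂, compactify_one]
  · rw [im]
    exact hU

end InvariantArc

end TwoVolterra

theorem theorem2 (a b c : ℝ) (ha : a ∈ Set.Ico (0 : ℝ) 1) (hb : b ∈ Set.Icc (0 : ℝ) (1 / 2))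
    (hc : c ∈ Set.Icc (0 : ℝ) 1) :
    -- (i)
    (c ≤ 1 / 2 →
      TwoVolterra.fixedSet a b c = {TwoVolterra.lam0} ∧
      ∀ p ∈ TwoVolterra.T,
        Tendsto (fun n : ℕ => (TwoVolterra.V a b c)^[n] p) atTop (𝓝 TwoVolterra.lam0)) ∧
    -- (ii)
    (MapsTo (TwoVolterra.V a b c) TwoVolterra.T TwoVolterra.T ∧
      MapsTo (TwoVolterra.V a b c) TwoVolterra.MZero TwoVolterra.MZero ∧
      MapsTo (TwoVolterra.V a b c) TwoVolterra.MOne TwoVolterra.MOne ∧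
      MapsTo (TwoVolterra.V a b c) TwoVolterra.MEq TwoVolterra.MEq ∧
      (0 < a →
        MapsTo (TwoVolterra.V a b c) TwoVolterra.MGt TwoVolterra.MGt ∧
        MapsTo (TwoVolterra.V a b c) TwoVolterra.MLt TwoVolterra.MLt) ∧
      (0 < c →
        MapsTo (TwoVolterra.V a b c) (TwoVolterra.MGt ∩ {p | p 0 + p 1 < 1})
          (TwoVolterra.MGt ∩ {p | p 0 + p 1 < 1}) ∧
        MapsTo (TwoVolterra.V a b c) (TwoVolterra.MLt ∩ {p | p 0 + p 1 < 1})
          (TwoVolterra.MLt ∩ {p | p 0 + p 1 < 1})) ∧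
      MapsTo (TwoVolterra.V a b c) (TwoVolterra.MGt ∪ TwoVolterra.MEq)
        (TwoVolterra.MGt ∪ TwoVolterra.MEq) ∧
      MapsTo (TwoVolterra.V a b c) (TwoVolterra.MLt ∪ TwoVolterra.MEq)
        (TwoVolterra.MLt ∪ TwoVolterra.MEq)) ∧
    -- (iii)
    (1 / 2 < c → a ≠ 2 * b →
      TwoVolterra.fixedSet a b c =
        {TwoVolterra.lam0, TwoVolterra.lam1 a c, TwoVolterra.lam2 a c, TwoVolterra.lam3 a b c} ∧
      (TwoVolterra.fixedSet a b c).ncard = 4 ∧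
      TwoVolterra.IsRepelling (TwoVolterra.V a b c) TwoVolterra.lam0 ∧
      (2 * b < a →
        TwoVolterra.IsAttracting (TwoVolterra.V a b c) (TwoVolterra.lam1 a c) ∧
        TwoVolterra.IsAttracting (TwoVolterra.V a b c) (TwoVolterra.lam2 a c) ∧
        TwoVolterra.IsSaddle (TwoVolterra.V a b c) (TwoVolterra.lam3 a b c)) ∧
      (a < 2 * b →
        TwoVolterra.IsSaddle (TwoVolterra.V a b c) (TwoVolterra.lam1 a c) ∧
        TwoVolterra.IsSaddle (TwoVolterra.V a b c) (TwoVolterra.lam2 a c) ∧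
        TwoVolterra.IsAttracting (TwoVolterra.V a b c) (TwoVolterra.lam3 a b c))) ∧
    -- (iv)
    (1 / 2 < c → a = 2 * b →
      TwoVolterra.fixedSet a b c = {TwoVolterra.lam0} ∪ TwoVolterra.segF b c ∧
      Cardinal.mk (TwoVolterra.segF b c) = Cardinal.continuum ∧
      TwoVolterra.IsRepelling (TwoVolterra.V a b c) TwoVolterra.lam0 ∧
      (∀ ν : ℝ, 0 ≤ ν →
        MapsTo (TwoVolterra.V a b c) (TwoVolterra.ray ν) (TwoVolterra.ray ν) ∧
        TwoVolterra.lamBar b c ν ∈ TwoVolterra.ray ν ∩ TwoVolterra.segF b c ∧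
        ∀ p ∈ TwoVolterra.T, p 0 ≠ 0 → p 1 / p 0 = ν → (0 < b ∨ p 0 + p 1 < 1) →
          Tendsto (fun n : ℕ => (TwoVolterra.V a b c)^[n] p) atTop
            (𝓝 (TwoVolterra.lamBar b c ν))) ∧
      (∀ p ∈ TwoVolterra.MZero, p 1 ≠ 0 → (0 < b ∨ p 1 < 1) →
        Tendsto (fun n : ℕ => (TwoVolterra.V a b c)^[n] p) atTop
          (𝓝 (TwoVolterra.lam1 a c)))) ∧
    -- (v)
    (1 / 2 < c →
      (a < 2 * b →
        TwoVolterra.IsStableManifold (TwoVolterra.V a b c) TwoVolterra.T (TwoVolterra.lam1 a c)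
          {p | p ∈ TwoVolterra.MZero ∧ p 1 ≠ 0 ∧ (0 < a ∨ p 1 < 1)} ∧
        TwoVolterra.IsStableManifold (TwoVolterra.V a b c) TwoVolterra.T (TwoVolterra.lam2 a c)
          {p | p ∈ TwoVolterra.MOne ∧ p 0 ≠ 0 ∧ (0 < a ∨ p 0 < 1)}) ∧
      (2 * b < a →
        TwoVolterra.IsStableManifold (TwoVolterra.V a b c) TwoVolterra.T (TwoVolterra.lam3 a b c)
          (TwoVolterra.MEq \ {TwoVolterra.lam0})) ∧
      (a ≠ 2 * b →
        ∃ γ : ℝ → (Fin 2 → ℝ),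
          ContinuousOn γ (Icc (-1) 1) ∧ InjOn γ (Icc (-1) 1) ∧
          MapsTo γ (Icc (-1) 1) TwoVolterra.T ∧
          TwoVolterra.V a b c '' (γ '' Icc (-1) 1) = γ '' Icc (-1) 1 ∧
          γ (-1) = TwoVolterra.lam1 a c ∧ γ 0 = TwoVolterra.lam3 a b c ∧
          γ 1 = TwoVolterra.lam2 a c ∧
          (a < 2 * b →
            TwoVolterra.IsUnstableManifold (TwoVolterra.V a b c) TwoVolterra.T
              (TwoVolterra.lam1 a c) (γ '' Ico (-1) 0) ∧
            TwoVolterra.IsUnstableManifold (TwoVolterra.V a b c) TwoVolterra.T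
              (TwoVolterra.lam2 a c) (γ '' Ioc 0 1)) ∧
          (2 * b < a →
            TwoVolterra.IsUnstableManifold (TwoVolterra.V a b c) TwoVolterra.T
              (TwoVolterra.lam3 a b c) (γ '' Ioo (-1) 1)))) := by
  have H : TwoVolterra.Admissible a b c := ⟨ha.1, ha.2, hb.1, hb.2, hc.1, hc.2⟩
  refine ⟨fun h => ⟨TwoVolterra.fixedSet_of_le_half H h,
      fun p hp => TwoVolterra.tendsto_lam0_of_le_half H h hp⟩,
    ⟨TwoVolterra.mapsTo_T H, TwoVolterra.mapsTo_MZero H, TwoVolterra.mapsTo_MOne H,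
      TwoVolterra.mapsTo_MEq H,
      fun h => ⟨TwoVolterra.mapsTo_MGt H h, TwoVolterra.mapsTo_MLt H h⟩,
      fun h => ⟨TwoVolterra.mapsTo_MGt_inter H h, TwoVolterra.mapsTo_MLt_inter H h⟩,
      TwoVolterra.mapsTo_MGt_union H, TwoVolterra.mapsTo_MLt_union H⟩,
    fun h hab => ⟨TwoVolterra.fixedSet_eq H h hab, TwoVolterra.ncard_fixedSet H h hab,
      TwoVolterra.isRepelling_lam0 h,
      fun hlt => ⟨(TwoVolterra.isAttracting_edge H h hlt).1,
        (TwoVolterra.isAttracting_edge H h hlt).2, TwoVolterra.isSaddle_lam3 H h hlt⟩,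
      fun hlt => ⟨(TwoVolterra.isSaddle_edge H h hlt).1,
        (TwoVolterra.isSaddle_edge H h hlt).2, TwoVolterra.isAttracting_lam3 H h hlt⟩⟩,
    fun h hab => ⟨TwoVolterra.fixedSet_of_eq H h hab, TwoVolterra.mk_segF H h hab,
      TwoVolterra.isRepelling_lam0 h, fun ν hν => ⟨TwoVolterra.mapsTo_ray H hab ν,
        TwoVolterra.lamBar_mem H h hab hν, ?_⟩, fun p hp hp1 hbp =>
        TwoVolterra.tendsto_lam1_of_mem_MZero H h hp hp1 (hbp.imp_left fun hb0 => by linarith)⟩,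
    fun h => ⟨fun hab => ⟨TwoVolterra.isStableManifold_lam1 H h hab,
      TwoVolterra.isStableManifold_lam2 H h hab⟩,
      fun hab => TwoVolterra.isStableManifold_lam3 H h hab, fun hab => ?_⟩⟩
  · rintro p hp hp0 rfl hbp
    exact TwoVolterra.tendsto_lamBar H h hab hp hp0 hbp
  · rcases lt_or_gt_of_ne hab with hlt | hgt
    · obtain ⟨γ, h1, h2, h3, h4, h5, h6, h7, h8, h9⟩ := TwoVolterra.arc_of_lt H h hlt
      exact ⟨γ, h1, h2, h3, h4, h5, h6, h7, fun _ => ⟨h8, h9⟩, fun hgt => absurd hgt hlt.not_gt⟩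
    · obtain ⟨γ, h1, h2, h3, h4, h5, h6, h7, h8⟩ := TwoVolterra.arc_of_gt H h hgt
      exact ⟨γ, h1, h2, h3, h4, h5, h6, h7, fun hlt => absurd hlt hgt.not_gt, fun _ => h8⟩
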